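/- **Setting.** Let $\epsilon>0$ be real, $M\ge 1$ an integer, $G$ a tree with $n$ nodes, and let a set of original links (unordered pairs of nodes of $G$) be given, each link $o$ with a cost $c_o\in[1,M]$. For nodes $p,q$ let $P_{pq}\subseteq E[G]$ be the edge set of the $p$-$q$ path. Let $L$ be the shadow completion: for every original link $o$ and all $p,q$ with $P_{pq}\subseteq P_o$ (including $p=q$) it contains a link $pq$ of cost $c_o$, labelled by $o$ (parallel links with different labels are allowed); these links are the shadows of $o$. A link covers the edges of its path; $\mathrm{cov}(X)$ is the set of links in $L$ that cover at least one edge of $X$, and $\mathrm{OPT}(X)$ is the minimum cost of a set of links in $L$ that covers all edges in $X\subseteq E[G]$. A $\gamma$-bundle is a union of $\gamma$ (not necessarily distinct) paths of $G$, and $\mathrm{LP}_\gamma$ is: minimize $c^Tx$ over $x\in\mathbb R_{\ge0}^L$ subject to $x(\mathrm{cov}(e))\ge1$ for all $e\in E[G]$ and $\sum_{\ell\in \mathrm{cov}(B)}c_\ell x_\ell\ge \mathrm{OPT}(B)$ for all $\gamma$-bundles $B$. Let $\gamma\ge 200M/\epsilon^2$ be an integer and $x$ an optimal solution of $\mathrm{LP}_\gamma$.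 *Contraction.* Let $E^h=\{e: x(\mathrm{cov}(e))\ge 2/\epsilon\}$, and let $\bar G$ be the tree obtained from $G$ by contracting the edges in $E^h$, so that $E[\bar G]=E[G]\setminus E^h$. Let $L_0\subseteq L$ be any set of links that covers $E^h$. For $u\in V[\bar G]$ let $s_u$ be the total cost of the links in $L_0$ that cover at least one edge contracted into $u$ (so $s_u=0$ if $u$ is not a compound node). Interpret $x$ as a vector on the links of $\bar G$. *Decomposition.* For a subtree $T$ of $\bar G$, a vector $z\ge0$ on links between nodes of $T$, and an edge $e=\{u,v\}$ of $T$, let $T^u\ni u$ and $T^v\ni v$ be the components of $T-e$. The edge $e$ is $\alpha$-thin if for $q=u$ and for $q=v$ the cost in $z$ of the links with both ends in $V[T^q]$ is at least $\alpha$. Splitting $z$ at $e$ produces $z^u$ and $z^v$: $z^u$ keeps the values of the links inside $T^u$, adds the value of each link $pp'$ with $p\in V[T^u]$, $p'\in V[T^v]$ to its shadow $pu$ with the same label (hence of the same cost), and is zero elsewhere; $z^v$ is defined symmetrically. Starting with $(\bar G,x)$, as long as some pair $(T,z)$ has a $\frac{4M}{\epsilon^2}$-thin edge, replace it by $(T^u,z^u)$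 and $(T^v,z^v)$ for such an edge. Let $(T,z)$ be a pair in a final decomposition obtained in this way. Call $r\in V[T]$ a *center* of $(T,z)$ if each tree $K$ of $T-r$ has at most $\beta=\frac{48M}{\epsilon^2}$ leaves and the cost in $z$ of the links with both ends in $V[K]$ is at most $\beta$. Given a center $r$, a link between two different trees of $T-r$ is a cross-link; $z^{cr}$ is the restriction of $z$ to cross-links and $z^{in}=z-z^{cr}$. Let $y$ arise from $z^{in}$ by adding the value of each cross-link $pq$ to each of its two shadows $pr$ and $qr$ with the same label, and setting the values of self-loops at $r$ to zero. For a tree $K$ of $T-r$ let $\bar R$ be the subtree of $T$ with node set $V[K]\cup\{r\}$, and let $\bar y$ be the restriction of $y$ to links with both ends in $V[\bar R]$. **Lemma.** (a) For every center $r$ of $(T,z)$ and every tree $K$ of $T-r$: $E[\bar R]$ is a $\gamma$-bundle of $G$ or $\mathrm{OPT}(E[\bar R])\le\sum_{u\in V[\bar R]}s_u$; and in either case $$\mathrm{OPT}(E[\bar R])\le c^T\bar y+\sum_{u\in V[\bar R]}s_u .$$ (b) For every $\epsilon>0$ there are an algorithm and a constant $C$ such that, for all data as above for which $(T,z)$ has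 a center, the algorithm, given $M$, the instance ($G$, the original links, their costs), $T$ and $z$, computes a set $S\subseteq L$ of links that covers $E[T]$ and satisfies, for every center $r$ of $(T,z)$ and every $L_0$ as above, $$c(S)\le c^Tz^{in}+2c^Tz^{cr}+\sum_{u\in V[T]}s_u ,$$ in at most $n^{C M}$ steps if $n\ge2$. (Steps are elementary operations on lists and pairs, and additions and comparisons of real numbers.) -/

import Mathlib

namespace TreeAug

noncomputable section

open scoped Classical

/-! ### Paths, subtrees, leaves -/

/-- For a pair `s = {p, q}` of nodes of a tree `H`: the edge set of the `p`-`q` path in `H`. -/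
def pathEdges {N : Type*} (H : SimpleGraph N) (s : Sym2 N) : Set (Sym2 N) :=
  {e | ∃ p q, s = s(p, q) ∧ ∃ w : H.Walk p q, w.IsPath ∧ e ∈ w.edges}

/-- The node set of the component containing `u` of the subtree `T` minus the edge `{u, v}`.
A subtree of a tree `H` is represented by its node set `T`. -/
def side {N : Type*} (H : SimpleGraph N) (T : Set N) (u v : N) : Set N :=
  {w | w ∈ T ∧ (H.deleteEdges {s(u, v)}).Reachable u w}

/-- The trees (as node sets) obtained from the subtree `T` by removing the node `r`. -/
def branches {N : Type*} (H : SimpleGraph N) (T : Set N) (r : N) : Set (Set N) :=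
  {K | ∃ C : (H.induce (T \ {r})).ConnectedComponent, K = Subtype.val '' C.supp}

/-- The number of leaves (nodes of degree one) of the subtree with node set `K`. -/
def leafCount {N : Type*} (H : SimpleGraph N) (K : Set N) : ℕ :=
  {a | a ∈ K ∧ (H.neighborSet a ∩ K).ncard = 1}.ncard

/-! ### Fractional solutions on a tree

In a tree with node set `N`, a link is a pair `(o, s)`: its end nodes are the two nodes of `s`, and
`o` names the original link of which it is a shadow. It has the cost `c o` of that link. -/

section Fractional

variable {O N : Type*} [Fintype O] [Fintype N]

/-- `cᵀ z`. -/
def totalCost (c : O → ℝ) (z : O × Sym2 N → ℝ) : ℝ := ∑ l, c l.1 * z l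

/-- The total cost in `z` of the links connecting two nodes of `A`. -/
def costWithin (c : O → ℝ) (z : O × Sym2 N → ℝ) (A : Set N) : ℝ :=
  ∑ l with ∀ a ∈ l.2, a ∈ A, c l.1 * z l

/-- The edge `{u, v}` of the subtree `T` is `α`-thin with respect to `z`. -/
def IsThin (H : SimpleGraph N) (c : O → ℝ) (α : ℝ) (T : Set N) (z : O × Sym2 N → ℝ)
    (u v : N) : Prop :=
  u ∈ T ∧ v ∈ T ∧ H.Adj u v ∧
    α ≤ costWithin c z (side H T u v) ∧ α ≤ costWithin c z (side H T v u)

/-- The splitting `z^u` of `z` at the edge `{u, v}` of the subtree `T`: links inside the side of `u`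
keep their value, the value of a link with end nodes `q` in the side of `u` and `q'` in the side of
`v` is added to its shadow with end nodes `q` and `u`, all other links are dropped. -/
def splitAt (H : SimpleGraph N) (T : Set N) (z : O × Sym2 N → ℝ) (u v : N) : O × Sym2 N → ℝ :=
  fun l => ∑ l' with (∃ a ∈ l'.2, a ∈ side H T u v) ∧
    l = (l'.1, l'.2.map fun a => if a ∈ side H T u v then a else u), z l'

/-- `IsDecomposition H c α (T, z) D`: the greedy procedure, which splits at `α`-thin edges as long
as there are any, can turn the pair `(T, z)` into the list `D` of pairs. -/
inductive IsDecomposition (H : SimpleGraph N) (c : O → ℝ) (α : ℝ) :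
    Set N × (O × Sym2 N → ℝ) → List (Set N × (O × Sym2 N → ℝ)) → Prop
  | done (T : Set N) (z : O × Sym2 N → ℝ) (h : ∀ u v, ¬ IsThin H c α T z u v) :
      IsDecomposition H c α (T, z) [(T, z)]
  | split (T : Set N) (z : O × Sym2 N → ℝ) (u v : N) (h : IsThin H c α T z u v)
      (D D' : List (Set N × (O × Sym2 N → ℝ)))
      (hu : IsDecomposition H c α (side H T u v, splitAt H T z u v) D)
      (hv : IsDecomposition H c α (side H T v u, splitAt H T z v u) D') :
      IsDecomposition H c α (T, z) (D ++ D')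

/-- `r` is a `β`-center of `(T, z)`; a pair that has one is called `β`-simple. -/
def IsCenter (H : SimpleGraph N) (c : O → ℝ) (β : ℝ) (T : Set N) (z : O × Sym2 N → ℝ)
    (r : N) : Prop :=
  r ∈ T ∧ ∀ K ∈ branches H T r, costWithin c z K ≤ β ∧ (leafCount H K : ℝ) ≤ β

/-- The pair `s` of nodes connects two different trees of `T - r`. -/
def IsCross (H : SimpleGraph N) (T : Set N) (r : N) (s : Sym2 N) : Prop :=
  ∃ K ∈ branches H T r, ∃ K' ∈ branches H T r, K ≠ K' ∧ ∃ a ∈ K, ∃ b ∈ K', s = s(a, b)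

/-- `z^cr`, the part of `z` on cross-links. -/
def crossPart (H : SimpleGraph N) (T : Set N) (r : N) (z : O × Sym2 N → ℝ) : O × Sym2 N → ℝ :=
  fun l => if IsCross H T r l.2 then z l else 0

/-- `z^in`, the part of `z` on in-links. -/
def inPart (H : SimpleGraph N) (T : Set N) (r : N) (z : O × Sym2 N → ℝ) : O × Sym2 N → ℝ :=
  fun l => z l - crossPart H T r z l

/-- The vector `y` obtained from `z` by replacing each cross-link `{p, q}` by its two shadows
`{p, r}` and `{q, r}`, without the self-loops of `r`. -/
def rootSplit (H : SimpleGraph N) (T : Set N) (r : N) (z : O × Sym2 N → ℝ) : O × Sym2 N → ℝ :=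
  fun l =>
    if r ∉ l.2 then inPart H T r z l
    else if l.2.IsDiag then 0
    else z l + ∑ l' with l'.1 = l.1 ∧ IsCross H T r l'.2 ∧ ∃ q ∈ l.2, q ≠ r ∧ q ∈ l'.2, z l'

/-- The restriction of `y` to links with both end nodes in `A`. -/
def restrictTo (A : Set N) (y : O × Sym2 N → ℝ) : O × Sym2 N → ℝ :=
  fun l => if ∀ a ∈ l.2, a ∈ A then y l else 0

end Fractional

end

/-! ### Instances -/

/-- An instance of the weighted tree augmentation problem on the nodes `0, …, n - 1`, given by a
tree, a set of links, and link costs. -/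
structure Instance (n : ℕ) where
  tree : SimpleGraph (Fin n)
  isTree : tree.IsTree
  origLinks : Finset (Sym2 (Fin n))
  cost : Sym2 (Fin n) → ℝ

namespace Instance

noncomputable section

open scoped Classical

variable {n : ℕ}

/-- The links of the shadow completion: `(o, s)` is the shadow of the original link `o` with end
nodes `s`; its cost is `cost o`. The original link `o` itself is `(o, o)`. -/
abbrev Link (I : Instance n) : Type :=
  {l : Sym2 (Fin n) × Sym2 (Fin n) //
    l.1 ∈ I.origLinks ∧ pathEdges I.tree l.2 ⊆ pathEdges I.tree l.1}

/-- `c(S)`. -/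
def setCost (I : Instance n) (S : Finset I.Link) : ℝ := ∑ l ∈ S, I.cost l.1.1

/-- The set `S` of links covers all edges in `X`. -/
def Covers (I : Instance n) (S : Finset I.Link) (X : Set (Sym2 (Fin n))) : Prop :=
  ∀ e ∈ X, ∃ l ∈ S, e ∈ pathEdges I.tree l.1.2

/-- `OPT(X)`: the minimum cost of a set of links that covers `X`. -/
def opt (I : Instance n) (X : Set (Sym2 (Fin n))) : ℝ :=
  sInf {t | ∃ S : Finset I.Link, I.Covers S X ∧ t = I.setCost S}

/-- `x(cov(e))`. -/
def coverage (I : Instance n) (x : I.Link → ℝ) (e : Sym2 (Fin n)) : ℝ :=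
  ∑ l with e ∈ pathEdges I.tree l.1.2, x l

/-- `B` is a union of `γ` (not necessarily distinct) paths. -/
def IsBundle (I : Instance n) (γ : ℕ) (B : Set (Sym2 (Fin n))) : Prop :=
  ∃ p : Fin γ → Sym2 (Fin n), B = ⋃ i, pathEdges I.tree (p i)

/-- The objective function `cᵀ x`. -/
def objective (I : Instance n) (x : I.Link → ℝ) : ℝ := ∑ l, I.cost l.1.1 * x l

/-- `x` is feasible for the `γ`-bundle LP. -/
structure IsFeasible (I : Instance n) (γ : ℕ) (x : I.Link → ℝ) : Prop where
  nonneg : ∀ l, 0 ≤ x l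
  cut : ∀ e ∈ I.tree.edgeSet, 1 ≤ I.coverage x e
  bundle : ∀ B, I.IsBundle γ B →
    I.opt B ≤ ∑ l with ∃ e ∈ B, e ∈ pathEdges I.tree l.1.2, I.cost l.1.1 * x l

/-- `x` is an optimal solution of the `γ`-bundle LP. -/
def IsOptimal (I : Instance n) (γ : ℕ) (x : I.Link → ℝ) : Prop :=
  I.IsFeasible γ x ∧ ∀ x', I.IsFeasible γ x' → I.objective x ≤ I.objective x'

/-! ### Contraction of the heavily covered edges -/

/-- The set `E^h` of heavily covered edges. -/
def heavy (I : Instance n) (x : I.Link → ℝ) (ε : ℝ) : Set (Sym2 (Fin n)) :=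
  {e | e ∈ I.tree.edgeSet ∧ 2 / ε ≤ I.coverage x e}

/-- The nodes of the contracted tree: the components of the forest formed by the heavy edges. -/
def Node (I : Instance n) (x : I.Link → ℝ) (ε : ℝ) : Type :=
  (SimpleGraph.fromEdgeSet (I.heavy x ε)).ConnectedComponent

/-- The node of the contracted tree that represents the original node `p`. -/
def node (I : Instance n) (x : I.Link → ℝ) (ε : ℝ) (p : Fin n) : I.Node x ε :=
  (SimpleGraph.fromEdgeSet (I.heavy x ε)).connectedComponentMk p

theorem node_surjective (I : Instance n) (x : I.Link → ℝ) (ε : ℝ) :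
    Function.Surjective (I.node x ε) := fun a => Quot.exists_rep a

instance (I : Instance n) (x : I.Link → ℝ) (ε : ℝ) : Fintype (I.Node x ε) :=
  Fintype.ofSurjective _ (I.node_surjective x ε)

/-- The tree obtained by contracting the heavy edges. -/
def contracted (I : Instance n) (x : I.Link → ℝ) (ε : ℝ) : SimpleGraph (I.Node x ε) where
  Adj a b := a ≠ b ∧ ∃ p q, I.node x ε p = a ∧ I.node x ε q = b ∧ I.tree.Adj p q
  symm := ⟨fun _ _ ⟨h, p, q, hp, hq, hpq⟩ => ⟨h.symm, q, p, hq, hp, hpq.symm⟩⟩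
  loopless := ⟨fun _ h => h.1 rfl⟩

/-- The vector `x`, interpreted in the contracted tree. (Shadows of one original link that become
parallel are merged, and their values added.) -/
def contractedVec (I : Instance n) (x : I.Link → ℝ) (ε : ℝ) :
    Sym2 (Fin n) × Sym2 (I.Node x ε) → ℝ :=
  fun l => ∑ l' with l = (l'.1.1, l'.1.2.map (I.node x ε)), x l'

/-- The edge set of the subtree with node set `A` of the contracted tree, as a set of edges of the
original tree. -/
def edgesOf (I : Instance n) (x : I.Link → ℝ) (ε : ℝ) (A : Set (I.Node x ε)) :
    Set (Sym2 (Fin n)) :=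
  {e | ∃ p q, e = s(p, q) ∧ I.tree.Adj p q ∧ I.node x ε p ≠ I.node x ε q ∧
    I.node x ε p ∈ A ∧ I.node x ε q ∈ A}

/-- `s_u`: the total cost of the links in `L₀` that cover an edge contracted into the node `u`.
It is `0` unless `u` is a compound node. -/
def charge (I : Instance n) (x : I.Link → ℝ) (ε : ℝ) (L₀ : Finset I.Link)
    (u : I.Node x ε) : ℝ :=
  ∑ l ∈ L₀ with ∃ e ∈ I.heavy x ε, (∀ p ∈ e, I.node x ε p = u) ∧ e ∈ pathEdges I.tree l.1.2,
    I.cost l.1.1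

/-- The sum of `s_u` over the nodes `u` in `A`. -/
def chargeOn (I : Instance n) (x : I.Link → ℝ) (ε : ℝ) (L₀ : Finset I.Link)
    (A : Set (I.Node x ε)) : ℝ :=
  ∑ u with u ∈ A, I.charge x ε L₀ u

/-- `(T, z)` is part of a decomposition of the contracted tree that the greedy procedure, run with
thinness parameter `4M / ε²`, can produce. -/
def IsPart (I : Instance n) (M : ℕ) (ε : ℝ) (x : I.Link → ℝ) (T : Set (I.Node x ε))
    (z : Sym2 (Fin n) × Sym2 (I.Node x ε) → ℝ) : Prop :=
  ∃ D, IsDecomposition (I.contracted x ε) I.cost (4 * M / ε ^ 2)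
    (Set.univ, I.contractedVec x ε) D ∧ (T, z) ∈ D

/-- `r` is a `β`-center of `(T, z)` for `β = 48M / ε²`. -/
def IsRoot (I : Instance n) (M : ℕ) (ε : ℝ) (x : I.Link → ℝ) (T : Set (I.Node x ε))
    (z : Sym2 (Fin n) × Sym2 (I.Node x ε) → ℝ) (r : I.Node x ε) : Prop :=
  IsCenter (I.contracted x ε) I.cost (48 * M / ε ^ 2) T z r

end

end Instance

/-! ### Machine model

Programs act on binary trees whose leaves are `nil` or real numbers. Every elementary operation
(making or taking apart a pair, testing for `nil`, adding or comparing two reals) takes one step.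
There is no conversion of reals into anything else. -/

inductive Val : Type
  | nil : Val
  | real (a : ℝ) : Val
  | pair (v w : Val) : Val

inductive Prog : Type
  | id : Prog
  | nil : Prog
  | zero : Prog
  | fst : Prog
  | snd : Prog
  | add : Prog
  | le : Prog
  | pair (f g : Prog) : Prog
  | comp (f g : Prog) : Prog
  | ite (b f g : Prog) : Prog
  | loop (b f : Prog) : Prog

noncomputable section

open scoped Classical

def Val.fst : Val → Val
  | .pair v _ => v
  | _ => .nil

def Val.snd : Val → Val
  | .pair _ w => w
  | _ => .nil

def Val.add : Val → Val
  | .pair (.real a) (.real b) => .real (a + b)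
  | _ => .nil

/-- Comparison of two reals; true is `pair nil nil`, false is `nil`. -/
def Val.le : Val → Val
  | .pair (.real a) (.real b) => if a ≤ b then .pair .nil .nil else .nil
  | _ => .nil

/-- `Run p v w t`: the program `p`, started on `v`, stops with the result `w` after `t` steps.
`comp f g` runs `f` and then `g`; `ite b f g` runs `f` if the result of `b` is not `nil` and `g`
otherwise; `loop b f` repeats `f` as long as the result of `b` is not `nil`. -/
inductive Run : Prog → Val → Val → ℕ → Prop
  | id (v : Val) : Run .id v v 1
  | nil (v : Val) : Run .nil v .nil 1
  | zero (v : Val) : Run .zero v (.real 0) 1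
  | fst (v : Val) : Run .fst v v.fst 1
  | snd (v : Val) : Run .snd v v.snd 1
  | add (v : Val) : Run .add v v.add 1
  | le (v : Val) : Run .le v v.le 1
  | pair {f g : Prog} {v w₁ w₂ : Val} {t₁ t₂ : ℕ} (h₁ : Run f v w₁ t₁) (h₂ : Run g v w₂ t₂) :
      Run (.pair f g) v (.pair w₁ w₂) (t₁ + t₂ + 1)
  | comp {f g : Prog} {v w w' : Val} {t₁ t₂ : ℕ} (h₁ : Run f v w t₁) (h₂ : Run g w w' t₂) :
      Run (.comp f g) v w' (t₁ + t₂ + 1)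
  | ite_true {b f g : Prog} {v a w : Val} {t₁ t₂ : ℕ} (h₁ : Run b v a t₁) (ha : a ≠ .nil)
      (h₂ : Run f v w t₂) : Run (.ite b f g) v w (t₁ + t₂ + 1)
  | ite_false {b f g : Prog} {v w : Val} {t₁ t₂ : ℕ} (h₁ : Run b v .nil t₁)
      (h₂ : Run g v w t₂) : Run (.ite b f g) v w (t₁ + t₂ + 1)
  | loop_stop {b f : Prog} {v : Val} {t : ℕ} (h : Run b v .nil t) : Run (.loop b f) v v (t + 1)
  | loop_step {b f : Prog} {v a v' w : Val} {t₁ t₂ t₃ : ℕ} (h₁ : Run b v a t₁) (ha : a ≠ .nil)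
      (h₂ : Run f v v' t₂) (h₃ : Run (.loop b f) v' w t₃) :
      Run (.loop b f) v w (t₁ + t₂ + t₃ + 1)

/-! ### Encodings -/

def Val.nat : ℕ → Val
  | 0 => .nil
  | k + 1 => .pair .nil (Val.nat k)

def Val.list : List Val → Val
  | [] => .nil
  | v :: l => .pair v (Val.list l)

/-- Code of an unordered pair of original nodes, smaller node first. -/
def encPair {n : ℕ} (s : Sym2 (Fin n)) : Val := .pair (.nat s.inf) (.nat s.sup)

namespace Instance

variable {n : ℕ}

/-- Code of a list of links of the shadow completion. -/
def encLinks (I : Instance n) (S : List I.Link) : Val :=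
  .list (S.map fun l => .pair (encPair l.1.1) (encPair l.1.2))

/-- Code of the tree: the list of its edges. -/
def encTree (I : Instance n) : Val :=
  .list (((List.finRange n).sym2.filter fun e => decide (e ∈ I.tree.edgeSet)).map encPair)

/-- The original links, in a fixed order. -/
def linkList (I : Instance n) : List (Sym2 (Fin n)) :=
  (List.finRange n).sym2.filter fun o => decide (o ∈ I.origLinks)

/-- Code of the original links and their costs. -/
def encCosts (I : Instance n) : Val :=
  .list (I.linkList.map fun o => .pair (encPair o) (.real (I.cost o)))

/-- Code of a node of the contracted tree: the list of the original nodes it represents. -/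
def encNode (I : Instance n) (x : I.Link → ℝ) (ε : ℝ) (a : I.Node x ε) : Val :=
  .list (((List.finRange n).filter fun p => decide (I.node x ε p = a)).map fun p => .nat p)

/-- The nodes in `T`, in a fixed order. -/
def nodeList (I : Instance n) (x : I.Link → ℝ) (ε : ℝ) (T : Set (I.Node x ε)) :
    List (I.Node x ε) :=
  ((List.finRange n).map (I.node x ε)).dedup.filter fun a => decide (a ∈ T)

/-- Code of `z`: all its values on links with both end nodes in `T`. -/
def encVec (I : Instance n) (x : I.Link → ℝ) (ε : ℝ) (T : Set (I.Node x ε))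
    (z : Sym2 (Fin n) × Sym2 (I.Node x ε) → ℝ) : Val :=
  .list (I.linkList.flatMap fun o => (I.nodeList x ε T).flatMap fun a =>
    (I.nodeList x ε T).map fun b =>
      .pair (encPair o) (.pair (I.encNode x ε a) (.pair (I.encNode x ε b)
        (.real (z (o, s(a, b)))))))

/-- The input of the algorithm: `n`, `M`, the instance, and the pair `(T, z)`. -/
def encInput (I : Instance n) (M : ℕ) (ε : ℝ) (x : I.Link → ℝ) (T : Set (I.Node x ε))
    (z : Sym2 (Fin n) × Sym2 (I.Node x ε) → ℝ) : Val :=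
  .pair (.nat n) (.pair (.nat M) (.pair I.encTree (.pair I.encCosts
    (.pair (.list ((I.nodeList x ε T).map (I.encNode x ε))) (I.encVec x ε T z)))))

/-- A list of links, as a set. -/
def toSet (I : Instance n) (S : List I.Link) : Finset I.Link := S.toFinset

end Instance

end

end TreeAug

open TreeAug

/-! Everything is expressed by separation. An edge of a tree lies on the p-q path iff deleting it
separates p from q (`mem_pathEdges`), the node sets that the edges cut off from a root form a
laminar family (`sep_laminar`), and contraction does not change what a surviving edge separates
(`sep_contracted_iff`). So the argument can be carried out in G.

Every pair (T, z) of the decomposition is the image of x under a retraction φ of the nodes onto T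
that moves no node across an edge of T (`IsImage`, `exists_isImage`). Hence a link covers an edge of
R̄ only if its image is not a loop and has an end in K (`IsRootEdge.image_of_covers`). The cost in x
of the links that cover E[R̄] is therefore at most the cost in z of the links meeting K, and this is
at most the cost of ȳ (`costMeeting_le_totalCost`). If E[R̄] is a γ-bundle, its bundle constraint
finishes (a).

The set E[R̄] is a union of maximal ascending paths, and each of them starts in a leaf of K, in a
compound node, or in the topmost node of K. If there are more than γ of them, then K has many
compound nodes, since it has few leaves (`IsRootEdge.isBundle_or`). Each compound node contributes
at least 1 to the sum of the s_u, because L₀ covers its heavy edges and all costs are at least 1. On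
the other hand, OPT is at most twice the cost of the links that cover R̄: cutting every link at its
highest node leaves ascending links, for which the covering LP has no integrality gap
(`exists_cover_le`, `Instance.opt_le_two_mul_coverCost`). These links stay within K, at cost at most
β, or cover the light edge from K to r. The constants are such that OPT is smaller than the number
of compound nodes (`IsRootEdge.isBundle_or_opt_le`).

For (b), a dynamic program computes OPT on every branch. It always adds a link that covers a topmost
uncovered edge; then the set of uncovered edges stays closed under descending (`downClosed_cons`).
Such a set is determined by its topmost edge above each lowest edge, so at most n ^ (leaves + 1)
sets occur (`card_downClosed_le`), and one cheapest partial solution is kept for each. All nodes of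
T are tried as centers and the cheapest result is returned. An in-link meets at most one branch and
a cross-link at most two (`sum_costMeeting_le`), so summing over the branches gives the bound.
Tables are capped at n ^ (b * M + 1) entries, hence the whole computation is polynomial in n ^ M
(`exists_prog`). -/

namespace TreeAug

/-! ### A calculus of polynomial-time programs on lists. -/

/-! ### Polynomial bounds -/

/-- `g` is bounded by a power of its argument on `[2, ∞)`. -/
def PolyBound (g : ℕ → ℕ) : Prop := ∃ d, ∀ s, 2 ≤ s → g s ≤ s ^ d

namespace PolyBound

theorem pow (d : ℕ) : PolyBound fun s => s ^ d := ⟨d, fun _ _ => le_rfl⟩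

theorem self : PolyBound fun s => s := ⟨1, fun s _ => by simp⟩

theorem const (c : ℕ) : PolyBound fun _ => c :=
  ⟨c, fun _ hs => Nat.lt_two_pow_self.le.trans (Nat.pow_le_pow_left hs c)⟩

theorem mul {f g : ℕ → ℕ} (hf : PolyBound f) (hg : PolyBound g) :
    PolyBound fun s => f s * g s := by
  obtain ⟨a, ha⟩ := hf
  obtain ⟨b, hb⟩ := hg
  exact ⟨a + b, fun s hs => by rw [pow_add]; exact Nat.mul_le_mul (ha s hs) (hb s hs)⟩

theorem add {f g : ℕ → ℕ} (hf : PolyBound f) (hg : PolyBound g) :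
    PolyBound fun s => f s + g s := by
  obtain ⟨a, ha⟩ := hf
  obtain ⟨b, hb⟩ := hg
  refine ⟨a + b + 1, fun s hs => ?_⟩
  have h1 : s ^ a ≤ s ^ (a + b) := Nat.pow_le_pow_right (by lia) (by lia)
  have h2 : s ^ b ≤ s ^ (a + b) := Nat.pow_le_pow_right (by lia) (by lia)
  have h3 : s ^ (a + b) * 2 ≤ s ^ (a + b) * s := Nat.mul_le_mul_left _ hs
  rw [pow_succ]
  have := ha s hs
  have := hb s hs
  lia

end PolyBound

/-! ### Sizes and lists -/

namespace Val

/-- The number of atoms and pairs of a value. -/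
def size : Val → ℕ
  | .nil => 1
  | .real _ => 1
  | .pair v w => v.size + w.size + 1

/-- The list represented by a value. -/
def toList : Val → List Val
  | .nil => []
  | .real _ => [.nil]
  | .pair v w => v :: w.toList

theorem size_fst_le (v : Val) : v.fst.size ≤ v.size := by
  cases v <;> simp only [fst, size] <;> lia

theorem size_snd_le (v : Val) : v.snd.size ≤ v.size := by
  cases v <;> simp only [snd, size] <;> lia

@[simp] theorem toList_list (l : List Val) : (Val.list l).toList = l := by
  induction l with
  | nil => rfl
  | cons a l ih => simp [Val.list, toList, ih]

theorem size_list (l : List Val) : (Val.list l).size = (l.map fun a => a.size + 1).sum + 1 := by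
  induction l with
  | nil => rfl
  | cons a l ih => simp [Val.list, size, ih]; lia

theorem sum_toList_le (v : Val) : (v.toList.map fun a => a.size + 1).sum ≤ v.size + 1 := by
  induction v with
  | nil => simp [toList]
  | real a => simp [toList, size]
  | pair v w _ ih => simp only [toList, size, List.map_cons, List.sum_cons]; lia

theorem length_toList_le (v : Val) : v.toList.length ≤ v.size := by
  induction v with
  | nil => simp [toList]
  | real a => simp [toList, size]
  | pair v w _ ih => simp only [toList, size, List.length_cons]; lia

theorem size_le_of_mem {v a : Val} (h : a ∈ v.toList) : a.size ≤ v.size := by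
  induction v with
  | nil => simp [toList] at h
  | real a => simp [toList] at h; subst h; simp [size]
  | pair v w _ ih =>
    simp only [toList, List.mem_cons] at h
    rcases h with rfl | h
    · simp only [size]; lia
    · have := ih h; simp only [size]; lia

theorem size_list_le_of_sublist {l m : List Val} (h : l.Sublist m) :
    (Val.list l).size ≤ (Val.list m).size := by
  rw [size_list, size_list]
  have := (h.map fun a => a.size + 1).sum_le_sum (by simp)
  lia

theorem size_list_toList_le (v : Val) : (Val.list v.toList).size ≤ v.size + 2 := by
  rw [size_list]; have := sum_toList_le v; lia

theorem size_list_le {l : List Val} {k m : ℕ} (hk : l.length ≤ k) (hm : ∀ a ∈ l, a.size ≤ m) :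
    (Val.list l).size ≤ k * (m + 1) + 1 := by
  rw [size_list]
  have := List.sum_le_card_nsmul (l.map fun a => a.size + 1) (m + 1) (by
    simp only [List.mem_map]; rintro _ ⟨a, ha, rfl⟩; have := hm a ha; lia)
  rw [List.length_map, smul_eq_mul] at this
  have := Nat.mul_le_mul_right (m + 1) hk
  lia

theorem foldl_cons_eq_list (l : List Val) :
    l.foldl (fun acc a => Val.pair a acc) .nil = Val.list l.reverse := by
  rw [← List.foldr_reverse]
  induction l.reverse with
  | nil => rfl
  | cons a l ih => simp [Val.list, ih]

end Val

/-! ### Polynomial time -/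

/-- `f` is computed in polynomial time, and has results of polynomial size, on the values `v` that
are admissible for the size parameter `s`. -/
def PolyTime (Q : ℕ → Val → Prop) (f : Val → Val) : Prop :=
  ∃ p d, ∀ s, 2 ≤ s → ∀ v, Q s v → (f v).size ≤ s ^ d ∧ ∃ t ≤ s ^ d, Run p v (f v) t

/-- All values of size at most `s`. -/
def SizeLe (s : ℕ) (v : Val) : Prop := v.size ≤ s

namespace PolyTime

variable {Q : ℕ → Val → Prop}

theorem of_bounds {f : Val → Val} (p : Prog) {g h : ℕ → ℕ} (hg : PolyBound g) (hh : PolyBound h)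
    (H : ∀ s, 2 ≤ s → ∀ v, Q s v → (f v).size ≤ g s ∧ ∃ t ≤ h s, Run p v (f v) t) :
    PolyTime Q f := by
  obtain ⟨d, hd⟩ := hg.add hh
  refine ⟨p, d, fun s hs v hv => ?_⟩
  obtain ⟨h1, t, ht, hr⟩ := H s hs v hv
  have := hd s hs
  exact ⟨by lia, t, by lia, hr⟩

theorem mono {Q' : ℕ → Val → Prop} {f : Val → Val} (h : PolyTime Q f)
    (hQ : ∀ s v, Q' s v → Q s v) : PolyTime Q' f := by
  obtain ⟨p, d, h⟩ := h
  exact ⟨p, d, fun s hs v hv => h s hs v (hQ s v hv)⟩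

theorem pair {f g : Val → Val} (hf : PolyTime Q f) (hg : PolyTime Q g) :
    PolyTime Q fun v => .pair (f v) (g v) := by
  obtain ⟨p, a, hp⟩ := hf
  obtain ⟨q, b, hq⟩ := hg
  have hb := ((PolyBound.pow a).add (PolyBound.pow b)).add (PolyBound.const 1)
  refine of_bounds (.pair p q) hb hb fun s hs v hv => ?_
  obtain ⟨h1, t1, ht1, hr1⟩ := hp s hs v hv
  obtain ⟨h2, t2, ht2, hr2⟩ := hq s hs v hv
  exact ⟨by simp only [Val.size]; lia, _, by lia, Run.pair hr1 hr2⟩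

/-- The result of `f` has size at most a power of s, and that power serves as size parameter for
`g`. The exponent a + 1 keeps the parameter at least 2 even if a = 0. -/
theorem comp {f g : Val → Val} (hg : PolyTime SizeLe g) (hf : PolyTime Q f) :
    PolyTime Q fun v => g (f v) := by
  obtain ⟨p, a, hp⟩ := hf
  obtain ⟨q, b, hq⟩ := hg
  have hb := ((PolyBound.pow a).add (PolyBound.pow ((a + 1) * b))).add (PolyBound.const 1)
  refine of_bounds (.comp p q) hb hb fun s hs v hv => ?_
  obtain ⟨h1, t1, ht1, hr1⟩ := hp s hs v hv
  obtain ⟨h2, t2, ht2, hr2⟩ := hq (s ^ (a + 1)) (hs.trans (Nat.le_self_pow (by lia) s)) (f v)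
    (h1.trans (Nat.pow_le_pow_right (by lia) (by lia)))
  rw [← pow_mul] at h2 ht2
  exact ⟨by lia, _, by lia, Run.comp hr1 hr2⟩

theorem nil : PolyTime Q fun _ => .nil :=
  of_bounds .nil (.const 1) (.const 1) fun _ _ v _ => ⟨by simp [Val.size], 1, le_rfl, .nil v⟩

theorem zero : PolyTime Q fun _ => .real 0 :=
  of_bounds .zero (.const 1) (.const 1) fun _ _ v _ => ⟨by simp [Val.size], 1, le_rfl, .zero v⟩

theorem id : PolyTime SizeLe fun v => v :=
  of_bounds .id .self (.const 1) fun _ _ v hv => ⟨hv, 1, le_rfl, .id v⟩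

theorem fst {f : Val → Val} (hf : PolyTime Q f) : PolyTime Q fun v => (f v).fst :=
  comp (of_bounds .fst .self (.const 1) fun _ _ v hv =>
    ⟨(Val.size_fst_le v).trans hv, 1, le_rfl, .fst v⟩) hf

theorem snd {f : Val → Val} (hf : PolyTime Q f) : PolyTime Q fun v => (f v).snd :=
  comp (of_bounds .snd .self (.const 1) fun _ _ v hv =>
    ⟨(Val.size_snd_le v).trans hv, 1, le_rfl, .snd v⟩) hf

theorem size_add_le (v : Val) : v.add.size ≤ 1 := by
  unfold Val.add; split <;> simp [Val.size]

theorem size_le_le (v : Val) : v.le.size ≤ 3 := by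
  unfold Val.le; split
  · split_ifs <;> simp [Val.size]
  · simp [Val.size]

theorem add {f g : Val → Val} (hf : PolyTime Q f) (hg : PolyTime Q g) :
    PolyTime Q fun v => (Val.pair (f v) (g v)).add :=
  comp (of_bounds .add (.const 1) (.const 1) fun _ _ v _ =>
    ⟨size_add_le v, 1, le_rfl, .add v⟩) (hf.pair hg)

end PolyTime

noncomputable section

open scoped Classical

/-- The code of a truth value. -/
def Val.bool (c : Prop) : Val := if c then .pair .nil .nil else .nil

theorem Val.bool_ne_nil {c : Prop} : Val.bool c ≠ .nil ↔ c := by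
  unfold Val.bool; split_ifs <;> simp [*]

theorem Val.bool_eq_nil {c : Prop} : Val.bool c = .nil ↔ ¬ c := by
  unfold Val.bool; split_ifs <;> simp [*]

theorem Val.size_bool_le (c : Prop) : (Val.bool c).size ≤ 3 := by
  unfold Val.bool; split_ifs <;> simp [Val.size]

/-- The predicate `c` is decidable in polynomial time. -/
def PolyDec (Q : ℕ → Val → Prop) (c : Val → Prop) : Prop := PolyTime Q fun v => Val.bool (c v)

namespace PolyTime

variable {Q : ℕ → Val → Prop}

theorem ite {c : Val → Prop} {f g : Val → Val} (hc : PolyDec Q c) (hf : PolyTime Q f)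
    (hg : PolyTime Q g) : PolyTime Q fun v => if c v then f v else g v := by
  obtain ⟨b, d, hb⟩ := hc
  obtain ⟨p, a₁, hp⟩ := hf
  obtain ⟨q, a₂, hq⟩ := hg
  have hB := (((PolyBound.pow d).add (PolyBound.pow a₁)).add (PolyBound.pow a₂)).add
    (PolyBound.const 1)
  refine of_bounds (.ite b p q) hB hB fun s hs v hv => ?_
  obtain ⟨_, t, ht, hr⟩ := hb s hs v hv
  obtain ⟨h1, t1, ht1, hr1⟩ := hp s hs v hv
  obtain ⟨h2, t2, ht2, hr2⟩ := hq s hs v hv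
  by_cases h : c v
  · simp only [h, if_true]
    exact ⟨by lia, _, by lia, Run.ite_true hr (Val.bool_ne_nil.2 h) hr1⟩
  · simp only [h, if_false]
    replace hr : Run b v .nil t := by simpa only [Val.bool_eq_nil.2 h] using hr
    exact ⟨by lia, _, by lia, Run.ite_false hr hr2⟩

/-- The loop that runs `p` on `(a, (acc, v))` for each element `a` of a list. -/
def foldLoop (p : Prog) : Prog :=
  .loop .fst (.pair (.comp .fst .snd)
    (.pair (.comp (.pair (.comp .fst .fst) .snd) p) (.comp .snd .snd)))

/-- Here σ bounds the list and all intermediate accumulators, and τ the time of one call of `p`.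
Testing, unpacking and repacking the state take the remaining 16 steps of an iteration. -/
theorem run_foldLoop {p : Prog} {g : Val → Val → Val → Val} {v : Val} {σ τ : ℕ}
    (hp : ∀ a acc, a.size ≤ σ → acc.size ≤ σ →
      ∃ t ≤ τ, Run p (.pair a (.pair acc v)) (g a acc v) t) :
    ∀ (l acc : Val), l.size ≤ σ →
      (∀ m, m <+: l.toList → (m.foldl (fun acc a => g a acc v) acc).size ≤ σ) →
      ∃ t ≤ l.toList.length * (τ + 16) + 2,
        Run (foldLoop p) (.pair l (.pair acc v))
          (.pair .nil (.pair (l.toList.foldl (fun acc a => g a acc v) acc) v)) t := by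
  have step : ∀ l acc w, l ≠ .nil → l.size ≤ σ → acc.size ≤ σ → ∀ t,
      Run (foldLoop p) (.pair l.snd (.pair (g l.fst acc v) v)) w t →
      ∃ t' ≤ t + (τ + 16), Run (foldLoop p) (.pair l (.pair acc v)) w t' := by
    intro l acc w hl h1 h2 t ht
    obtain ⟨u, hu, hr⟩ := hp l.fst acc ((Val.size_fst_le l).trans h1) h2
    refine ⟨_, ?_, Run.loop_step (.fst _) hl
      (.pair (.comp (.fst _) (.snd _))
        (.pair (.comp (.pair (.comp (.fst _) (.fst _)) (.snd _)) hr) (.comp (.snd _) (.snd _)))) ht⟩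
    lia
  intro l
  induction l with
  | nil =>
    intro acc _ _
    exact ⟨2, by simp, Run.loop_stop (.fst _)⟩
  -- A real in the place of a list counts as [nil]: it passes the loop test and both its projections
  -- are nil, so the body runs exactly once.
  | real a =>
    intro acc h1 h2
    obtain ⟨t, ht, hr⟩ := step (.real a) acc _ (by simp) h1 (h2 [] (by simp)) 2
      (Run.loop_stop (.fst _))
    exact ⟨t, by simp [Val.toList]; lia, hr⟩
  | pair a l _ ih =>
    intro acc h1 h2
    have h1' : l.size ≤ σ := (Val.size_snd_le (.pair a l)).trans h1
    obtain ⟨u, hu, hr⟩ := ih (g a acc v) h1' fun m hm =>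
      h2 (a :: m) (by simpa [Val.toList] using hm)
    obtain ⟨t, ht, hr⟩ := step (.pair a l) acc _ (by simp) h1 (h2 [] (by simp)) u hr
    refine ⟨t, ?_, hr⟩
    simp only [Val.toList, List.length_cons, add_mul, one_mul]
    lia

/-- A polynomial step alone does not bound the accumulator, which might square its size in every
iteration. The bound on the results for all prefixes excludes this. -/
theorem fold {l init : Val → Val} {g : Val → Val → Val → Val} (hQ : ∀ s v, Q s v → SizeLe s v)
    (hl : PolyTime Q l) (hi : PolyTime Q init)
    (hg : PolyTime SizeLe fun w => g w.fst w.snd.fst w.snd.snd)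
    (hb : ∃ b, PolyBound b ∧ ∀ s, 2 ≤ s → ∀ v, Q s v → ∀ m, m <+: (l v).toList →
      (m.foldl (fun acc a => g a acc v) (init v)).size ≤ b s) :
    PolyTime Q fun v => (l v).toList.foldl (fun acc a => g a acc v) (init v) := by
  obtain ⟨p, a, hp⟩ := hl
  obtain ⟨q, c, hq⟩ := hi
  obtain ⟨r, e, hr⟩ := hg
  obtain ⟨b, ⟨k, hk⟩, hb⟩ := hb
  have hB : PolyBound fun s => s ^ a + s ^ c +
      (s ^ a * (s ^ ((a + k + 4) * e) + 16) + 2) + 100 :=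
    (((PolyBound.pow a).add (PolyBound.pow c)).add
      (((PolyBound.pow a).mul ((PolyBound.pow _).add (.const 16))).add (.const 2))).add (.const 100)
  refine of_bounds (.comp (.comp (.pair p (.pair q .id)) (foldLoop r)) (.comp .snd .fst))
    (PolyBound.pow k) hB fun s hs v hv => ⟨(hb s hs v hv _ (List.prefix_refl _)).trans (hk s hs), ?_⟩
  obtain ⟨h1, t1, ht1, hr1⟩ := hp s hs v hv
  obtain ⟨h2, t2, ht2, hr2⟩ := hq s hs v hv
  have e1 : s ^ a ≤ s ^ (a + k + 1) := Nat.pow_le_pow_right (by lia) (by lia)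
  have e2 : s ^ k ≤ s ^ (a + k + 1) := Nat.pow_le_pow_right (by lia) (by lia)
  have e3 : s ≤ s ^ (a + k + 1) := Nat.le_self_pow (by lia) s
  have e4 : s ^ (a + k + 4) = s ^ (a + k + 1) * s ^ 3 := by rw [← pow_add]
  have e5 : s ^ (a + k + 1) * 2 ^ 3 ≤ s ^ (a + k + 1) * s ^ 3 :=
    Nat.mul_le_mul_left _ (Nat.pow_le_pow_left hs 3)
  have hv' : v.size ≤ s := hQ s v hv
  -- The argument of one call consists of three values of size at most σ, so its size is at most 3σ
  -- + 2 ≤ 2 ^ 3 * σ. As 2 ≤ s, three more factors s suffice.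
  obtain ⟨t, ht, hrt⟩ := run_foldLoop (p := r) (g := g) (v := v) (σ := s ^ (a + k + 1))
    (τ := s ^ ((a + k + 4) * e)) (fun x acc hx hacc => by
      obtain ⟨-, t, ht, hrt⟩ := hr (s ^ (a + k + 4)) (hs.trans (Nat.le_self_pow (by lia) s))
        (.pair x (.pair acc v)) (by simp only [SizeLe, Val.size]; lia)
      rw [← pow_mul] at ht
      exact ⟨t, ht, hrt⟩) (l v) (init v) (h1.trans e1)
    (fun m hm => ((hb s hs v hv m hm).trans (hk s hs)).trans e2)
  have hlen := Nat.mul_le_mul_right (s ^ ((a + k + 4) * e) + 16)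
    ((Val.length_toList_le (l v)).trans h1)
  refine ⟨_, ?_, Run.comp (.comp (.pair hr1 (.pair hr2 (.id v))) hrt) (.comp (.snd _) (.fst _))⟩
  lia

variable {l : Val → Val}

theorem reverse (hl : PolyTime SizeLe l) : PolyTime SizeLe fun v => Val.list (l v).toList.reverse := by
  suffices h : PolyTime SizeLe fun v => Val.list v.toList.reverse from h.comp hl
  have := fold (l := fun v => v) (init := fun _ => .nil) (g := fun a acc _ => .pair a acc)
    (Q := SizeLe) (fun _ _ h => h) id nil (id.fst.pair id.snd.fst)
    ⟨_, PolyBound.self.add (.const 2), fun s _ v hv m hm => by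
      rw [Val.foldl_cons_eq_list, Val.size_list, List.map_reverse, List.sum_reverse]
      have h1 := (hm.sublist.map fun a => a.size + 1).sum_le_sum (by simp)
      have h2 := Val.sum_toList_le v
      have h3 : v.size ≤ s := hv
      lia⟩
  simpa only [Val.foldl_cons_eq_list] using this

theorem foldr {init : Val → Val} {g : Val → Val → Val → Val}
    (hl : PolyTime SizeLe l) (hi : PolyTime SizeLe init)
    (hg : PolyTime SizeLe fun w => g w.fst w.snd.fst w.snd.snd)
    (hb : ∃ b, PolyBound b ∧ ∀ s, 2 ≤ s → ∀ v, SizeLe s v → ∀ m, m <:+ (l v).toList →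
      (m.foldr (fun a acc => g a acc v) (init v)).size ≤ b s) :
    PolyTime SizeLe fun v => (l v).toList.foldr (fun a acc => g a acc v) (init v) := by
  have := fold (Q := SizeLe) (fun _ _ h => h) hl.reverse hi hg (by
    obtain ⟨b, h1, h2⟩ := hb
    refine ⟨b, h1, fun s hs v hv m hm => ?_⟩
    rw [Val.toList_list] at hm
    have h := h2 s hs v hv m.reverse (by rw [← List.reverse_prefix]; simpa using hm)
    rwa [List.foldr_reverse] at h)
  simpa only [Val.toList_list, List.foldl_reverse] using this

theorem filter {c : Val → Val → Prop} (hl : PolyTime SizeLe l)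
    (hc : PolyDec SizeLe fun w => c w.fst w.snd) :
    PolyTime SizeLe fun v => Val.list ((l v).toList.filter fun a => decide (c a v)) := by
  have key : ∀ v (m : List Val), m.foldr (fun a acc => if c a v then .pair a acc else acc) Val.nil
      = Val.list (m.filter fun a => decide (c a v)) := by
    intro v m
    induction m with
    | nil => rfl
    | cons a m ih => by_cases h : c a v <;> simp [h, ih, Val.list]
  have := foldr (l := l) (init := fun _ => .nil)
    (g := fun a acc v => if c a v then .pair a acc else acc) hl nil
    (ite (hc.comp (id.fst.pair id.snd.snd)) (id.fst.pair id.snd.fst) id.snd.fst)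
    (by
      obtain ⟨_, d, hd⟩ := hl
      refine ⟨_, (PolyBound.pow d).add (.const 2), fun s hs v hv m hm => ?_⟩
      rw [key]
      have h1 := Val.size_list_le_of_sublist
        ((List.filter_sublist (p := fun a => decide (c a v))).trans hm.sublist)
      have h2 := Val.size_list_toList_le (l v)
      have := (hd s hs v hv).1
      lia)
  simpa only [key] using this

theorem map {f : Val → Val → Val} (hl : PolyTime SizeLe l)
    (hf : PolyTime SizeLe fun w => f w.fst w.snd) :
    PolyTime SizeLe fun v => Val.list ((l v).toList.map fun a => f a v) := by
  have key : ∀ v (m : List Val), m.foldr (fun a acc => .pair (f a v) acc) Val.nil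
      = Val.list (m.map fun a => f a v) := by
    intro v m
    induction m with
    | nil => rfl
    | cons a m ih => simp [ih, Val.list]
  have := foldr (l := l) (init := fun _ => .nil)
    (g := fun a acc v => .pair (f a v) acc) hl nil
    ((hf.comp (id.fst.pair id.snd.snd)).pair id.snd.fst)
    (by
      obtain ⟨_, d, hd⟩ := hl
      obtain ⟨_, e, he⟩ := hf
      refine ⟨_, ((PolyBound.pow d).mul ((PolyBound.pow ((d + 3) * e)).add (.const 1))).add (.const 1),
        fun s hs v hv m hm => ?_⟩
      rw [key]
      refine Val.size_list_le ?_ ?_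
      · rw [List.length_map]
        exact hm.length_le.trans ((Val.length_toList_le _).trans (hd s hs v hv).1)
      · simp only [List.mem_map]
        rintro _ ⟨a, ha, rfl⟩
        have h1 := (Val.size_le_of_mem (hm.subset ha)).trans (hd s hs v hv).1
        have h2 : v.size ≤ s := hv
        have e1 : s ^ d ≤ s ^ (d + 1) := Nat.pow_le_pow_right (by lia) (by lia)
        have e3 : s ≤ s ^ (d + 1) := Nat.le_self_pow (by lia) s
        have e4 : s ^ (d + 3) = s ^ (d + 1) * s ^ 2 := by rw [← pow_add]
        have e5 : s ^ (d + 1) * 2 ^ 2 ≤ s ^ (d + 1) * s ^ 2 :=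
          Nat.mul_le_mul_left _ (Nat.pow_le_pow_left hs 2)
        have h3 := (he (s ^ (d + 3)) (hs.trans (Nat.le_self_pow (by lia) s)) (.pair a v)
          (by simp only [SizeLe, Val.size]; lia)).1
        rw [← pow_mul] at h3
        exact h3)
  simpa only [key] using this

theorem append {f g : Val → Val} (hf : PolyTime SizeLe f) (hg : PolyTime SizeLe g) :
    PolyTime SizeLe fun v => (f v).toList.foldr Val.pair (g v) := by
  refine foldr (g := fun a acc _ => .pair a acc) hf hg (id.fst.pair id.snd.fst) ?_
  obtain ⟨_, d, hd⟩ := hf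
  obtain ⟨_, e, he⟩ := hg
  refine ⟨_, ((PolyBound.pow d).add (PolyBound.pow e)).add (.const 2), fun s hs v hv m hm => ?_⟩
  have key : ∀ (w : Val) (m : List Val),
      (m.foldr Val.pair w).size = (m.map fun a => a.size + 1).sum + w.size := by
    intro w m
    induction m with
    | nil => simp
    | cons a m ih => simp [Val.size, ih]; lia
  rw [key]
  have h1 := (hm.sublist.map fun a => a.size + 1).sum_le_sum (by simp)
  have h2 := Val.sum_toList_le (f v)
  have := (hd s hs v hv).1
  have := (he s hs v hv).1
  lia

theorem flatten (hl : PolyTime SizeLe l) :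
    PolyTime SizeLe fun v => Val.list ((l v).toList.flatMap Val.toList) := by
  have key : ∀ (m : List Val), m.foldr (fun a acc => a.toList.foldr Val.pair acc) Val.nil
      = Val.list (m.flatMap Val.toList) := by
    intro m
    induction m with
    | nil => rfl
    | cons a m ih =>
      simp only [List.foldr_cons, ih, List.flatMap_cons]
      induction a.toList with
      | nil => rfl
      | cons b k ih => simp [Val.list, ih]
  have := foldr (l := l) (init := fun _ => .nil)
    (g := fun a acc _ => a.toList.foldr Val.pair acc) hl nil (append id.fst id.snd.fst)
    (by
      obtain ⟨_, d, hd⟩ := hl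
      refine ⟨_, ((PolyBound.pow d).add (.const 2)), fun s hs v hv m hm => ?_⟩
      rw [key, Val.size_list]
      have h0 : ((m.flatMap Val.toList).map fun a => a.size + 1).sum ≤
          (m.map fun a => a.size + 1).sum := by
        clear hm
        induction m with
        | nil => simp
        | cons a m ih =>
          have := Val.sum_toList_le a
          simp only [List.flatMap_cons, List.map_append, List.sum_append, List.map_cons,
            List.sum_cons]
          lia
      have h1 := (hm.sublist.map fun a => a.size + 1).sum_le_sum (by simp)
      have h2 := Val.sum_toList_le (l v)
      have := (hd s hs v hv).1
      lia)
  simpa only [key] using this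

theorem flatMap {f : Val → Val → Val} (hl : PolyTime SizeLe l)
    (hf : PolyTime SizeLe fun w => f w.fst w.snd) :
    PolyTime SizeLe fun v => Val.list ((l v).toList.flatMap fun a => (f a v).toList) := by
  have := (map hl hf).flatten
  simpa only [Val.toList_list, List.flatMap_map] using this

end PolyTime

namespace PolyDec

variable {Q : ℕ → Val → Prop} {l : Val → Val}

theorem of_ne_nil {f : Val → Val} (hf : PolyTime SizeLe f) : PolyDec SizeLe fun v => f v ≠ .nil := by
  obtain ⟨p, d, hp⟩ := hf
  refine PolyTime.of_bounds (.ite p (.pair .nil .nil) .nil) (.const 3)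
    ((PolyBound.pow d).add (.const 5)) fun s hs v hv => ⟨Val.size_bool_le _, ?_⟩
  obtain ⟨_, t, ht, hr⟩ := hp s hs v hv
  by_cases h : f v = .nil
  · rw [h] at hr
    have := Run.ite_false (f := .pair .nil .nil) hr (.nil v)
    rw [← Val.bool_eq_nil.2 (not_not.2 h : ¬ f v ≠ .nil)] at this
    exact ⟨_, by lia, this⟩
  · have := Run.ite_true (g := .nil) hr h (.pair (.nil v) (.nil v))
    have e : Val.bool (f v ≠ .nil) = .pair .nil .nil := if_pos h
    rw [← e] at this
    exact ⟨_, by lia, this⟩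

theorem not {c : Val → Prop} (hc : PolyDec SizeLe c) : PolyDec SizeLe fun v => ¬ c v := by
  have := PolyTime.ite hc .nil (.pair .nil .nil)
  refine Eq.mp ?_ this
  unfold PolyDec Val.bool
  congr! 2 with v
  by_cases h : c v <;> simp [h]

theorem and {c d : Val → Prop} (hc : PolyDec SizeLe c) (hd : PolyDec SizeLe d) :
    PolyDec SizeLe fun v => c v ∧ d v := by
  have := PolyTime.ite hc hd .nil
  refine Eq.mp ?_ this
  unfold PolyDec Val.bool
  congr! 2 with v
  by_cases h : c v <;> simp [h]

theorem or {c d : Val → Prop} (hc : PolyDec SizeLe c) (hd : PolyDec SizeLe d) :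
    PolyDec SizeLe fun v => c v ∨ d v := by
  simpa only [not_and_or, not_not] using (hc.not.and hd.not).not

theorem eq_nil {f : Val → Val} (hf : PolyTime SizeLe f) : PolyDec SizeLe fun v => f v = .nil := by
  simpa only [ne_eq, not_not] using (of_ne_nil hf).not

theorem exists_mem {c : Val → Val → Prop} (hl : PolyTime SizeLe l)
    (hc : PolyDec SizeLe fun w => c w.fst w.snd) :
    PolyDec SizeLe fun v => ∃ a ∈ (l v).toList, c a v := by
  have := of_ne_nil (PolyTime.filter hl hc)
  refine Eq.mp ?_ this
  congr! 2 with v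
  have : ∀ m : List Val, Val.list m ≠ .nil ↔ m ≠ [] := fun m => by cases m <;> simp [Val.list]
  rw [this]
  simp

theorem forall_mem {c : Val → Val → Prop} (hl : PolyTime SizeLe l)
    (hc : PolyDec SizeLe fun w => c w.fst w.snd) :
    PolyDec SizeLe fun v => ∀ a ∈ (l v).toList, c a v := by
  simpa only [not_exists, not_and, not_not] using
    (exists_mem (c := fun a v => ¬ c a v) hl hc.not).not

/-- Comparison of the real numbers `a` and `b`; false if one of them is not a real number. -/
theorem le {f g : Val → Val} (hf : PolyTime SizeLe f) (hg : PolyTime SizeLe g) :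
    PolyDec SizeLe fun v => (Val.pair (f v) (g v)).le ≠ .nil :=
  of_ne_nil (PolyTime.comp (PolyTime.of_bounds .le (.const 3) (.const 1) fun _ _ v _ =>
    ⟨PolyTime.size_le_le v, 1, le_rfl, .le v⟩) (hf.pair hg))

end PolyDec
end
end TreeAug

/-! ### The algorithm, and its running time in terms of input and table length. -/

namespace TreeAug
noncomputable section

open scoped Classical

/-! ### The algorithm -/

namespace Val

/-- The elements of a list that satisfy `c`. -/
def filter (c : Val → Prop) (l : Val) : Val := .list (l.toList.filter fun a => decide (c a))

/-- Case distinction. -/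
def ite (c : Prop) (v w : Val) : Val := if c then v else w

theorem mem_filter {c : Val → Prop} {l a : Val} : a ∈ (filter c l).toList ↔ a ∈ l.toList ∧ c a := by
  simp [filter]

theorem size_filter_le (c : Val → Prop) (l : Val) : (filter c l).size ≤ l.size + 2 :=
  (size_list_le_of_sublist List.filter_sublist).trans (size_list_toList_le l)

theorem size_le_sum_toList (v : Val) : v.size ≤ (v.toList.map fun a => a.size + 1).sum + 1 := by
  induction v with
  | nil => simp [toList, size]
  | real a => simp [toList, size]
  | pair v w _ ih => simp only [toList, size, List.map_cons, List.sum_cons]; lia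

/-- The list `a` is at most as long as the list `b`; for codes of natural numbers: `a ≤ b`. -/
def lenLe (a b : Val) : Prop := b.toList.foldl (fun acc _ => acc.snd) a = .nil

def natEq (a b : Val) : Prop := lenLe a b ∧ lenLe b a

def edgeEq (e f : Val) : Prop := natEq e.fst f.fst ∧ natEq e.snd f.snd

/-- The node `a` is an end of the edge `e`. -/
def isEnd (a e : Val) : Prop := natEq a e.fst ∨ natEq a e.snd

/-- The edges in `E` that are reachable from the node `a`. -/
def reach (E a : Val) : Val :=
  E.toList.foldl (fun acc _ => filter (fun e => isEnd a e ∨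
    ∃ f ∈ acc.toList, isEnd e.fst f ∨ isEnd e.snd f) E) .nil

/-- The nodes `a` and `b` are connected by the edges in `E`. -/
def conn (E a b : Val) : Prop := natEq a b ∨ ∃ f ∈ (reach E a).toList, isEnd b f

/-- The edge `e` separates the nodes `a` and `b` in the tree with edges `E`. -/
def separates (E e a b : Val) : Prop := ¬ conn (filter (fun f => ¬ edgeEq e f) E) a b

/-- The node `a` is in the list `A`. -/
def nodeMem (a A : Val) : Prop := ∃ b ∈ A.toList, natEq a b

/-- The edges in `E` that connect different members of the list `T` of lists of nodes. -/
def edgesBetween (E T : Val) : Val :=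
  filter (fun e => (∃ A ∈ T.toList, nodeMem e.fst A) ∧ (∃ A ∈ T.toList, nodeMem e.snd A) ∧
    ¬ ∃ A ∈ T.toList, nodeMem e.fst A ∧ nodeMem e.snd A) E

/-- Seen from the node `a`, the edge `e` is equal to `f` or beyond `f`. -/
def beyond (E a f e : Val) : Prop := separates E f a e.fst ∨ separates E f a e.snd

/-- The partial solution `x` dominates `y`. A partial solution consists of the edges that remain to
be covered, the cost, and the chosen links. -/
def dominates (x y : Val) : Prop :=
  (∀ e ∈ x.fst.toList, ∃ f ∈ y.fst.toList, edgeEq e f) ∧ (pair x.snd.fst y.snd.fst).le ≠ .nil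

/-- Insertion of a partial solution into a table of partial solutions. -/
def insertSol (x tbl : Val) : Val :=
  ite (∃ y ∈ tbl.toList, dominates y x) tbl (pair x (filter (fun y => ¬ dominates x y) tbl))

/-- The link `k` covers a topmost remaining edge of the partial solution `x`. -/
def useful (E a x k : Val) : Prop :=
  ∃ e ∈ x.fst.toList, separates E e k.fst.fst k.fst.snd ∧
    ∀ f ∈ x.fst.toList, edgeEq f e ∨ ¬ beyond E a f e

/-- Extension of the partial solution `x` by the link `k`. -/
def extend (E x k : Val) : Val :=
  pair (filter (fun e => ¬ separates E e k.fst.fst k.fst.snd) x.fst)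
    (pair (pair x.snd.fst k.snd).add (pair (pair k.fst k.fst) x.snd.snd))

/-- Only links covering a topmost remaining edge are tried. This keeps the sets of remaining edges
closed under descending, so that few different ones occur. -/
def expansions (E C a tbl : Val) : Val :=
  list (tbl.toList.flatMap fun x =>
    (list ((filter (useful E a x) C).toList.map fun k => extend E x k)).toList)

/-- One round of the dynamic program. The table is discarded if it gets longer than `B`. -/
def round (B E C a tbl : Val) : Val :=
  ite (lenLe ((expansions E C a tbl).toList.foldl (fun acc x => insertSol x acc) tbl) B)
    ((expansions E C a tbl).toList.foldl (fun acc x => insertSol x acc) tbl) nil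

/-- The start entry has all of X left, cost 0 and no links. One round per edge of X suffices because
every extension covers a further edge. -/
def table (B E C a X : Val) : Val :=
  X.toList.foldl (fun acc _ => round B E C a acc) (pair (pair X (pair (real 0) nil)) nil)

/-- The solution for the edge set `X`, or `nil` if none was found. -/
def solution (B E C a X : Val) : Val := (filter (fun x => x.fst = nil) (table B E C a X)).fst

/-- The solutions for the branches at the member `A` of `T`. -/
def solutions (B E C T A : Val) : Val :=
  list ((filter (fun f => nodeMem f.fst A ∨ nodeMem f.snd A) (edgesBetween E T)).toList.map fun f =>
    solution B E C A.fst (filter (beyond E A.fst f) (edgesBetween E T)))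

/-- The union of a list of solutions. -/
def union (l : Val) : Val :=
  pair (l.toList.foldl (fun acc x => (pair acc x.snd.fst).add) (real 0))
    (list (l.toList.flatMap fun x => x.snd.snd.toList))

/-- The input names no center, so every node of T is tried. A node is dropped if no solution is
found for one of its branches, for instance because a table outgrew B. -/
def candidates (B E C T : Val) : Val :=
  list ((filter (fun A => ∀ x ∈ (solutions B E C T A).toList, x ≠ nil) T).toList.map fun A =>
    union (solutions B E C T A))

/-- The cheapest of a list of candidates. -/
def cheapest (l : Val) : Val :=
  l.toList.foldl (fun acc x => ite (acc = nil ∨ (pair x.fst acc.fst).le ≠ nil) x acc) nil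

/-- The links of the cheapest candidate. -/
def algorithm (B E C T : Val) : Val := (cheapest (candidates B E C T)).snd

end Val

/-! ### The algorithm runs in polynomial time -/

namespace PolyTime

variable {a b c d e : Val → Val}

theorem vfilter {l : Val → Val} {c : Val → Val → Prop} (hl : PolyTime SizeLe l)
    (hc : PolyDec SizeLe fun w => c w.fst w.snd) :
    PolyTime SizeLe fun v => Val.filter (fun a => c a v) (l v) := filter hl hc

theorem vite {c : Val → Prop} {f g : Val → Val} (hc : PolyDec SizeLe c) (hf : PolyTime SizeLe f)
    (hg : PolyTime SizeLe g) : PolyTime SizeLe fun v => Val.ite (c v) (f v) (g v) := ite hc hf hg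

theorem up (ha : PolyTime SizeLe a) : PolyTime SizeLe fun v => a v.snd := comp ha id.snd

theorem lenLe (ha : PolyTime SizeLe a) (hb : PolyTime SizeLe b) :
    PolyDec SizeLe fun v => Val.lenLe (a v) (b v) := by
  refine PolyDec.eq_nil (fold (g := fun _ acc _ => acc.snd) (fun _ _ h => h) hb ha id.snd.fst.snd ?_)
  obtain ⟨_, d, hd⟩ := ha
  refine ⟨_, PolyBound.pow d, fun s hs v hv m hm => le_trans ?_ (hd s hs v hv).1⟩
  generalize a v = w
  clear hm
  induction m generalizing w with
  | nil => rfl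
  | cons x m ih => exact (ih w.snd).trans (Val.size_snd_le w)

theorem natEq (ha : PolyTime SizeLe a) (hb : PolyTime SizeLe b) :
    PolyDec SizeLe fun v => Val.natEq (a v) (b v) := (lenLe ha hb).and (lenLe hb ha)

theorem edgeEq (ha : PolyTime SizeLe a) (hb : PolyTime SizeLe b) :
    PolyDec SizeLe fun v => Val.edgeEq (a v) (b v) :=
  (natEq ha.fst hb.fst).and (natEq ha.snd hb.snd)

theorem isEnd (ha : PolyTime SizeLe a) (hb : PolyTime SizeLe b) :
    PolyDec SizeLe fun v => Val.isEnd (a v) (b v) :=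
  (natEq ha hb.fst).or (natEq ha hb.snd)

theorem reach (ha : PolyTime SizeLe a) (hb : PolyTime SizeLe b) :
    PolyTime SizeLe fun v => Val.reach (a v) (b v) := by
  refine fold (g := fun _ acc v => Val.filter (fun e => Val.isEnd (b v) e ∨
    ∃ f ∈ acc.toList, Val.isEnd e.fst f ∨ Val.isEnd e.snd f) (a v)) (fun _ _ h => h) ha nil ?_ ?_
  · refine vfilter ha.up.up (PolyDec.or ?_ (PolyDec.exists_mem id.snd.snd.fst (PolyDec.or ?_ ?_)))
    · exact isEnd hb.up.up.up id.fst
    · exact isEnd id.snd.fst.fst id.fst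
    · exact isEnd id.snd.fst.snd id.fst
  · obtain ⟨_, d, hd⟩ := ha
    refine ⟨_, (PolyBound.pow d).add (.const 2), fun s hs v hv m _ => ?_⟩
    have h := (hd s hs v hv).1
    rcases List.eq_nil_or_concat m with rfl | ⟨m, x, rfl⟩
    · simp [Val.size]
    · rw [List.concat_eq_append, List.foldl_append]
      exact (Val.size_filter_le _ _).trans (by lia)

theorem conn (ha : PolyTime SizeLe a) (hb : PolyTime SizeLe b) (hc : PolyTime SizeLe c) :
    PolyDec SizeLe fun v => Val.conn (a v) (b v) (c v) :=
  (natEq hb hc).or (PolyDec.exists_mem (reach ha hb) (isEnd hc.up id.fst))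

theorem separates (ha : PolyTime SizeLe a) (hb : PolyTime SizeLe b) (hc : PolyTime SizeLe c)
    (hd : PolyTime SizeLe d) : PolyDec SizeLe fun v => Val.separates (a v) (b v) (c v) (d v) :=
  (conn (vfilter ha (edgeEq hb.up id.fst).not) hc hd).not

theorem nodeMem (ha : PolyTime SizeLe a) (hb : PolyTime SizeLe b) :
    PolyDec SizeLe fun v => Val.nodeMem (a v) (b v) :=
  PolyDec.exists_mem hb (natEq ha.up id.fst)

theorem edgesBetween (ha : PolyTime SizeLe a) (hb : PolyTime SizeLe b) :
    PolyTime SizeLe fun v => Val.edgesBetween (a v) (b v) := by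
  refine vfilter ha (PolyDec.and (PolyDec.exists_mem hb.up ?_)
    (PolyDec.and (PolyDec.exists_mem hb.up ?_) (PolyDec.not (PolyDec.exists_mem hb.up
      (PolyDec.and ?_ ?_)))))
  · exact nodeMem id.snd.fst.fst id.fst
  · exact nodeMem id.snd.fst.snd id.fst
  · exact nodeMem id.snd.fst.fst id.fst
  · exact nodeMem id.snd.fst.snd id.fst

theorem beyond (ha : PolyTime SizeLe a) (hb : PolyTime SizeLe b) (hc : PolyTime SizeLe c)
    (hd : PolyTime SizeLe d) : PolyDec SizeLe fun v => Val.beyond (a v) (b v) (c v) (d v) :=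
  (separates ha hc hb hd.fst).or (separates ha hc hb hd.snd)

theorem dominates (ha : PolyTime SizeLe a) (hb : PolyTime SizeLe b) :
    PolyDec SizeLe fun v => Val.dominates (a v) (b v) := by
  refine (PolyDec.forall_mem ha.fst (PolyDec.exists_mem hb.up.fst ?_)).and
    (PolyDec.le ha.snd.fst hb.snd.fst)
  exact edgeEq id.snd.fst id.fst

theorem insertSol (ha : PolyTime SizeLe a) (hb : PolyTime SizeLe b) :
    PolyTime SizeLe fun v => Val.insertSol (a v) (b v) :=
  vite (PolyDec.exists_mem hb (dominates id.fst ha.up)) hb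
    (ha.pair (vfilter hb (dominates ha.up id.fst).not))

theorem useful (ha : PolyTime SizeLe a) (hb : PolyTime SizeLe b) (hc : PolyTime SizeLe c)
    (hd : PolyTime SizeLe d) : PolyDec SizeLe fun v => Val.useful (a v) (b v) (c v) (d v) := by
  refine PolyDec.exists_mem hc.fst (PolyDec.and ?_ (PolyDec.forall_mem hc.up.fst (PolyDec.or ?_
    (PolyDec.not ?_))))
  · exact separates ha.up id.fst hd.up.fst.fst hd.up.fst.snd
  · exact edgeEq id.fst id.snd.fst
  · exact beyond ha.up.up hb.up.up id.fst id.snd.fst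

theorem extend (ha : PolyTime SizeLe a) (hb : PolyTime SizeLe b) (hc : PolyTime SizeLe c) :
    PolyTime SizeLe fun v => Val.extend (a v) (b v) (c v) :=
  pair (vfilter hb.fst (separates ha.up id.fst hc.up.fst.fst hc.up.fst.snd).not)
    (pair (add hb.snd.fst hc.snd) (pair (hc.fst.pair hc.fst) hb.snd.snd))

theorem expansions (ha : PolyTime SizeLe a) (hb : PolyTime SizeLe b) (hc : PolyTime SizeLe c)
    (hd : PolyTime SizeLe d) : PolyTime SizeLe fun v => Val.expansions (a v) (b v) (c v) (d v) := by
  refine flatMap hd (map (vfilter hb.up ?_) ?_)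
  · exact useful ha.up.up hc.up.up id.snd.fst id.fst
  · exact extend ha.up.up id.snd.fst id.fst

/-- Measured by the sum of the entry sizes, an insertion adds no more than the new entry. Hence
growth under repeated insertion is additive. -/
theorem sum_size_insertSol_le (x tbl : Val) :
    ((Val.insertSol x tbl).toList.map fun a => a.size + 1).sum ≤
      (tbl.toList.map fun a => a.size + 1).sum + (x.size + 1) := by
  unfold Val.insertSol Val.ite
  split_ifs
  · lia
  · simp only [Val.toList, List.map_cons, List.sum_cons, Val.filter, Val.toList_list]
    have := ((List.filter_sublist (l := tbl.toList)
      (p := fun a => decide (¬ Val.dominates x a))).map fun a => a.size + 1).sum_le_sum (by simp)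
    lia

theorem insertSols (ha : PolyTime SizeLe a) (hb : PolyTime SizeLe b) :
    PolyTime SizeLe fun v => (a v).toList.foldl (fun acc x => Val.insertSol x acc) (b v) := by
  refine fold (g := fun x acc _ => Val.insertSol x acc) (fun _ _ h => h) ha hb
    (insertSol id.fst id.snd.fst) ?_
  obtain ⟨_, d, hd⟩ := ha
  obtain ⟨_, e, he⟩ := hb
  refine ⟨_, ((PolyBound.pow d).add (.pow e)).add (.const 5), fun s hs v hv m hm => ?_⟩
  have key : ∀ (m : List Val) (w : Val), ((m.foldl (fun acc x => Val.insertSol x acc) w).toList.map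
      fun a => a.size + 1).sum ≤ (w.toList.map fun a => a.size + 1).sum +
      (m.map fun a => a.size + 1).sum := by
    intro m
    induction m with
    | nil => simp
    | cons x m ih =>
      intro w
      have h1 := ih (Val.insertSol x w)
      have h2 := sum_size_insertSol_le x w
      simp only [List.foldl_cons, List.map_cons, List.sum_cons]
      lia
  have h1 := key m (b v)
  have h2 := Val.size_le_sum_toList (m.foldl (fun acc x => Val.insertSol x acc) (b v))
  have h3 := Val.sum_toList_le (b v)
  have h4 := (hm.sublist.map fun a => a.size + 1).sum_le_sum (by simp)
  have h5 := Val.sum_toList_le (a v)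
  have := (hd s hs v hv).1
  have := (he s hs v hv).1
  lia

theorem round (ha : PolyTime SizeLe a) (hb : PolyTime SizeLe b) (hc : PolyTime SizeLe c)
    (hd : PolyTime SizeLe d) (he : PolyTime SizeLe e) :
    PolyTime SizeLe fun v => Val.round (a v) (b v) (c v) (d v) (e v) :=
  have h := insertSols (expansions hb hc hd he) he
  vite (lenLe h ha) h nil

theorem length_le_of_lenLe {x y : Val} (h : Val.lenLe x y) : x.toList.length ≤ y.toList.length := by
  unfold Val.lenLe at h
  generalize y.toList = l at h
  induction l generalizing x with
  | nil => simp only [List.foldl_nil] at h; subst h; simp [Val.toList]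
  | cons z l ih =>
    have := ih h
    cases x <;> simp only [Val.toList, Val.snd, List.length_cons, List.length_nil] at this ⊢ <;> lia

theorem size_extend_le (E x k : Val) : (Val.extend E x k).size ≤ x.size + 2 * k.size + 10 := by
  have h1 := Val.size_filter_le (fun e => ¬ Val.separates E e k.fst.fst k.fst.snd) x.fst
  have h2 := size_add_le (Val.pair x.snd.fst k.snd)
  have h3 := Val.size_fst_le k
  have h4 : x.fst.size + x.snd.snd.size ≤ x.size + 1 := by
    have := Val.size_snd_le x.snd
    cases x <;> simp only [Val.fst, Val.snd, Val.size] at this ⊢ <;> lia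
  simp only [Val.extend, Val.size]
  lia

theorem mem_round {B E C a tbl x : Val} (h : x ∈ (Val.round B E C a tbl).toList) :
    x ∈ tbl.toList ∨ x ∈ (Val.expansions E C a tbl).toList := by
  unfold Val.round Val.ite at h
  split_ifs at h
  · rename_i h0
    clear h0
    generalize (Val.expansions E C a tbl).toList = l at h ⊢
    induction l generalizing tbl with
    | nil => exact .inl h
    | cons y l ih =>
      rcases ih h with h | h
      · beta_reduce at h
        unfold Val.insertSol Val.ite at h
        split_ifs at h
        · exact .inl h
        · simp only [Val.toList, List.mem_cons] at h
          rcases h with rfl | h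
          · exact .inr (by simp)
          · exact .inl (Val.mem_filter.1 h).1
      · exact .inr (List.mem_cons_of_mem _ h)
  · simp [Val.toList] at h

theorem mem_expansions {E C a tbl x : Val} : x ∈ (Val.expansions E C a tbl).toList ↔
    ∃ y ∈ tbl.toList, ∃ k ∈ C.toList, Val.useful E a y k ∧ x = Val.extend E y k := by
  simp only [Val.expansions, Val.toList_list, List.mem_flatMap, List.mem_map, Val.mem_filter,
    and_assoc]
  simp only [eq_comm]

theorem length_round_le (B E C a tbl : Val) :
    (Val.round B E C a tbl).toList.length ≤ B.toList.length := by
  unfold Val.round Val.ite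
  split_ifs with h
  · exact length_le_of_lenLe h
  · simp [Val.toList]

theorem table (ha : PolyTime SizeLe a) (hb : PolyTime SizeLe b) (hc : PolyTime SizeLe c)
    (hd : PolyTime SizeLe d) (he : PolyTime SizeLe e) :
    PolyTime SizeLe fun v => Val.table (a v) (b v) (c v) (d v) (e v) := by
  suffices h : PolyTime SizeLe fun v =>
      Val.table v.fst v.snd.fst v.snd.snd.fst v.snd.snd.snd.fst v.snd.snd.snd.snd from
    h.comp (f := fun v => .pair (a v) (.pair (b v) (.pair (c v) (.pair (d v) (e v)))))
      (ha.pair (hb.pair (hc.pair (hd.pair he))))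
  unfold Val.table
  have hstep := round (a := fun w => w.snd.snd.fst) (b := fun w => w.snd.snd.snd.fst)
    (c := fun w => w.snd.snd.snd.snd.fst) (d := fun w => w.snd.snd.snd.snd.snd.fst)
    (e := fun w => w.snd.fst) id.snd.snd.fst id.snd.snd.snd.fst id.snd.snd.snd.snd.fst
    id.snd.snd.snd.snd.snd.fst id.snd.fst
  refine fold (l := fun v => v.snd.snd.snd.snd)
    (init := fun v => .pair (.pair v.snd.snd.snd.snd (.pair (.real 0) .nil)) .nil)
    (g := fun _ acc v => Val.round v.fst v.snd.fst v.snd.snd.fst v.snd.snd.snd.fst acc)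
    (fun _ _ h => h) id.snd.snd.snd.snd ((id.snd.snd.snd.snd.pair (zero.pair nil)).pair nil)
    hstep ?_
  refine ⟨fun s => (s + 1) * ((s + 4 + s * (2 * s + 10)) + 1) + 1, ?_, fun s hs v hv m hm => ?_⟩
  · exact ((PolyBound.self.add (.const 1)).mul (((PolyBound.self.add (.const 4)).add
      (PolyBound.self.mul (((PolyBound.const 2).mul .self).add (.const 10)))).add (.const 1))).add
      (.const 1)
  have hv : v.size ≤ s := hv
  have h1 := Val.size_fst_le v
  have h2 := Val.size_snd_le v
  have h3 := Val.size_snd_le v.snd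
  have h4 := Val.size_fst_le v.snd.snd
  have h5 := Val.size_snd_le v.snd.snd
  have h6 := Val.size_snd_le v.snd.snd.snd
  have hlen : m.length ≤ s := by
    have := hm.length_le
    have := Val.length_toList_le v.snd.snd.snd.snd
    lia
  generalize hw : Val.pair (.pair v.snd.snd.snd.snd (.pair (.real 0) .nil)) .nil = w
  -- The cap B bounds the number of entries (the start table has one), and a round adds at most 2 *
  -- s + 10 to the size of an entry. With at most s rounds the table stays polynomial.
  have key : ∀ m : List Val,
      (m.foldl (fun acc _ => Val.round v.fst v.snd.fst v.snd.snd.fst v.snd.snd.snd.fst acc)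
        w).toList.length ≤ s + 1 ∧
      ∀ x ∈ (m.foldl (fun acc _ => Val.round v.fst v.snd.fst v.snd.snd.fst v.snd.snd.snd.fst acc)
        w).toList, x.size ≤ s + 4 + m.length * (2 * s + 10) := by
    intro m
    induction m using List.reverseRecOn with
    | nil => subst hw; simp [Val.toList, Val.size]; lia
    | append_singleton m y ih =>
      simp only [List.foldl_append, List.foldl_cons, List.foldl_nil, List.length_append,
        List.length_cons, List.length_nil] at ih ⊢
      refine ⟨(length_round_le _ _ _ _ _).trans ?_, fun x hx => ?_⟩
      · have := Val.length_toList_le v.fst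
        lia
      · rcases mem_round hx with h | h
        · have := ih.2 x h
          lia
        · obtain ⟨y, hy, k, hk, -, rfl⟩ := mem_expansions.1 h
          have := ih.2 y hy
          have := size_extend_le v.snd.fst y k
          have := Val.size_le_of_mem hk
          lia
  have hm2 := Nat.mul_le_mul_right (2 * s + 10) hlen
  have hfin := Val.size_list_le (key m).1 fun x hx => ((key m).2 x hx).trans
    (by lia : _ ≤ s + 4 + s * (2 * s + 10))
  refine le_trans ?_ hfin
  rw [Val.size_list]
  exact Val.size_le_sum_toList _

theorem solution (ha : PolyTime SizeLe a) (hb : PolyTime SizeLe b) (hc : PolyTime SizeLe c)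
    (hd : PolyTime SizeLe d) (he : PolyTime SizeLe e) :
    PolyTime SizeLe fun v => Val.solution (a v) (b v) (c v) (d v) (e v) :=
  (vfilter (table ha hb hc hd he) (PolyDec.eq_nil id.fst.fst)).fst

theorem solutions (ha : PolyTime SizeLe a) (hb : PolyTime SizeLe b) (hc : PolyTime SizeLe c)
    (hd : PolyTime SizeLe d) (he : PolyTime SizeLe e) :
    PolyTime SizeLe fun v => Val.solutions (a v) (b v) (c v) (d v) (e v) := by
  refine map (vfilter (edgesBetween hb hd) (PolyDec.or ?_ ?_)) (solution ha.up hb.up hc.up he.up.fst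
    (vfilter (edgesBetween hb.up hd.up) ?_))
  · exact nodeMem id.fst.fst he.up
  · exact nodeMem id.fst.snd he.up
  · exact beyond hb.up.up he.up.up.fst id.snd.fst id.fst

theorem union (ha : PolyTime SizeLe a) : PolyTime SizeLe fun v => Val.union (a v) := by
  refine pair (fold (g := fun x acc _ => (Val.pair acc x.snd.fst).add) (fun _ _ h => h) ha zero
    (add id.snd.fst id.fst.snd.fst) ?_) (flatMap ha id.fst.snd.snd)
  refine ⟨_, .const 1, fun s hs v hv m hm => ?_⟩
  rcases List.eq_nil_or_concat m with rfl | ⟨m, x, rfl⟩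
  · simp [Val.size]
  · rw [List.concat_eq_append, List.foldl_append]
    exact size_add_le _

theorem candidates (ha : PolyTime SizeLe a) (hb : PolyTime SizeLe b) (hc : PolyTime SizeLe c)
    (hd : PolyTime SizeLe d) :
    PolyTime SizeLe fun v => Val.candidates (a v) (b v) (c v) (d v) := by
  refine map (vfilter hd (PolyDec.forall_mem (solutions ha.up hb.up hc.up hd.up id.fst) ?_))
    (union (solutions ha.up hb.up hc.up hd.up id.fst))
  exact PolyDec.of_ne_nil id.fst

theorem cheapest (ha : PolyTime SizeLe a) : PolyTime SizeLe fun v => Val.cheapest (a v) := by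
  refine fold (g := fun x acc _ => Val.ite (acc = .nil ∨ (Val.pair x.fst acc.fst).le ≠ .nil) x acc)
    (fun _ _ h => h) ha nil
    (vite ((PolyDec.eq_nil id.snd.fst).or (PolyDec.le id.fst.fst id.snd.fst.fst)) id.fst id.snd.fst)
    ?_
  obtain ⟨_, d, hd⟩ := ha
  refine ⟨_, (PolyBound.pow d), fun s hs v hv m hm => ?_⟩
  have h := (hd s hs v hv).1
  replace hm : ∀ x ∈ m, x.size ≤ s ^ d := fun x hx => (Val.size_le_of_mem (hm.subset hx)).trans h
  clear h
  induction m using List.reverseRecOn with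
  | nil => simpa [Val.size] using Nat.one_le_pow d s (by lia)
  | append_singleton m y ih =>
    simp only [List.foldl_append, List.foldl_cons, List.foldl_nil]
    have h1 := ih fun x hx => hm x (by simp [hx])
    have h2 := hm y (by simp)
    rw [Val.ite]
    split_ifs
    · exact h2
    · exact h1

theorem algorithm (ha : PolyTime SizeLe a) (hb : PolyTime SizeLe b) (hc : PolyTime SizeLe c)
    (hd : PolyTime SizeLe d) :
    PolyTime SizeLe fun v => Val.algorithm (a v) (b v) (c v) (d v) :=
  (cheapest (candidates ha hb hc hd)).snd

end PolyTime
end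
end TreeAug

/-! ### Separation by edges of a tree, and fractional covers by chains. -/

namespace TreeAug

open SimpleGraph

/-! ### Edges that separate two nodes -/

section Separation

variable {V : Type*} {G : SimpleGraph V} {e f : Sym2 V} {p q r : V}

/-- The nodes `p` and `q` are in different components of `G - e`. -/
def Sep (G : SimpleGraph V) (e : Sym2 V) (p q : V) : Prop := ¬ (G.deleteEdges {e}).Reachable p q

theorem Sep.symm (h : Sep G e p q) : Sep G e q p := fun h' => h h'.symm

theorem not_sep_self : ¬ Sep G e p p := fun h => h (Reachable.refl p)

theorem not_sep_trans (h₁ : ¬ Sep G e p q) (h₂ : ¬ Sep G e q r) : ¬ Sep G e p r := by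
  unfold Sep at *
  push Not at *
  exact h₁.trans h₂

theorem not_sep_symm (h : ¬ Sep G e p q) : ¬ Sep G e q p := fun h' => h h'.symm

theorem not_sep_of_adj (h : G.Adj p q) (he : e ≠ s(p, q)) : ¬ Sep G e p q := by
  unfold Sep
  push Not
  exact Adj.reachable (deleteEdges_adj.2 ⟨h, fun h' => he (Set.mem_singleton_iff.1 h').symm⟩)

theorem Sep.of_not_left (h : Sep G e p q) (h' : ¬ Sep G e p r) : Sep G e r q :=
  fun h'' => not_sep_trans h' (not_not.2 h'') h

theorem Sep.of_not_right (h : Sep G e p q) (h' : ¬ Sep G e q r) : Sep G e p r :=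
  (h.symm.of_not_left h').symm

/-- Deleting an edge of a connected graph leaves at most two components, each containing an end:
follow a walk from p up to its first use of the edge. -/
theorem not_sep_or (hG : G.Connected) {a b : V} (p : V) :
    ¬ Sep G s(a, b) p a ∨ ¬ Sep G s(a, b) p b := by
  obtain ⟨w⟩ := hG.preconnected p a
  induction w with
  | nil => exact .inl not_sep_self
  | @cons p p' a h w ih =>
    by_cases he : s(a, b) = s(p, p')
    · rcases Sym2.eq_iff.1 he with ⟨rfl, rfl⟩ | ⟨rfl, rfl⟩
      · exact .inl not_sep_self
      · exact .inr not_sep_self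
    · exact ih.imp (not_sep_trans (not_sep_of_adj h he)) (not_sep_trans (not_sep_of_adj h he))

/-- Pigeonhole on the two components of `not_sep_or`. -/
theorem Sep.not_sep (hG : G.Connected) (h₁ : Sep G e p q) (h₂ : Sep G e q r) : ¬ Sep G e p r := by
  induction e with | _ a b
  rcases not_sep_or hG (a := a) (b := b) p with hp | hp <;>
  rcases not_sep_or hG (a := a) (b := b) q with hq | hq <;>
  rcases not_sep_or hG (a := a) (b := b) r with hr | hr
  all_goals first
    | exact not_sep_trans hp (not_sep_symm hr)
    | exact absurd h₁ (not_sep_trans hp (not_sep_symm hq))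
    | exact absurd h₂ (not_sep_trans hq (not_sep_symm hr))

theorem sep_of_adj (hG : G.IsAcyclic) (h : G.Adj p q) : Sep G s(p, q) p q :=
  isBridge_iff.1 (isAcyclic_iff_forall_adj_isBridge.1 hG h)

/-- If the nodes `p` and `q` are on one side of `e` and an end of `f` is on the other side, then
`f` does not separate `p` and `q`. -/
theorem not_sep_of_end (h : ¬ Sep G e p q) {c : V} (hc : c ∈ f) (hf : Sep G e p c) :
    ¬ Sep G f p q := by
  unfold Sep at h
  push Not at h
  obtain ⟨w⟩ := h
  induction w with
  | nil => exact not_sep_self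
  | @cons p p' q h w ih =>
    have hpp' : ¬ Sep G e p p' := fun h' => h' h.reachable
    have hadj := (deleteEdges_adj.1 h).1
    refine not_sep_trans (not_sep_of_adj hadj ?_) (ih (hf.of_not_left hpp'))
    rintro rfl
    rcases Sym2.mem_iff.1 hc with rfl | rfl
    · exact not_sep_self hf
    · exact hpp' hf

/-- A walk that avoids e could be shortened to a path that avoids e, and this would be the unique
p-q path. From here on, coverage is always treated as separation. -/
theorem mem_pathEdges (hG : G.IsTree) :
    e ∈ pathEdges G s(p, q) ↔ e ∈ G.edgeSet ∧ Sep G e p q := by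
  have key : ∀ {p q : V} (w : G.Walk p q), w.IsPath → (e ∈ w.edges ↔ e ∈ G.edgeSet ∧ Sep G e p q) := by
    classical
    intro p q w hw
    refine ⟨fun he => ⟨w.edges_subset_edgeSet he, fun hr => ?_⟩, fun ⟨_, he⟩ => ?_⟩
    · obtain ⟨u⟩ := hr
      let u' := (u.mapLe (deleteEdges_le (G := G) {e})).bypass
      have hu' : u'.IsPath := Walk.bypass_isPath _
      have heq : w = u' := (hG.existsUnique_path p q).unique hw hu'
      rw [heq] at he
      have h1 := Walk.edges_bypass_subset_edges _ he
      rw [Walk.edges_mapLe_eq_edges] at h1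
      have := u.edges_subset_edgeSet h1
      rw [edgeSet_deleteEdges] at this
      exact this.2 rfl
    · by_contra h
      exact he ⟨w.toDeleteEdges {e} fun f hf hfe => h (hfe ▸ hf)⟩
  constructor
  · rintro ⟨p', q', hpq, w, hw, he⟩
    have := (key w hw).1 he
    rcases Sym2.eq_iff.1 hpq with ⟨rfl, rfl⟩ | ⟨rfl, rfl⟩
    · exact this
    · exact ⟨this.1, this.2.symm⟩
  · intro h
    obtain ⟨w, hw, -⟩ := hG.existsUnique_path p q
    exact ⟨p, q, rfl, w, hw, (key w hw).2 h⟩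

theorem pathEdges_diag (hG : G.IsTree) (p : V) : pathEdges G s(p, p) = ∅ := by
  ext e
  simp [mem_pathEdges hG, not_sep_self]

/-- Orients e with respect to the root r: a is its lower end, b its upper end. -/
theorem sep_or_of_mem (hG : G.IsTree) (he : e ∈ G.edgeSet) (r : V) :
    ∃ a b, e = s(a, b) ∧ Sep G e r a ∧ ¬ Sep G e r b := by
  induction e with | _ a b
  have hab := sep_of_adj hG.isAcyclic he
  by_cases h : Sep G s(a, b) r a
  · exact ⟨a, b, rfl, h, h.not_sep hG.connected hab⟩
  · exact ⟨b, a, Sym2.eq_swap, hab.of_not_left (not_sep_symm h), h⟩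

theorem not_sep_of_mem (he : e ∈ G.edgeSet) (hef : f ≠ e) {a b : V} (ha : a ∈ e) (hb : b ∈ e) :
    ¬ Sep G f a b := by
  induction e with | _ c d
  rcases Sym2.mem_iff.1 ha with rfl | rfl <;> rcases Sym2.mem_iff.1 hb with rfl | rfl
  · exact not_sep_self
  · exact not_sep_of_adj he hef
  · exact not_sep_symm (not_sep_of_adj he hef)
  · exact not_sep_self

/-- The sets of nodes that are separated from `r` by an edge form a laminar family. -/
theorem sep_laminar (hG : G.IsTree) (hf : f ∈ G.edgeSet) (he' : Sep G e r p) (hf' : Sep G f r p) :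
    (∀ q, Sep G e r q → Sep G f r q) ∨ ∀ q, Sep G f r q → Sep G e r q := by
  by_cases hef : e = f
  · subst hef; exact .inl fun _ h => h
  obtain ⟨c, d, hcd, -, -⟩ := sep_or_of_mem hG hf r
  have hc : c ∈ f := by simp [hcd]
  -- If an end c of f lies beyond e, then f cannot separate r from a node on the side of r, so the
  -- far side of f is inside that of e. Otherwise f does not separate any two nodes beyond e, and p
  -- shows that all of them are beyond f.
  by_cases h : Sep G e r c
  · refine .inr fun q hq => ?_
    by_contra hq'
    exact not_sep_of_end hq' hc h hq
  · refine .inl fun q hq => ?_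
    exact hf'.of_not_right (not_sep_of_end (he'.symm.not_sep hG.connected hq) hc
      (he'.symm.of_not_right h))

end Separation

/-! ### Covering with links that form chains -/

/-- Local ratio. By `hA`, the sets through e form a chain on the elements at least as heavy as e.
Take a lightest e that no zero-cost set covers, and lower the costs of all sets through e by their
minimum. As y covers e at least once, the fractional cost drops by at least this minimum. A solution
for the lowered costs needs only one of its sets through e for the elements at least as heavy as e;
lighter elements are covered by zero-cost sets. So undoing the reduction costs the minimum only
once. -/
theorem exists_cover_le {E ι : Type*} [Fintype ι] (X : Finset E) (A : ι → Set E) (w : E → ℕ)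
    (hA : ∀ e ∈ X, ∀ i j, e ∈ A i → e ∈ A j → (∀ f ∈ X, w e ≤ w f → f ∈ A i → f ∈ A j) ∨
      ∀ f ∈ X, w e ≤ w f → f ∈ A j → f ∈ A i)
    (y : ι → ℝ) (hy : ∀ i, 0 ≤ y i)
    (hX : ∀ e ∈ X, 1 ≤ ∑ i ∈ (Set.toFinite {i | e ∈ A i}).toFinset, y i)
    (c : ι → ℝ) (hc : ∀ i, 0 ≤ c i) :
    ∃ S : Finset ι, (∀ e ∈ X, ∃ i ∈ S, e ∈ A i) ∧ ∑ i ∈ S, c i ≤ ∑ i, c i * y i := by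
  classical
  have hfin : ∀ e, (Set.toFinite {i | e ∈ A i}).toFinset = Finset.univ.filter fun i => e ∈ A i := by
    intro e; ext; simp
  simp only [hfin] at hX
  induction hk : (Finset.univ.filter fun i => 0 < c i).card using Nat.strong_induction_on
    generalizing c with
  | _ k ih =>
  by_cases h : ∀ e ∈ X, ∃ i, c i = 0 ∧ e ∈ A i
  · refine ⟨Finset.univ.filter fun i => c i = 0, fun e he => ?_, ?_⟩
    · obtain ⟨i, hi, hi'⟩ := h e he
      exact ⟨i, by simp [hi], hi'⟩
    · rw [Finset.sum_eq_zero (by simp)]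
      exact Finset.sum_nonneg fun i _ => mul_nonneg (hc i) (hy i)
  push Not at h
  obtain ⟨e, he, hmin⟩ := Finset.exists_min_image (X.filter fun e => ∀ i, c i = 0 → e ∉ A i) w (by
    obtain ⟨e, he, h⟩ := h
    exact ⟨e, by simp only [Finset.mem_filter]; exact ⟨he, h⟩⟩)
  simp only [Finset.mem_filter] at he hmin
  obtain ⟨heX, he⟩ := he
  have hpos : ∀ i, e ∈ A i → 0 < c i := fun i hi =>
    lt_of_le_of_ne (hc i) fun h0 => he i h0.symm hi
  obtain ⟨i₁, hi₁, hmin₁⟩ := Finset.exists_min_image (Finset.univ.filter fun i => e ∈ A i) c (by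
    by_contra hne
    rw [Finset.not_nonempty_iff_eq_empty] at hne
    have := hX e heX
    rw [hne, Finset.sum_empty] at this
    linarith)
  simp only [Finset.mem_filter, Finset.mem_univ, true_and] at hi₁ hmin₁
  set c' : ι → ℝ := fun i => if e ∈ A i then c i - c i₁ else c i with hc'
  have hc'0 : ∀ i, 0 ≤ c' i := by
    intro i
    simp only [hc']
    split_ifs with hi
    · exact sub_nonneg.2 (hmin₁ i hi)
    · exact hc i
  have hlt : (Finset.univ.filter fun i => 0 < c' i).card < k := by
    rw [← hk]
    refine Finset.card_lt_card ⟨fun i hi => ?_, fun hsub => ?_⟩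
    · simp only [Finset.mem_filter, Finset.mem_univ, true_and, hc'] at hi ⊢
      split_ifs at hi with hi'
      · exact hpos i hi'
      · exact hi
    · have := hsub (Finset.mem_filter.2 ⟨Finset.mem_univ i₁, hpos i₁ hi₁⟩)
      simp [hc', hi₁] at this
  obtain ⟨S, hS, hcost⟩ := ih _ hlt c' hc'0 rfl
  -- Of the chosen sets through e, the one with the most elements at least as heavy as e contains
  -- all such elements of the others, by the chain condition.
  obtain ⟨i₀, hi₀, hmax⟩ := Finset.exists_max_image (S.filter fun i => e ∈ A i)
    (fun i => (X.filter fun f => w e ≤ w f ∧ f ∈ A i).card) (by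
      obtain ⟨i, hi, hi'⟩ := hS e heX
      exact ⟨i, Finset.mem_filter.2 ⟨hi, hi'⟩⟩)
  simp only [Finset.mem_filter] at hi₀ hmax
  have htop : ∀ i ∈ S, e ∈ A i → ∀ f ∈ X, w e ≤ w f → f ∈ A i → f ∈ A i₀ := by
    intro i hi hei
    rcases hA e heX i i₀ hei hi₀.2 with h | h
    · exact h
    · have heq := Finset.eq_of_subset_of_card_le
        (s := X.filter fun f => w e ≤ w f ∧ f ∈ A i₀) (t := X.filter fun f => w e ≤ w f ∧ f ∈ A i)
        (fun f hf => by
          simp only [Finset.mem_filter] at hf ⊢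
          exact ⟨hf.1, hf.2.1, h f hf.1 hf.2.1 hf.2.2⟩) (hmax i ⟨hi, hei⟩)
      intro f hf hw hfi
      have : f ∈ X.filter fun f => w e ≤ w f ∧ f ∈ A i := by simp [hf, hw, hfi]
      rw [← heq] at this
      exact (Finset.mem_filter.1 this).2.2
  refine ⟨((S.filter fun i => e ∉ A i) ∪ Finset.univ.filter fun i => c i = 0) ∪ {i₀},
    fun f hf => ?_, ?_⟩
  · by_cases hw : w e ≤ w f
    · obtain ⟨i, hi, hfi⟩ := hS f hf
      by_cases hei : e ∈ A i
      · exact ⟨i₀, by simp, htop i hi hei f hf hw hfi⟩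
      · exact ⟨i, by simp [hi, hei], hfi⟩
    · by_contra hcon
      refine hw (hmin f ⟨hf, fun i hi hfi => hcon ⟨i, by simp [hi], hfi⟩⟩)
  · have h1 : ∑ i ∈ ((S.filter fun i => e ∉ A i) ∪ Finset.univ.filter fun i => c i = 0) ∪ {i₀}, c i ≤
        ∑ i ∈ S.filter (fun i => e ∉ A i), c i + c i₀ := by
      have haux : ∀ s t : Finset ι, ∑ i ∈ s ∪ t, c i ≤ ∑ i ∈ s, c i + ∑ i ∈ t, c i := by
        intro s t
        rw [← Finset.sum_union_inter]
        exact le_add_of_nonneg_right (Finset.sum_nonneg fun i _ => hc i)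
      have h0 : ∑ i ∈ Finset.univ.filter (fun i => c i = 0), c i = 0 :=
        Finset.sum_eq_zero (by simp)
      have h1 := haux ((S.filter fun i => e ∉ A i) ∪ Finset.univ.filter fun i => c i = 0) {i₀}
      have h2 := haux (S.filter fun i => e ∉ A i) (Finset.univ.filter fun i => c i = 0)
      rw [Finset.sum_singleton] at h1
      linarith
    have h2 : ∑ i ∈ S.filter (fun i => e ∉ A i), c i + c' i₀ ≤ ∑ i ∈ S, c' i := by
      rw [← Finset.sum_filter_not_add_sum_filter S (fun i => e ∈ A i) c']
      refine add_le_add (Finset.sum_le_sum fun i hi => ?_) ?_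
      · simp [hc', (Finset.mem_filter.1 hi).2]
      · exact Finset.single_le_sum (f := c') (fun i _ => hc'0 i) (Finset.mem_filter.2 hi₀)
    have h3 : ∑ i, c i * y i = ∑ i, c' i * y i + c i₁ * ∑ i with e ∈ A i, y i := by
      rw [Finset.mul_sum, Finset.sum_filter, ← Finset.sum_add_distrib]
      refine Finset.sum_congr rfl fun i _ => ?_
      simp only [hc']
      split_ifs <;> ring
    have h4 : c i₁ ≤ c i₁ * ∑ i with e ∈ A i, y i := le_mul_of_one_le_right (hc i₁) (hX e heX)
    have h5 : c i₀ = c' i₀ + c i₁ := by simp [hc', hi₀.2]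
    linarith

end TreeAug

/-! ### Rooted trees: ascending paths, bundles, and the factor 2 for fractional covers. -/

namespace TreeAug

open SimpleGraph

section RootedTree

variable {V : Type*} {G : SimpleGraph V} {e f : Sym2 V} {a b r : V}

/-- An edge is determined by its lower end. -/
theorem eq_of_sep_of_mem (hG : G.IsTree) (he : e ∈ G.edgeSet) (hf : f ∈ G.edgeSet)
    (hae : a ∈ e) (haf : a ∈ f) (h : Sep G e r a) (h' : Sep G f r a) : e = f := by
  have key : ∀ {e f : Sym2 V}, e ∈ G.edgeSet → f ∈ G.edgeSet → a ∈ e → a ∈ f → Sep G e r a →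
      Sep G f r a → (∀ q, Sep G e r q → Sep G f r q) → e = f := by
    intro e f he hf hae haf h h' hsub
    by_contra hne
    obtain ⟨c, d, rfl, hc, hd⟩ := sep_or_of_mem hG hf r
    have : a = c := by
      rcases Sym2.mem_iff.1 haf with rfl | rfl
      · rfl
      · exact absurd h' hd
    subst this
    exact hd (hsub d (h.of_not_right (not_sep_of_mem hf hne haf (by simp))))
  rcases sep_laminar hG hf h h' with hs | hs
  · exact key he hf hae haf h h' hs
  · exact (key hf he haf hae h' h hs).symm

/-- The number of nodes that `e` separates from `r`. -/
noncomputable def weight (G : SimpleGraph V) (r : V) (e : Sym2 V) : ℕ := {p | Sep G e r p}.ncard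

/-- The edges that separate one node from r form a chain by laminarity, and `weight` sorts it. -/
theorem sep_of_weight_le [Finite V] (hG : G.IsTree) (hf : f ∈ G.edgeSet) (he' : Sep G e r a)
    (hf' : Sep G f r a) (hw : weight G r e ≤ weight G r f) {q : V} (hq : Sep G e r q) :
    Sep G f r q := by
  rcases sep_laminar hG hf he' hf' with h | h
  · exact h q hq
  · have := Set.eq_of_subset_of_ncard_le (s := {p | Sep G f r p}) (t := {p | Sep G e r p}) h hw
    exact this.symm.subset hq

/-- The edge `f` is the next edge above `e`. -/
def Next (G : SimpleGraph V) (r : V) (X : Set (Sym2 V)) (e f : Sym2 V) : Prop :=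
  f ∈ X ∧ ∃ b ∈ e, b ∈ f ∧ ¬ Sep G e r b ∧ Sep G f r b

theorem Next.sep (hG : G.IsTree) {X : Set (Sym2 V)} (he : e ∈ G.edgeSet) (hX : X ⊆ G.edgeSet)
    (h : Next G r X e f) : ∀ q, Sep G e r q → Sep G f r q := by
  obtain ⟨hf, b, hbe, hbf, h1, h2⟩ := h
  obtain ⟨a, b', rfl, ha, hb⟩ := sep_or_of_mem hG he r
  have hne : f ≠ s(a, b') := fun h => h1 (h ▸ h2)
  have ha' : Sep G f r a := h2.of_not_right (not_sep_of_mem he hne hbe (by simp))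
  rcases sep_laminar hG (hX hf) ha ha' with h | h
  · exact h
  · exact absurd (h b h2) h1

theorem Next.weight_lt [Finite V] (hG : G.IsTree) {X : Set (Sym2 V)} (he : e ∈ G.edgeSet)
    (hX : X ⊆ G.edgeSet) (h : Next G r X e f) : weight G r e < weight G r f := by
  have h1 := h.sep hG he hX
  obtain ⟨-, b, -, -, h2, h3⟩ := h
  exact Set.ncard_lt_ncard ⟨h1, fun h => h2 (h h3)⟩

/-- Climb from the lower end a of e as long as X has an edge above. That edge is unique, since an
edge is determined by its lower end, so the edges reached form a single path. The weights increase
along the way, which makes the climb finite. -/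
theorem exists_path_of_next [Finite V] (hG : G.IsTree) {X : Set (Sym2 V)} (hX : X ⊆ G.edgeSet) :
    ∀ e ∈ X, ∀ a ∈ e, Sep G e r a → ∃ t, ¬ Sep G e r t ∧
      pathEdges G s(a, t) = {g | Relation.ReflTransGen (Next G r X) e g} := by
  intro e
  induction hk : Nat.card V - weight G r e using Nat.strong_induction_on generalizing e with
  | _ k ih =>
  intro heX a hae ha
  have he := hX heX
  have hb : ∃ b, e = s(a, b) ∧ ¬ Sep G e r b := by
    obtain ⟨a', b, rfl, ha', hb⟩ := sep_or_of_mem hG he r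
    rcases Sym2.mem_iff.1 hae with rfl | rfl
    · exact ⟨b, rfl, hb⟩
    · exact absurd ha hb
  obtain ⟨b, rfl, hb⟩ := hb
  have hbu : ∀ b' ∈ s(a, b), ¬ Sep G s(a, b) r b' → b' = b := by
    intro b' hb' h
    rcases Sym2.mem_iff.1 hb' with rfl | rfl
    · exact absurd ha h
    · rfl
  have hsep : ∀ f, f ≠ s(a, b) → ¬ Sep G f a b := fun f hf =>
    not_sep_of_mem he hf (by simp) (by simp)
  by_cases h : ∃ f, Next G r X s(a, b) f
  · obtain ⟨f, hf⟩ := h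
    have hlt := hf.weight_lt hG he hX
    have hle : weight G r f ≤ Nat.card V := Set.ncard_le_card _
    have hsub := hf.sep hG he hX
    have hf0 := hf
    obtain ⟨hfX, b', hb'e, hb'f, h1, h2⟩ := hf
    obtain rfl := hbu b' hb'e h1
    obtain ⟨t, ht, hpt⟩ := ih _ (by lia) f rfl hfX b' hb'f h2
    have hte : ¬ Sep G s(a, b') r t := fun h => ht (hsub t h)
    refine ⟨t, hte, Set.ext fun g => ?_⟩
    have hg : g ∈ pathEdges G s(b', t) ↔ Relation.ReflTransGen (Next G r X) f g := by
      rw [hpt]; rfl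
    rw [Set.mem_ofPred_eq, mem_pathEdges hG]
    rw [mem_pathEdges hG] at hg
    by_cases hge : g = s(a, b')
    · subst hge
      exact ⟨fun _ => .refl, fun _ => ⟨he, ha.symm.of_not_right hte⟩⟩
    · have h3 : Sep G g a t ↔ Sep G g b' t :=
        ⟨fun h => h.of_not_left (hsep g hge), fun h => h.of_not_left (not_sep_symm (hsep g hge))⟩
      rw [h3, hg]
      refine ⟨fun h => .head hf0 h, fun h => ?_⟩
      rcases Relation.ReflTransGen.cases_head h with h | ⟨f', hf', h⟩
      · exact absurd h.symm hge
      · obtain ⟨hfX', b'', hb''e, hb''f, h1', h2'⟩ := hf'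
        obtain rfl := hbu b'' hb''e h1'
        rwa [eq_of_sep_of_mem hG (hX hfX) (hX hfX') hb'f hb''f h2 h2']
  · refine ⟨b, hb, Set.ext fun g => ?_⟩
    rw [Set.mem_ofPred_eq, mem_pathEdges hG]
    constructor
    · rintro ⟨-, hg⟩
      by_cases hge : g = s(a, b)
      · rw [hge]
      · exact absurd hg (hsep g hge)
    · intro hg
      rcases Relation.ReflTransGen.cases_head hg with rfl | ⟨f, hf, -⟩
      · exact ⟨he, ha.symm.of_not_right hb⟩
      · exact absurd ⟨f, hf⟩ h

/-- The edge `e` of `X` is the lowest edge of a maximal ascending path in `X`. -/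
def IsStart (G : SimpleGraph V) (r : V) (X : Set (Sym2 V)) (e : Sym2 V) : Prop :=
  e ∈ X ∧ ∀ a ∈ e, Sep G e r a → ∀ f ∈ X, a ∈ f → f = e

/-- If g is no start, another edge of X hangs at its lower end. That edge has smaller weight and g
is next above it, so the descent ends. -/
theorem exists_isStart [Finite V] (hG : G.IsTree) {X : Set (Sym2 V)} (hX : X ⊆ G.edgeSet) :
    ∀ g ∈ X, ∃ e, IsStart G r X e ∧ Relation.ReflTransGen (Next G r X) e g := by
  intro g
  induction hk : weight G r g using Nat.strong_induction_on generalizing g with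
  | _ k ih =>
  intro hg
  by_cases h : IsStart G r X g
  · exact ⟨g, h, .refl⟩
  · simp only [IsStart, hg, true_and, not_forall] at h
    obtain ⟨a, hag, ha, f, hf, haf, hne⟩ := h
    have hn : Next G r X f g := ⟨hg, a, haf, hag,
      fun h => hne (eq_of_sep_of_mem hG (hX hf) (hX hg) haf hag h ha), ha⟩
    obtain ⟨e, he, heg⟩ := ih _ (hk ▸ hn.weight_lt hG (hX hf) hX) f rfl hf
    exact ⟨e, he, heg.tail hn⟩

end RootedTree

noncomputable section

open scoped Classical

namespace Instance

variable {n : ℕ} {I : Instance n}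

/-- Every edge of X is reached by climbing from a start, so the ascending paths from the starts have
union X; they may overlap. Superfluous indices get the empty path from r to r. -/
theorem isBundle_of_ncard_le (r : Fin n) {X : Set (Sym2 (Fin n))} (hX : X ⊆ I.tree.edgeSet) {γ : ℕ}
    (hγ : {e | IsStart I.tree r X e}.ncard ≤ γ) : I.IsBundle γ X := by
  set F := {e | IsStart I.tree r X e}.toFinset with hF
  have hcard : F.card ≤ γ := by rwa [hF, ← Set.ncard_eq_toFinset_card']
  have hpath : ∀ e : Sym2 (Fin n), ∃ s : Sym2 (Fin n), e ∈ X →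
      pathEdges I.tree s = {g | Relation.ReflTransGen (Next I.tree r X) e g} := by
    intro e
    by_cases he : e ∈ X
    · obtain ⟨a, b, hab, ha, -⟩ := sep_or_of_mem I.isTree (hX he) r
      obtain ⟨t, -, ht⟩ := exists_path_of_next (r := r) I.isTree hX e he a (by simp [hab]) ha
      exact ⟨_, fun _ => ht⟩
    · exact ⟨s(r, r), fun h => absurd h he⟩
  choose s hs using hpath
  refine ⟨fun i => if h : (i : ℕ) < F.card then s (F.equivFin.symm ⟨i, h⟩) else s(r, r),
    Set.ext fun g => ?_⟩
  rw [Set.mem_iUnion]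
  constructor
  · intro hg
    obtain ⟨e, he, heg⟩ := exists_isStart (r := r) I.isTree hX g hg
    have heF : e ∈ F := by simpa [hF] using he
    refine ⟨⟨F.equivFin ⟨e, heF⟩, (F.equivFin ⟨e, heF⟩).2.trans_le hcard⟩, ?_⟩
    simp only [Fin.is_lt, dite_true, Fin.eta, Equiv.symm_apply_apply]
    rw [hs e he.1]
    exact heg
  · rintro ⟨i, hi⟩
    beta_reduce at hi
    split_ifs at hi with h
    · have heF := (F.equivFin.symm ⟨i, h⟩).2
      have he : IsStart I.tree r X (F.equivFin.symm ⟨i, h⟩) := by simpa [hF] using heF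
      rw [hs _ he.1] at hi
      rcases Relation.ReflTransGen.cases_tail hi with h | ⟨_, _, h⟩
      · rw [h]; exact he.1
      · exact h.1
    · rw [pathEdges_diag I.isTree] at hi
      exact hi.elim

/-! ### Optimal covers -/

theorem setCost_nonneg (hc : ∀ o ∈ I.origLinks, 0 ≤ I.cost o) (S : Finset I.Link) :
    0 ≤ I.setCost S := Finset.sum_nonneg fun l _ => hc _ l.2.1

theorem opt_le (hc : ∀ o ∈ I.origLinks, 0 ≤ I.cost o) {S : Finset I.Link}
    {X : Set (Sym2 (Fin n))} (hS : I.Covers S X) : I.opt X ≤ I.setCost S := by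
  refine csInf_le ⟨0, ?_⟩ ⟨S, hS, rfl⟩
  rintro _ ⟨S, -, rfl⟩
  exact setCost_nonneg hc S

theorem exists_setCost_eq_opt {S : Finset I.Link} {X : Set (Sym2 (Fin n))} (hS : I.Covers S X) :
    ∃ S, I.Covers S X ∧ I.setCost S = I.opt X := by
  have hfin : {t | ∃ S : Finset I.Link, I.Covers S X ∧ t = I.setCost S}.Finite :=
    (Set.finite_range I.setCost).subset (by rintro _ ⟨S, -, rfl⟩; exact ⟨S, rfl⟩)
  obtain ⟨S', h1, h2⟩ := Set.Nonempty.csInf_mem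
    (s := {t | ∃ S : Finset I.Link, I.Covers S X ∧ t = I.setCost S}) ⟨_, S, hS, rfl⟩ hfin
  exact ⟨S', h1, h2.symm⟩

/-- The total cost in `x` of the links that cover an edge in `X`. -/
def coverCost (I : Instance n) (x : I.Link → ℝ) (X : Set (Sym2 (Fin n))) : ℝ :=
  ∑ l with ∃ e ∈ X, e ∈ pathEdges I.tree l.1.2, I.cost l.1.1 * x l

theorem mem_pathEdges_out {e : Sym2 (Fin n)} (l : I.Link) : e ∈ pathEdges I.tree l.1.2 ↔
    e ∈ I.tree.edgeSet ∧ Sep I.tree e l.1.2.out.1 l.1.2.out.2 := by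
  rw [← mem_pathEdges I.isTree, Sym2.mk, Prod.mk.eta, Quot.out_eq]

/-- The natural relaxation of the covering problem has integrality gap at most 2. -/
theorem opt_le_two_mul_coverCost (hc : ∀ o ∈ I.origLinks, 0 ≤ I.cost o) {x : I.Link → ℝ}
    (hx : ∀ l, 0 ≤ x l) {X : Set (Sym2 (Fin n))} (hX : X ⊆ I.tree.edgeSet)
    (hcov : ∀ e ∈ X, 1 ≤ I.coverage x e) : I.opt X ≤ 2 * I.coverCost x X := by
  obtain ⟨r⟩ := I.isTree.nonempty
  have hG := I.isTree
  -- Every link is cut at its highest node. The half with lower end `lo` covers the edges that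
  -- separate r from `lo` but not from `top`.
  let lo : I.Link × Bool → Fin n := fun i => if i.2 then i.1.1.2.out.1 else i.1.1.2.out.2
  let top : I.Link × Bool → Fin n := fun i => if i.2 then i.1.1.2.out.2 else i.1.1.2.out.1
  let A : I.Link × Bool → Set (Sym2 (Fin n)) := fun i =>
    {e | e ∈ X ∧ Sep I.tree e r (lo i) ∧ ¬ Sep I.tree e r (top i)}
  have hAsub : ∀ i e, e ∈ A i → e ∈ pathEdges I.tree i.1.1.2 := by
    rintro ⟨l, b⟩ e ⟨h1, h2, h3⟩
    refine (mem_pathEdges_out l).2 ⟨hX h1, ?_⟩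
    cases b
    · exact (h2.symm.of_not_right h3).symm
    · exact h2.symm.of_not_right h3
  have hAex : ∀ l : I.Link, ∀ e ∈ X, e ∈ pathEdges I.tree l.1.2 →
      e ∈ A (l, true) ∨ e ∈ A (l, false) := by
    intro l e he h
    have h := ((mem_pathEdges_out l).1 h).2
    by_cases h' : Sep I.tree e r l.1.2.out.1
    · exact .inl ⟨he, h', h'.not_sep hG.connected h⟩
    · exact .inr ⟨he, (h.of_not_left (not_sep_symm h')), h'⟩
  obtain ⟨S, hS, hcost⟩ := exists_cover_le X.toFinset A (weight I.tree r)
    (by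
      intro e he i j hi hj
      by_contra hcon
      push Not at hcon
      obtain ⟨⟨f, hf, hwf, hfi, hfj⟩, ⟨g, hg, hwg, hgj, hgi⟩⟩ := hcon
      rw [Set.mem_toFinset] at hf hg
      -- Both f and g are above e, hence above the lower ends of both halves. So f can be missing
      -- from A j only if `top j` is also below f, and likewise for g and `top i`. But f and g are
      -- comparable, and either order gives a contradiction.
      have hde : ∀ {k f}, e ∈ A k → f ∈ A k → weight I.tree r e ≤ weight I.tree r f →
          ∀ q, Sep I.tree e r q → Sep I.tree f r q := fun h1 h2 h3 q hq =>
        sep_of_weight_le hG (hX h2.1) h1.2.1 h2.2.1 h3 hq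
      have hfj' : Sep I.tree f r (lo j) := hde hi hfi hwf _ hj.2.1
      have hgi' : Sep I.tree g r (lo i) := hde hj hgj hwg _ hi.2.1
      have hfj'' : Sep I.tree f r (top j) := by_contra fun h => hfj ⟨hf, hfj', h⟩
      have hgi'' : Sep I.tree g r (top i) := by_contra fun h => hgi ⟨hg, hgi', h⟩
      rcases sep_laminar hG (hX hg) hfi.2.1 hgi' with h | h
      · exact hgj.2.2 (h _ hfj'')
      · exact hfi.2.2 (h _ hgi''))
    -- Links that cover nothing in X get value 0, so that only `coverCost` is paid. Both halves of a
    -- link carry its full value, whence the factor 2.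
    (fun i => if ∃ e ∈ X, e ∈ pathEdges I.tree i.1.1.2 then x i.1 else 0)
    (fun i => by split_ifs; exacts [hx _, le_rfl])
    (by
      intro e he
      rw [Set.mem_toFinset] at he
      refine (hcov e he).trans ?_
      have hfin : (Set.toFinite {i | e ∈ A i}).toFinset = Finset.univ.filter fun i => e ∈ A i := by
        ext; simp
      rw [hfin, Finset.sum_filter, Fintype.sum_prod_type, coverage, Finset.sum_filter]
      refine Finset.sum_le_sum fun l _ => ?_
      rw [Fintype.sum_bool]
      by_cases h : e ∈ pathEdges I.tree l.1.2
      · have hex : ∃ e ∈ X, e ∈ pathEdges I.tree l.1.2 := ⟨e, he, h⟩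
        have := hx l
        simp only [hex, h, if_true]
        rcases hAex l e he h with h | h <;> simp only [h, if_true] <;> split_ifs <;> linarith
      · simp only [h, if_false]
        have := hx l
        split_ifs <;> linarith)
    (fun i => I.cost i.1.1.1) (fun i => hc _ i.1.2.1)
  have hcov' : I.Covers (S.image Prod.fst) X := by
    intro e he
    obtain ⟨i, hi, hei⟩ := hS e (Set.mem_toFinset.2 he)
    exact ⟨i.1, Finset.mem_image_of_mem _ hi, hAsub i e hei⟩
  refine (opt_le hc hcov').trans ?_
  refine (Finset.sum_image_le_of_nonneg (f := fun l : I.Link => I.cost l.1.1) (fun l _ => hc _ l.2.1)).trans (hcost.trans ?_)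
  rw [Fintype.sum_prod_type, coverCost, Finset.mul_sum, Finset.sum_filter]
  refine Finset.sum_le_sum fun l _ => ?_
  simp only [Fintype.sum_bool]
  split_ifs
  · linarith
  · simp

end Instance
end
end TreeAug

/-! ### Branches, the contracted tree, and decompositions as retractions. -/

namespace TreeAug

open SimpleGraph

/-! ### Sides and branches of a subtree -/

section Subtree

variable {N : Type*} {H : SimpleGraph N} {T : Set N} {u v r : N}

theorem mem_side {w : N} : w ∈ side H T u v ↔ w ∈ T ∧ ¬ Sep H s(u, v) u w := by
  simp [side, Sep]

theorem side_subset : side H T u v ⊆ T := fun _ h => h.1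

/-- Induction along walks inside a subtree. -/
theorem induction_of_reachable_induce {P : N → Prop} {a b : N} (ha : a ∈ T) (hb : b ∈ T)
    (hT : (H.induce T).Reachable ⟨a, ha⟩ ⟨b, hb⟩) (hP : P b)
    (hstep : ∀ a ∈ T, ∀ a' ∈ T, H.Adj a a' → P a' → P a) : P a := by
  obtain ⟨w⟩ := hT
  have : ∀ {a b : T} (w : (H.induce T).Walk a b), P b → P a := by
    intro a b w
    induction w with
    | nil => exact fun h => h
    | @cons a a' b h w ih => exact fun hb => hstep a a.2 a' a'.2 h (ih hb)
  exact this w hP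

theorem not_sep_of_reachable_induce {A : Set N} {e : Sym2 N} {a b : A}
    (h : (H.induce A).Reachable a b) (he : ∀ p ∈ A, ∀ q ∈ A, e ≠ s(p, q)) : ¬ Sep H e a b := by
  obtain ⟨w⟩ := h
  induction w with
  | nil => exact not_sep_self
  | @cons a a' b h w ih => exact not_sep_trans (not_sep_of_adj h (he a a.2 a' a'.2)) ih

theorem preconnected_side (hH : H.IsAcyclic) (hT : (H.induce T).Preconnected) (hu : u ∈ T)
    (huv : H.Adj u v) : (H.induce (side H T u v)).Preconnected := by
  have huu : u ∈ side H T u v := mem_side.2 ⟨hu, not_sep_self⟩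
  have key : ∀ w : side H T u v, (H.induce (side H T u v)).Reachable w ⟨u, huu⟩ := by
    rintro ⟨w, hw⟩
    have := induction_of_reachable_induce
      (P := fun w => ∀ hw : w ∈ side H T u v, (H.induce (side H T u v)).Reachable ⟨w, hw⟩ ⟨u, huu⟩)
      hw.1 hu (hT _ _) (fun _ => Reachable.refl _) (by
        intro a ha a' ha' hadj ih hw
        by_cases he : s(u, v) = s(a, a')
        · rcases Sym2.eq_iff.1 he with ⟨rfl, rfl⟩ | ⟨rfl, rfl⟩
          · exact Reachable.refl _
          · exact absurd (sep_of_adj hH huv) (mem_side.1 hw).2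
        · have hw' : a' ∈ side H T u v :=
            mem_side.2 ⟨ha', not_sep_trans (mem_side.1 hw).2 (not_sep_of_adj hadj he)⟩
          have h1 : (H.induce (side H T u v)).Adj ⟨a, hw⟩ ⟨a', hw'⟩ := hadj
          exact h1.reachable.trans (ih hw'))
    exact this hw
  exact fun a b => (key a).trans (key b).symm

theorem exists_adj_of_preconnected (hT : (H.induce T).Preconnected) (hr : r ∈ T) {a : N} (ha : a ∈ T)
    (har : a ≠ r) : ∃ k, ∃ hk : k ∈ T \ {r}, H.Adj k r ∧
      (H.induce (T \ {r})).Reachable ⟨a, ha, har⟩ ⟨k, hk⟩ := by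
  have := induction_of_reachable_induce
    (P := fun a => ∀ ha : a ∈ T \ {r}, ∃ k, ∃ hk : k ∈ T \ {r}, H.Adj k r ∧
      (H.induce (T \ {r})).Reachable ⟨a, ha⟩ ⟨k, hk⟩) ha hr (hT _ _)
    (fun h => absurd rfl h.2) (by
      intro a ha a' ha' hadj ih haT
      by_cases h : a' = r
      · subst h
        exact ⟨a, haT, hadj, Reachable.refl _⟩
      · obtain ⟨k, hk, hkr, hr⟩ := ih ⟨ha', h⟩
        have h1 : (H.induce (T \ {r})).Adj ⟨a, haT⟩ ⟨a', ha', h⟩ := hadj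
        exact ⟨k, hk, hkr, h1.reachable.trans hr⟩)
  exact this ⟨ha, har⟩

theorem not_mem_branch {K : Set N} (hK : K ∈ branches H T r) : r ∉ K := by
  obtain ⟨C, rfl⟩ := hK
  rintro ⟨⟨a, ha⟩, -, har⟩
  exact ha.2 har

theorem branch_subset {K : Set N} (hK : K ∈ branches H T r) : K ⊆ T := by
  obtain ⟨C, rfl⟩ := hK
  rintro _ ⟨⟨a, ha⟩, -, rfl⟩
  exact ha.1

theorem exists_mem_branches {a : N} (ha : a ∈ T) (har : a ≠ r) : ∃ K ∈ branches H T r, a ∈ K :=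
  ⟨_, ⟨(H.induce (T \ {r})).connectedComponentMk ⟨a, ha, har⟩, rfl⟩, ⟨a, ha, har⟩, rfl, rfl⟩

theorem branch_eq_of_mem {K K' : Set N} (hK : K ∈ branches H T r) (hK' : K' ∈ branches H T r)
    {a : N} (h : a ∈ K) (h' : a ∈ K') : K = K' := by
  obtain ⟨C, rfl⟩ := hK
  obtain ⟨C', rfl⟩ := hK'
  obtain ⟨b, hb, rfl⟩ := h
  obtain ⟨b', hb', he⟩ := h'
  obtain rfl := Subtype.ext he
  rw [ConnectedComponent.mem_supp_iff] at hb hb'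
  rw [← hb, ← hb']

theorem exists_adj_branch (hT : (H.induce T).Preconnected) (hr : r ∈ T) {K : Set N}
    (hK : K ∈ branches H T r) : ∃ k ∈ K, H.Adj k r := by
  obtain ⟨C, rfl⟩ := hK
  obtain ⟨⟨a, ha⟩, rfl⟩ := C.exists_rep
  obtain ⟨k, hk, hkr, h⟩ := exists_adj_of_preconnected hT hr ha.1 ha.2
  refine ⟨k, ⟨⟨k, hk⟩, ?_, rfl⟩, hkr⟩
  exact ConnectedComponent.eq.2 h.symm

/-- Moving within T - r never uses an edge at r, so a branch stays on one side of the edge kr. A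
node on the side of k whose branch hangs on another neighbour of r would be connected to r without
kr, although kr is a bridge. -/
theorem branch_eq_side (hH : H.IsAcyclic) (hT : (H.induce T).Preconnected) (hr : r ∈ T) {K : Set N}
    (hK : K ∈ branches H T r) {k : N} (hk : k ∈ K) (hkr : H.Adj k r) : K = side H T k r := by
  obtain ⟨C, rfl⟩ := hK
  obtain ⟨⟨k, hkT⟩, rfl, rfl⟩ := hk
  have hav : ∀ {a b : ↥(T \ {r})}, (H.induce (T \ {r})).Reachable a b → ∀ k',
      ¬ Sep H s(k', r) a b := fun h k' => not_sep_of_reachable_induce h (by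
    intro p hp q hq he
    rcases Sym2.eq_iff.1 he with ⟨-, rfl⟩ | ⟨-, rfl⟩
    · exact hq.2 rfl
    · exact hp.2 rfl)
  ext w
  constructor
  · rintro ⟨⟨w, hw⟩, hwC, rfl⟩
    exact mem_side.2 ⟨hw.1, not_sep_symm (hav (ConnectedComponent.eq.1 hwC) _)⟩
  · intro hw
    rw [mem_side] at hw
    have hbr := sep_of_adj hH hkr
    have hwr : w ≠ r := by
      rintro rfl
      exact hw.2 hbr
    obtain ⟨k', hk', hkr', h⟩ := exists_adj_of_preconnected hT hr hw.1 hwr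
    have hkk : k' = k := by
      by_contra hne
      refine not_sep_trans hw.2 (not_sep_trans (hav h k) (not_sep_of_adj hkr' ?_)) hbr
      intro he
      rcases Sym2.eq_iff.1 he with ⟨h, -⟩ | ⟨h, -⟩
      · exact hne h.symm
      · exact hkT.2 h
    subst hkk
    exact ⟨⟨w, hw.1, hwr⟩, ConnectedComponent.eq.2 h, rfl⟩

end Subtree

noncomputable section

open scoped Classical

namespace Instance

variable {n : ℕ} {I : Instance n} {x : I.Link → ℝ} {ε : ℝ} {p q : Fin n} {e f : Sym2 (Fin n)}

/-! ### The contracted tree -/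

theorem not_sep_of_node_eq (h : I.node x ε p = I.node x ε q) (he : e ∉ I.heavy x ε) :
    ¬ Sep I.tree e p q := by
  have := ConnectedComponent.eq.1 h
  unfold Sep
  push Not
  refine this.mono fun a b hab => ?_
  rw [fromEdgeSet_adj] at hab
  exact deleteEdges_adj.2 ⟨hab.1.1, fun h => he (h ▸ hab.1)⟩

theorem not_mem_heavy (h : I.node x ε p ≠ I.node x ε q) : s(p, q) ∉ I.heavy x ε := by
  intro h'
  refine h (ConnectedComponent.eq.2 (Adj.reachable ?_))
  rw [fromEdgeSet_adj]
  exact ⟨h', fun hpq => h (by rw [hpq])⟩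

/-- Walks in G project to the contracted tree, and walks there lift up to heavy edges. The critical
point is that no second tree edge joins the nodes of p and q, since it would bypass the bridge pq.
-/
theorem sep_contracted_iff (h : I.tree.Adj p q) (hpq : I.node x ε p ≠ I.node x ε q) {a b : Fin n} :
    Sep (I.contracted x ε) s(I.node x ε p, I.node x ε q) (I.node x ε a) (I.node x ε b) ↔
      Sep I.tree s(p, q) a b := by
  have hheavy := not_mem_heavy hpq
  constructor
  · intro hsep hr
    refine hsep ?_
    clear hsep
    obtain ⟨w⟩ := hr
    induction w with
    | nil => exact Reachable.refl _
    | @cons a a' b hadj w ih =>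
      have hadj := deleteEdges_adj.1 hadj
      refine Reachable.trans ?_ ih
      by_cases haa : I.node x ε a = I.node x ε a'
      · rw [haa]
      · refine Adj.reachable (deleteEdges_adj.2 ⟨⟨haa, a, a', rfl, rfl, hadj.1⟩, fun he => ?_⟩)
        have hsep := sep_of_adj I.isTree.isAcyclic h
        have h1 : ¬ Sep I.tree s(p, q) a a' := not_sep_of_adj hadj.1 fun h => hadj.2 h.symm
        rcases Sym2.eq_iff.1 (Set.mem_singleton_iff.1 he) with ⟨h2, h3⟩ | ⟨h2, h3⟩
        · exact not_sep_trans (not_sep_of_node_eq h2.symm hheavy)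
            (not_sep_trans h1 (not_sep_of_node_eq h3 hheavy)) hsep
        · exact not_sep_trans (not_sep_of_node_eq h3.symm hheavy)
            (not_sep_trans (not_sep_symm h1) (not_sep_of_node_eq h2 hheavy)) hsep
  · intro hsep hr
    have key : ∀ {A B : I.Node x ε} (w : ((I.contracted x ε).deleteEdges
        {s(I.node x ε p, I.node x ε q)}).Walk A B), ∀ a b, I.node x ε a = A → I.node x ε b = B →
        ¬ Sep I.tree s(p, q) a b := by
      intro A B w
      induction w with
      | nil => exact fun a b ha hb => not_sep_of_node_eq (ha.trans hb.symm) hheavy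
      | @cons A A' B hadj w ih =>
        intro a b ha hb
        obtain ⟨⟨hne, a₁, a₂, rfl, rfl, hadj'⟩, hdel⟩ := deleteEdges_adj.1 hadj
        refine not_sep_trans (not_sep_of_node_eq ha hheavy) (not_sep_trans
          (not_sep_of_adj hadj' ?_) (ih a₂ b rfl hb))
        intro he
        exact hdel (by
          have := congrArg (Sym2.map (I.node x ε)) he.symm
          simpa using this)
    obtain ⟨w⟩ := hr
    exact key w a b rfl rfl hsep

theorem isAcyclic_contracted : (I.contracted x ε).IsAcyclic := by
  rw [isAcyclic_iff_forall_adj_isBridge]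
  rintro _ _ ⟨hne, p, q, rfl, rfl, h⟩
  rw [isBridge_iff]
  exact (sep_contracted_iff h hne).2 (sep_of_adj I.isTree.isAcyclic h)

theorem connected_contracted : (I.contracted x ε).Connected := by
  have := I.isTree.nonempty
  have : Nonempty (I.Node x ε) := this.map (I.node x ε)
  refine ⟨fun A B => ?_⟩
  obtain ⟨a, rfl⟩ := I.node_surjective x ε A
  obtain ⟨b, rfl⟩ := I.node_surjective x ε B
  obtain ⟨w⟩ := I.isTree.connected.preconnected a b
  induction w with
  | nil => exact Reachable.refl _
  | @cons a a' b h w ih =>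
    refine Reachable.trans ?_ ih
    by_cases haa : I.node x ε a = I.node x ε a'
    · rw [haa]
    · exact Adj.reachable ⟨haa, a, a', rfl, rfl, h⟩

theorem mem_side_contracted {T : Set (I.Node x ε)} (h : I.tree.Adj p q)
    (hpq : I.node x ε p ≠ I.node x ε q) {a : Fin n} :
    I.node x ε a ∈ side (I.contracted x ε) T (I.node x ε p) (I.node x ε q) ↔
      I.node x ε a ∈ T ∧ ¬ Sep I.tree s(p, q) p a := by
  rw [mem_side, sep_contracted_iff h hpq]

theorem edgesOf_subset {A : Set (I.Node x ε)} : I.edgesOf x ε A ⊆ I.tree.edgeSet := by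
  rintro _ ⟨p, q, rfl, h, -⟩
  exact h

theorem not_mem_heavy_of_mem_edgesOf {A : Set (I.Node x ε)} (he : e ∈ I.edgesOf x ε A) :
    e ∉ I.heavy x ε := by
  obtain ⟨p, q, rfl, -, h, -⟩ := he
  exact not_mem_heavy h

theorem edgesOf_mono {A B : Set (I.Node x ε)} (h : A ⊆ B) : I.edgesOf x ε A ⊆ I.edgesOf x ε B := by
  rintro _ ⟨p, q, h1, h2, h3, h4, h5⟩
  exact ⟨p, q, h1, h2, h3, h h4, h h5⟩

theorem node_mem_of_mem_edgesOf {A : Set (I.Node x ε)} (he : e ∈ I.edgesOf x ε A) (hp : p ∈ e) :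
    I.node x ε p ∈ A := by
  obtain ⟨a, b, rfl, -, -, h1, h2⟩ := he
  rcases Sym2.mem_iff.1 hp with rfl | rfl
  · exact h1
  · exact h2

/-! ### Decompositions -/

/-- `(T, z)` is the image of `(univ, x)` under a retraction `φ` to the subtree `T`. -/
structure IsImage (I : Instance n) (x : I.Link → ℝ) (ε : ℝ) (T : Set (I.Node x ε))
    (z : Sym2 (Fin n) × Sym2 (I.Node x ε) → ℝ) (φ : Fin n → I.Node x ε) : Prop where
  connected : ((I.contracted x ε).induce T).Preconnected
  maps : ∀ p, φ p ∈ T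
  not_sep : ∀ e ∈ I.edgesOf x ε T, ∀ p p', I.node x ε p' = φ p → ¬ Sep I.tree e p p'
  nonneg : ∀ l, 0 ≤ z l
  eq_zero : ∀ o ∉ I.origLinks, ∀ s, z (o, s) = 0
  -- Loops are excluded: splitting drops the links with both ends on the other side, whereas φ sends
  -- them to loops.
  eq_sum : ∀ o s, ¬ s.IsDiag → z (o, s) = ∑ l with (o, s) = (l.1.1, l.1.2.map φ), x l

theorem isImage_univ (hx : ∀ l, 0 ≤ x l) :
    I.IsImage x ε Set.univ (I.contractedVec x ε) (I.node x ε) where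
  connected := by
    rintro ⟨a, -⟩ ⟨b, -⟩
    let g : I.contracted x ε →g (I.contracted x ε).induce Set.univ :=
      ⟨fun a => ⟨a, Set.mem_univ a⟩, fun h => h⟩
    exact ((connected_contracted (I := I)).preconnected a b).map g
  maps _ := Set.mem_univ _
  not_sep e he p p' h := not_sep_of_node_eq h.symm (not_mem_heavy_of_mem_edgesOf he)
  nonneg l := Finset.sum_nonneg fun l _ => hx l
  eq_zero o ho s := Finset.sum_eq_zero fun l hl => by
    simp only [Finset.mem_filter, Prod.mk.injEq] at hl
    exact absurd l.2.1 (hl.2.1 ▸ ho)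
  eq_sum o s _ := rfl

/-- The new retraction is φ followed by sending everything outside the side of u to u. This crosses
no edge e of that side: a node on the other side is connected to the edge uv there without e, and uv
itself is not e. -/
theorem IsImage.side {T : Set (I.Node x ε)} {z : Sym2 (Fin n) × Sym2 (I.Node x ε) → ℝ}
    {φ : Fin n → I.Node x ε} (h : I.IsImage x ε T z φ) {u v : I.Node x ε} (hu : u ∈ T)
    (huv : (I.contracted x ε).Adj u v) :
    I.IsImage x ε (side (I.contracted x ε) T u v) (splitAt (I.contracted x ε) T z u v)
      fun p => if φ p ∈ side (I.contracted x ε) T u v then φ p else u where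
  connected := preconnected_side isAcyclic_contracted h.connected hu huv
  maps p := by
    split_ifs with hp
    · exact hp
    · exact mem_side.2 ⟨hu, not_sep_self⟩
  not_sep := by
    intro e he p p' hp'
    have heT := edgesOf_mono side_subset he
    split_ifs at hp' with hp
    · exact h.not_sep e heT p p' hp'
    · obtain ⟨hne, a, b, rfl, rfl, hab⟩ := huv
      obtain ⟨q, hq⟩ := I.node_surjective x ε (φ p)
      refine not_sep_trans (h.not_sep e heT p q hq) ?_
      rw [← hq] at hp
      have hqT : I.node x ε q ∈ T := hq ▸ h.maps p
      have hq' : Sep I.tree s(a, b) a q := by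
        by_contra hcon
        exact hp ((mem_side_contracted hab hne).2 ⟨hqT, hcon⟩)
      have hside : ∀ c ∈ e, ¬ Sep I.tree s(a, b) a c := fun c hc =>
        ((mem_side_contracted hab hne).1 (node_mem_of_mem_edgesOf he hc)).2
      obtain ⟨c, d, hcd, -⟩ := id he
      have hce : c ∈ e := by simp [hcd]
      have hbr := sep_of_adj I.isTree.isAcyclic hab
      have hqb : ¬ Sep I.tree s(a, b) q b := hq'.symm.not_sep I.isTree.connected hbr
      refine not_sep_trans (not_sep_of_end hqb hce
        (hq'.symm.of_not_right (hside c hce))) (not_sep_trans (not_sep_symm (not_sep_of_adj hab ?_)) ?_)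
      · rintro rfl
        exact hside b (by simp) hbr
      · exact not_sep_of_node_eq hp'.symm (not_mem_heavy_of_mem_edgesOf heT)
  nonneg l := Finset.sum_nonneg fun l _ => h.nonneg l
  eq_zero o ho s := Finset.sum_eq_zero fun l hl => by
    simp only [Finset.mem_filter, Prod.mk.injEq] at hl
    exact h.eq_zero l.1 (hl.2.2.1 ▸ ho) l.2
  eq_sum := by
    intro o s hs
    set g : I.Node x ε → I.Node x ε :=
      fun a => if a ∈ TreeAug.side (I.contracted x ε) T u v then a else u with hg
    have h1 : splitAt (I.contracted x ε) T z u v (o, s) =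
        ∑ l' ∈ Finset.univ.filter (fun l' : Sym2 (Fin n) × Sym2 (I.Node x ε) =>
          (o, s) = (l'.1, l'.2.map g)),
          ∑ l : I.Link with (l.1.1, l.1.2.map φ) = l', x l := by
      unfold splitAt
      refine Finset.sum_congr ?_ ?_
      · ext ⟨o', s'⟩
        simp only [Finset.mem_filter, Finset.mem_univ, true_and, hg]
        -- With no end in the side the image would be a loop, so the condition on the ends is
        -- automatic.
        refine and_iff_right_of_imp fun heq => ?_
        by_contra hcon
        push Not at hcon
        obtain ⟨rfl, rfl⟩ := Prod.mk.inj heq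
        refine hs ?_
        induction s' with | _ a b
        simp [hcon a (by simp), hcon b (by simp)]
      · rintro ⟨o', s'⟩ hl
        simp only [Finset.mem_filter, Finset.mem_univ, true_and] at hl
        have hs' : ¬ s'.IsDiag := by
          intro hd
          obtain ⟨rfl, rfl⟩ := Prod.mk.inj hl
          refine hs ?_
          induction s' with | _ a b
          simp only [Sym2.mk_isDiag_iff] at hd
          simp [hd]
        rw [h.eq_sum o' s' hs']
        refine Finset.sum_congr ?_ fun _ _ => rfl
        ext l
        simp [eq_comm]
    rw [h1, ← Finset.sum_fiberwise_of_maps_to (s := Finset.univ.filter fun l : I.Link =>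
      (o, s) = (l.1.1, l.1.2.map fun p => g (φ p)))
      (t := Finset.univ.filter fun l' : Sym2 (Fin n) × Sym2 (I.Node x ε) =>
          (o, s) = (l'.1, l'.2.map g)) (g := fun l => (l.1.1, l.1.2.map φ))]
    · refine Finset.sum_congr rfl fun l' hl' => Finset.sum_congr ?_ fun _ _ => rfl
      ext l
      simp only [Finset.mem_filter, Finset.mem_univ, true_and] at hl' ⊢
      constructor
      · rintro rfl
        refine ⟨?_, rfl⟩
        rw [hl', Sym2.map_map]
        rfl
      · exact fun h => h.2
    · intro l hl
      simp only [Finset.mem_filter, Finset.mem_univ, true_and] at hl ⊢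
      rw [hl, Sym2.map_map]
      rfl

theorem exists_isImage {M : ℕ} (hx : ∀ l, 0 ≤ x l) {T : Set (I.Node x ε)}
    {z : Sym2 (Fin n) × Sym2 (I.Node x ε) → ℝ} (h : I.IsPart M ε x T z) :
    ∃ φ, I.IsImage x ε T z φ := by
  obtain ⟨D, hD, hTz⟩ := h
  have key : ∀ (P : Set (I.Node x ε) × (Sym2 (Fin n) × Sym2 (I.Node x ε) → ℝ)) D,
      IsDecomposition (I.contracted x ε) I.cost (4 * M / ε ^ 2) P D →
      (∃ φ, I.IsImage x ε P.1 P.2 φ) → ∀ P' ∈ D, ∃ φ, I.IsImage x ε P'.1 P'.2 φ := by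
    intro P D hD
    induction hD with
    | done T z h => simp
    | split T z u v h D D' _ _ ih ih' =>
      rintro ⟨φ, hφ⟩ P' hP'
      rcases List.mem_append.1 hP' with hP' | hP'
      · exact ih ⟨_, hφ.side h.1 h.2.2.1⟩ P' hP'
      · exact ih' ⟨_, hφ.side h.2.1 h.2.2.1.symm⟩ P' hP'
  exact key _ _ hD ⟨_, isImage_univ hx⟩ _ hTz

end Instance
end
end TreeAug

/-! ### Costs of the links that meet a branch. -/

namespace TreeAug

open SimpleGraph

noncomputable section

open scoped Classical

/-- Variant of `eq_of_sep_of_mem` for two lower ends that need not be the same original node, such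
as two representatives of one contracted node. If e and f were different, the upper end of the edge
with the larger far side would be beyond the other edge and hence beyond its own edge. -/
theorem eq_of_sep {V : Type*} {G : SimpleGraph V} (hG : G.IsTree) {e f : Sym2 V} {a a' r : V}
    (he : e ∈ G.edgeSet) (hf : f ∈ G.edgeSet) (hae : a ∈ e) (haf : a' ∈ f) (h₁ : Sep G e r a)
    (h₂ : Sep G e r a') (h₃ : Sep G f r a) (h₄ : Sep G f r a') : e = f := by
  by_contra hne
  obtain ⟨p, q, rfl, hp, hq⟩ := sep_or_of_mem hG he r
  obtain ⟨p', q', rfl, hp', hq'⟩ := sep_or_of_mem hG hf r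
  rcases sep_laminar hG hf h₁ h₃ with h | h
  · exact hq' (h q' (h₂.of_not_right (not_sep_of_mem hf hne haf (by simp))))
  · exact hq (h q (h₃.of_not_right (not_sep_of_mem he (Ne.symm hne) hae (by simp))))

/-! ### Costs of split vectors -/

section Fractional

variable {O N : Type*} {H : SimpleGraph N} {T : Set N} {r : N}
  {c : O → ℝ} {z : O × Sym2 N → ℝ}

theorem not_isCross_of_subset {K : Set N} (hK : K ∈ branches H T r) {s : Sym2 N}
    (hs : ∀ a ∈ s, a ∈ K) : ¬ IsCross H T r s := by
  rintro ⟨K₁, h₁, K₂, h₂, hne, a, ha, b, hb, rfl⟩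
  exact hne ((branch_eq_of_mem h₁ hK ha (hs a (by simp))).trans
    (branch_eq_of_mem hK h₂ (hs b (by simp)) hb))

theorem not_isCross_of_mem {s : Sym2 N} (hs : r ∈ s) : ¬ IsCross H T r s := by
  rintro ⟨K₁, h₁, K₂, h₂, hne, a, ha, b, hb, rfl⟩
  rcases Sym2.mem_iff.1 hs with rfl | rfl
  · exact not_mem_branch h₁ ha
  · exact not_mem_branch h₂ hb

theorem sum_le_sum_of_support {ι : Type*} {s t : Finset ι} {z : ι → ℝ} (hz : ∀ l, 0 ≤ z l)
    (h : ∀ l ∈ s, z l ≠ 0 → l ∈ t) : ∑ l ∈ s, z l ≤ ∑ l ∈ t, z l := by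
  rw [← Finset.sum_filter_ne_zero]
  refine Finset.sum_le_sum_of_subset_of_nonneg (fun l hl => ?_) fun l _ _ => hz l
  exact h l (Finset.mem_filter.1 hl).1 (Finset.mem_filter.1 hl).2

variable [Fintype O] [Fintype N]

theorem rootSplit_nonneg (hz : ∀ l, 0 ≤ z l) (l : O × Sym2 N) : 0 ≤ rootSplit H T r z l := by
  have hs := Finset.sum_nonneg (s := Finset.univ.filter fun l' : O × Sym2 N =>
    l'.1 = l.1 ∧ IsCross H T r l'.2 ∧ ∃ q ∈ l.2, q ≠ r ∧ q ∈ l'.2) (f := z) fun l _ => hz l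
  unfold rootSplit inPart crossPart
  split_ifs
  all_goals first
    | exact add_nonneg (hz l) hs
    | simp [hz l]

/-- The total cost in `z` of the links, other than self-loops, with an end in `K`. -/
def costMeeting (c : O → ℝ) (z : O × Sym2 N → ℝ) (K : Set N) : ℝ :=
  ∑ l with ¬ l.2.IsDiag ∧ ∃ a ∈ l.2, a ∈ K, c l.1 * z l

/-- Send all nodes outside K to r. A link inside K is kept; one with a single end a in K becomes ar,
where y has collected it, either as the link ar itself or as the shadow of a cross-link. So ȳ
dominates the push-forward of z. The alternative in `hc` is needed because costs are arbitrary on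
labels that are not original links; there z vanishes. -/
theorem costMeeting_le_totalCost (hz : ∀ l, 0 ≤ z l)
    (hc : ∀ o, 0 ≤ c o ∨ ∀ s, z (o, s) = 0)
    (hzT : ∀ l, ¬ l.2.IsDiag → z l ≠ 0 → ∀ a ∈ l.2, a ∈ T) {K : Set N} (hK : K ∈ branches H T r) :
    costMeeting c z K ≤ totalCost c (restrictTo (insert r K) (rootSplit H T r z)) := by
  set A : Finset (O × Sym2 N) := Finset.univ.filter fun l => ¬ l.2.IsDiag ∧ ∃ a ∈ l.2, a ∈ K with hA
  set g : O × Sym2 N → O × Sym2 N := fun l => (l.1, l.2.map fun a => if a ∈ K then a else r) with hg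
  have hrK := not_mem_branch hK
  have key : ∀ l', ∑ l ∈ A with g l = l', z l ≤ restrictTo (insert r K) (rootSplit H T r z) l' := by
    rintro ⟨o, s⟩
    by_cases hF : ∃ l ∈ A, g l = (o, s)
    swap
    · rw [Finset.sum_eq_zero fun l hl => absurd ⟨l, Finset.mem_filter.1 hl⟩ hF]
      unfold restrictTo
      split_ifs
      · exact rootSplit_nonneg hz _
      · exact le_rfl
    obtain ⟨⟨o₀, s₀⟩, hl₀, hgl₀⟩ := hF
    have hin : ∀ a ∈ s, a ∈ insert r K := by
      obtain ⟨rfl, rfl⟩ := Prod.mk.inj hgl₀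
      intro a ha
      obtain ⟨b, -, rfl⟩ := Sym2.mem_map.1 ha
      split_ifs with h
      · exact .inr h
      · exact .inl rfl
    rw [restrictTo, if_pos hin]
    by_cases hrs : r ∈ s
    · have hex : ∃ a ∈ K, s = s(a, r) := by
        obtain ⟨rfl, rfl⟩ := Prod.mk.inj hgl₀
        obtain ⟨-, a, ha, haK⟩ := (Finset.mem_filter.1 hl₀).2
        obtain ⟨b, hb⟩ := Sym2.mem_iff_exists.1 ha
        change s₀ = s(a, b) at hb
        subst hb
        refine ⟨a, haK, ?_⟩
        rw [Sym2.map_mk]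
        simp only [Sym2.map_mk, haK, if_true, Sym2.mem_iff] at hrs
        rcases hrs with rfl | hrs
        · exact absurd haK hrK
        · simp [haK, ← hrs]
      obtain ⟨a, haK, rfl⟩ := hex
      have har : a ≠ r := fun h => hrK (h ▸ haK)
      have hnd : ¬ (s(a, r)).IsDiag := by simpa using har
      rw [rootSplit, if_neg (by simp), if_neg hnd]
      refine le_trans ?_ (le_of_eq (Finset.sum_insert (f := z) (a := (o, s(a, r)))
        (s := Finset.univ.filter fun l' : O × Sym2 N =>
          l'.1 = o ∧ IsCross H T r l'.2 ∧ ∃ q ∈ s(a, r), q ≠ r ∧ q ∈ l'.2) fun h =>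
          not_isCross_of_mem (by simp) (Finset.mem_filter.1 h).2.2.1))
      refine sum_le_sum_of_support hz fun l hl hz0 => ?_
      obtain ⟨hlA, hgl⟩ := Finset.mem_filter.1 hl
      obtain ⟨o', s'⟩ := l
      obtain ⟨hnd', b, hb, hbK⟩ := (Finset.mem_filter.1 hlA).2
      obtain ⟨rfl, hs'⟩ := Prod.mk.inj hgl
      obtain ⟨d, hd⟩ := Sym2.mem_iff_exists.1 hb
      change s' = s(b, d) at hd
      subst hd
      have hbr : b ≠ r := fun h => hrK (h ▸ hbK)
      simp only [Sym2.map_mk, hbK, if_true] at hs'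
      have hdK : d ∉ K ∧ b = a := by
        rcases Sym2.eq_iff.1 hs' with ⟨h1, h2⟩ | ⟨h1, h2⟩
        · refine ⟨fun h => ?_, h1⟩
          rw [if_pos h] at h2
          exact hrK (h2 ▸ h)
        · exact absurd h1 hbr
      obtain ⟨hdK, rfl⟩ := hdK
      by_cases hdr : d = r
      · subst hdr
        simp
      · refine Finset.mem_insert_of_mem (Finset.mem_filter.2 ⟨Finset.mem_univ _, rfl, ?_,
          b, by simp, hbr, by simp⟩)
        obtain ⟨K', hK', hdK'⟩ := exists_mem_branches (H := H)
          (hzT _ hnd' hz0 d (by simp)) hdr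
        exact ⟨K, hK, K', hK', fun h => hdK (h ▸ hdK'), b, hbK, d, hdK', rfl⟩
    · have hsub : ∀ a ∈ s, a ∈ K := fun a ha => (hin a ha).resolve_left fun h => hrs (h ▸ ha)
      rw [rootSplit, if_pos hrs, inPart, crossPart, if_neg (not_isCross_of_subset hK hsub), sub_zero]
      rw [← Finset.sum_singleton z (o, s)]
      refine sum_le_sum_of_support hz fun l hl _ => ?_
      obtain ⟨hlA, hgl⟩ := Finset.mem_filter.1 hl
      obtain ⟨o', s'⟩ := l
      obtain ⟨rfl, rfl⟩ := Prod.mk.inj hgl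
      induction s' with | _ b d
      have hbK : b ∈ K := by
        by_contra h
        exact hrs (by simp [h])
      have hdK : d ∈ K := by
        by_contra h
        exact hrs (by simp [h])
      simp [hbK, hdK]
  rw [costMeeting, totalCost, ← hA, ← Finset.sum_fiberwise_of_maps_to (s := A) (t := Finset.univ)
    (g := g) fun _ _ => Finset.mem_univ _]
  refine Finset.sum_le_sum fun l' _ => ?_
  have h1 : ∑ l ∈ A with g l = l', c l.1 * z l = c l'.1 * ∑ l ∈ A with g l = l', z l := by
    rw [Finset.mul_sum]
    refine Finset.sum_congr rfl fun l hl => ?_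
    rw [← (Finset.mem_filter.1 hl).2]
  rw [h1]
  rcases hc l'.1 with h | h
  · exact mul_le_mul_of_nonneg_left (key l') h
  · have h0 : ∑ l ∈ A with g l = l', z l = 0 := by
      refine Finset.sum_eq_zero fun l hl => ?_
      have := (Finset.mem_filter.1 hl).2
      rw [← this] at h
      exact h l.2
    have h2 : restrictTo (insert r K) (rootSplit H T r z) l' = 0 := by
      unfold restrictTo rootSplit inPart crossPart
      have hl' : z l' = 0 := h l'.2
      have hs : ∑ l with l.1 = l'.1 ∧ IsCross H T r l.2 ∧ ∃ q ∈ l'.2, q ≠ r ∧ q ∈ l.2, z l = 0 :=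
        Finset.sum_eq_zero fun l hl => by
          have := (Finset.mem_filter.1 hl).2.1
          rw [← this] at h
          exact h l.2
      split_ifs <;> simp [hl', hs]
    rw [h0, h2]

/-- Exchange the sums: the branches are disjoint, so a link with two ends meets at most two of them,
and at most one unless it is a cross-link. -/
theorem sum_costMeeting_le (hz : ∀ l, 0 ≤ z l) (hc : ∀ o, 0 ≤ c o ∨ ∀ s, z (o, s) = 0) :
    ∑ K ∈ (branches H T r).toFinset, costMeeting c z K ≤
      totalCost c (inPart H T r z) + 2 * totalCost c (crossPart H T r z) := by
  have hcz : ∀ l : O × Sym2 N, 0 ≤ c l.1 * z l := fun l => by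
    rcases hc l.1 with h | h
    · exact mul_nonneg h (hz l)
    · rw [show z l = 0 from h l.2, mul_zero]
  simp only [costMeeting, totalCost, Finset.sum_filter]
  rw [Finset.sum_comm, Finset.mul_sum, ← Finset.sum_add_distrib]
  refine Finset.sum_le_sum fun l _ => ?_
  rw [← Finset.sum_filter, Finset.sum_const, nsmul_eq_mul]
  set B := (branches H T r).toFinset.filter fun K => ¬ l.2.IsDiag ∧ ∃ a ∈ l.2, a ∈ K with hB
  have hmem : ∀ K ∈ B, K ∈ branches H T r ∧ ∃ a ∈ l.2, a ∈ K := fun K hK => by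
    simp only [hB, Finset.mem_filter, Set.mem_toFinset] at hK
    exact ⟨hK.1, hK.2.2⟩
  obtain ⟨o, s⟩ := l
  simp only at hmem
  have h2 : B.card ≤ 2 := by
    induction s with | _ a b
    by_contra hcon
    push Not at hcon
    obtain ⟨K₁, K₂, K₃, h1, h2, h3, h12, h13, h23⟩ := Finset.two_lt_card_iff.1 hcon
    obtain ⟨hK₁, a₁, ha₁, hm₁⟩ := hmem K₁ h1
    obtain ⟨hK₂, a₂, ha₂, hm₂⟩ := hmem K₂ h2
    obtain ⟨hK₃, a₃, ha₃, hm₃⟩ := hmem K₃ h3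
    have key : a₁ = a₂ ∨ a₁ = a₃ ∨ a₂ = a₃ := by
      rcases Sym2.mem_iff.1 ha₁ with rfl | rfl <;> rcases Sym2.mem_iff.1 ha₂ with rfl | rfl <;>
        rcases Sym2.mem_iff.1 ha₃ with rfl | rfl <;> simp
    rcases key with rfl | rfl | rfl
    · exact h12 (branch_eq_of_mem hK₁ hK₂ hm₁ hm₂)
    · exact h13 (branch_eq_of_mem hK₁ hK₃ hm₁ hm₃)
    · exact h23 (branch_eq_of_mem hK₂ hK₃ hm₂ hm₃)
  have h1 : ¬ IsCross H T r s → B.card ≤ 1 := by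
    intro hcr
    refine Finset.card_le_one.2 fun K₁ h1 K₂ h2 => ?_
    by_contra hne
    obtain ⟨hK₁, a₁, ha₁, hm₁⟩ := hmem K₁ h1
    obtain ⟨hK₂, a₂, ha₂, hm₂⟩ := hmem K₂ h2
    have : a₁ ≠ a₂ := by
      rintro rfl
      exact hne (branch_eq_of_mem hK₁ hK₂ hm₁ hm₂)
    exact hcr ⟨K₁, hK₁, K₂, hK₂, hne, a₁, hm₁, a₂, hm₂, (Sym2.mem_and_mem_iff this).1 ⟨ha₁, ha₂⟩⟩
  have h0 := hcz (o, s)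
  unfold inPart crossPart
  by_cases hcr : IsCross H T r s
  · have : (B.card : ℝ) ≤ 2 := by exact_mod_cast h2
    simp only [hcr, if_true]
    nlinarith
  · have : (B.card : ℝ) ≤ 1 := by exact_mod_cast h1 hcr
    simp only [hcr, if_false]
    nlinarith

end Fractional
end
end TreeAug

/-! ### The branch at a center: a bundle, or rich in compound nodes. -/

namespace TreeAug

open SimpleGraph

noncomputable section

open scoped Classical

namespace Instance

variable {n : ℕ} {I : Instance n} {x : I.Link → ℝ} {ε : ℝ} {T K : Set (I.Node x ε)}
  {z : Sym2 (Fin n) × Sym2 (I.Node x ε) → ℝ} {φ : Fin n → I.Node x ε} {r : I.Node x ε}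
  {a b ρ : Fin n}

/-- `s(a, b)` is the edge of the original tree that connects the branch `K` at `r` with `r`. -/
structure IsRootEdge (I : Instance n) (x : I.Link → ℝ) (ε : ℝ) (T : Set (I.Node x ε))
    (r : I.Node x ε) (K : Set (I.Node x ε)) (a b : Fin n) : Prop where
  connected : ((I.contracted x ε).induce T).Preconnected
  root_mem : r ∈ T
  branch : K ∈ branches (I.contracted x ε) T r
  adj : I.tree.Adj a b
  node_mem : I.node x ε a ∈ K
  node_eq : I.node x ε b = r

theorem exists_isRootEdge (hT : ((I.contracted x ε).induce T).Preconnected) (hr : r ∈ T)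
    (hK : K ∈ branches (I.contracted x ε) T r) : ∃ a b, I.IsRootEdge x ε T r K a b := by
  obtain ⟨k, hk, -, a, b, rfl, hb, hab⟩ := exists_adj_branch hT hr hK
  exact ⟨a, b, hT, hr, hK, hab, hk, hb⟩

/-- The lower ends of the edges of the branch are in the branch. -/
theorem node_mem_of_sep (hρ : I.node x ε ρ = r) {e : Sym2 (Fin n)} (he : e ∈ I.edgesOf x ε (insert r K)) {p : Fin n}
    (hp : p ∈ e) (hs : Sep I.tree e ρ p) : I.node x ε p ∈ K := by
  refine (node_mem_of_mem_edgesOf he hp).resolve_left fun heq => ?_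
  exact not_sep_of_node_eq (hρ.trans heq.symm) (not_mem_heavy_of_mem_edgesOf he) hs

namespace IsRootEdge

variable (h : I.IsRootEdge x ε T r K a b) (hρ : I.node x ε ρ = r)
include h

theorem node_ne : I.node x ε a ≠ I.node x ε b := by
  intro heq
  exact not_mem_branch h.branch (h.node_eq ▸ heq ▸ h.node_mem)

theorem subset : insert r K ⊆ T := Set.insert_subset h.root_mem (branch_subset h.branch)

theorem mem_edgesOf : s(a, b) ∈ I.edgesOf x ε (insert r K) :=
  ⟨a, b, rfl, h.adj, h.node_ne, .inr h.node_mem, .inl h.node_eq⟩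

include hρ

/-- The nodes ρ and b may be different original nodes contracted into r. Heavy edges join them, so
ab does not separate them. -/
theorem sep_root {p : Fin n} : Sep I.tree s(a, b) ρ p ↔ ¬ Sep I.tree s(a, b) a p := by
  have h1 : ¬ Sep I.tree s(a, b) ρ b :=
    not_sep_of_node_eq (hρ.trans h.node_eq.symm) (not_mem_heavy h.node_ne)
  have h2 := sep_of_adj I.isTree.isAcyclic h.adj
  have h3 : Sep I.tree s(a, b) ρ a := h2.symm.of_not_left (not_sep_symm h1)
  exact ⟨fun hp => h3.symm.not_sep I.isTree.connected hp, fun hp => h3.of_not_right hp⟩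

theorem mem_iff {p : Fin n} :
    I.node x ε p ∈ K ↔ I.node x ε p ∈ T ∧ Sep I.tree s(a, b) ρ p := by
  rw [h.sep_root hρ, ← mem_side_contracted h.adj h.node_ne, h.node_eq]
  rw [← branch_eq_side isAcyclic_contracted h.connected h.root_mem h.branch h.node_mem]
  exact ⟨h.node_eq ▸ h.node_ne, a, b, rfl, h.node_eq, h.adj⟩

/-- This is the form in which the algorithm finds E[R̄]: the edges of T that are ab or beyond it. -/
theorem mem_edgesOf_iff {e : Sym2 (Fin n)} : e ∈ I.edgesOf x ε (insert r K) ↔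
    e ∈ I.edgesOf x ε T ∧ ∃ p ∈ e, Sep I.tree s(a, b) ρ p := by
  constructor
  · intro he
    refine ⟨edgesOf_mono h.subset he, ?_⟩
    obtain ⟨p, q, rfl, -, hne, hp, hq⟩ := he
    rcases hp with hp | hp
    · rcases hq with hq | hq
      · exact absurd (hp.trans hq.symm) hne
      · exact ⟨q, by simp, ((h.mem_iff hρ).1 hq).2⟩
    · exact ⟨p, by simp, ((h.mem_iff hρ).1 hp).2⟩
  · rintro ⟨he, p, hp, hs⟩
    by_cases hab : s(a, b) = e
    · exact hab ▸ h.mem_edgesOf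
    · obtain ⟨q, q', rfl, hadj, hne, hq, hq'⟩ := he
      have key : ∀ c ∈ s(q, q'), Sep I.tree s(a, b) ρ c := fun c hc =>
        hs.of_not_right (not_sep_of_mem hadj hab hp hc)
      exact ⟨q, q', rfl, hadj, hne, .inr ((h.mem_iff hρ).2 ⟨hq, key q (by simp)⟩),
        .inr ((h.mem_iff hρ).2 ⟨hq', key q' (by simp)⟩)⟩

/-- An edge such that no other edge enters its lower end from below has its lower end in a leaf. -/
theorem leaf_of_forall {e : Sym2 (Fin n)} (he : e ∈ I.edgesOf x ε (insert r K)) {p : Fin n}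
    (hp : p ∈ e) (hs : Sep I.tree e ρ p)
    (hall : ∀ p' q', I.node x ε p' = I.node x ε p → s(p', q') ∈ I.edgesOf x ε (insert r K) →
      s(p', q') = e) (hpa : I.node x ε p ≠ I.node x ε a) :
    I.node x ε p ∈ {v | v ∈ K ∧ ((I.contracted x ε).neighborSet v ∩ K).ncard = 1} := by
  have hpK := node_mem_of_sep hρ he hp hs
  obtain ⟨q, rfl⟩ := Sym2.mem_iff_exists.1 hp
  have hadj : I.tree.Adj p q := edgesOf_subset he
  have hqK : I.node x ε q ∈ K := by
    refine (node_mem_of_mem_edgesOf he (Sym2.mem_mk_right p q)).resolve_left fun heq => ?_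
    have h1 : ¬ Sep I.tree s(a, b) ρ q :=
      not_sep_of_node_eq (hρ.trans heq.symm) (not_mem_heavy h.node_ne)
    have h2 := ((h.mem_iff hρ).1 hpK).2
    have h3 : s(a, b) = s(p, q) := by
      by_contra hne
      exact not_sep_trans h1 (not_sep_symm (not_sep_of_adj hadj hne)) h2
    rcases Sym2.eq_iff.1 h3 with ⟨rfl, rfl⟩ | ⟨rfl, rfl⟩
    · exact hpa rfl
    · exact (h.sep_root hρ).1 h2 (sep_of_adj I.isTree.isAcyclic h.adj)
  have hne : I.node x ε p ≠ I.node x ε q := by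
    intro heq
    have := not_mem_heavy_of_mem_edgesOf he
    exact not_sep_of_node_eq heq this (sep_of_adj I.isTree.isAcyclic hadj)
  refine ⟨hpK, Set.ncard_eq_one.2 ⟨I.node x ε q, Set.eq_singleton_iff_unique_mem.2
    ⟨⟨⟨hne, p, q, rfl, rfl, hadj⟩, hqK⟩, ?_⟩⟩⟩
  rintro w ⟨⟨hne', p', q', hp', rfl, hadj'⟩, hwK⟩
  have := hall p' q' hp' ⟨p', q', rfl, hadj', by rwa [hp'], hp' ▸ .inr hpK, .inr hwK⟩
  rcases Sym2.eq_iff.1 this with ⟨-, rfl⟩ | ⟨-, rfl⟩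
  · rfl
  · exact absurd rfl hne'

/-- A set of edges of the branch, all of whose lower ends are in leaves, in `A`, or in the topmost
node. -/
theorem ncard_le_of_forall {S : Set (Sym2 (Fin n))} (hS : S ⊆ I.edgesOf x ε (insert r K))
    (A : Set (I.Node x ε))
    (hall : ∀ e ∈ S, ∀ p ∈ e, Sep I.tree e ρ p → I.node x ε p ∉ A →
      ∀ p' q', I.node x ε p' = I.node x ε p → s(p', q') ∈ I.edgesOf x ε (insert r K) →
      s(p', q') = e) :
    S.ncard ≤ leafCount (I.contracted x ε) K + A.ncard + 1 := by
  have hlow : ∀ e : Sym2 (Fin n), ∃ p, e ∈ S → p ∈ e ∧ Sep I.tree e ρ p := by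
    intro e
    by_cases he : e ∈ S
    · obtain ⟨p, q, heq, hp, -⟩ := sep_or_of_mem I.isTree (edgesOf_subset (hS he)) ρ
      exact ⟨p, fun _ => ⟨by simp [heq], hp⟩⟩
    · exact ⟨ρ, fun h => absurd h he⟩
  choose lo hlo using hlow
  -- Different edges have their lower ends in different contracted nodes, so edges can be counted by
  -- nodes.
  have hinj : Set.InjOn (fun e => I.node x ε (lo e)) S := by
    intro e he f hf heq
    have h1 := not_mem_heavy_of_mem_edgesOf (hS he)
    have h2 := not_mem_heavy_of_mem_edgesOf (hS hf)
    exact eq_of_sep I.isTree (edgesOf_subset (hS he)) (edgesOf_subset (hS hf)) (hlo e he).1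
      (hlo f hf).1 (hlo e he).2 ((hlo e he).2.of_not_right (not_sep_of_node_eq heq h1))
      ((hlo f hf).2.of_not_right (not_sep_of_node_eq heq.symm h2)) (hlo f hf).2
  rw [← hinj.ncard_image]
  -- The topmost node of K accounts for the summand 1: its upward edge leads to r, out of K, so it
  -- need not be a leaf of K.
  refine (Set.ncard_le_ncard (t := insert (I.node x ε a)
    ({v | v ∈ K ∧ ((I.contracted x ε).neighborSet v ∩ K).ncard = 1} ∪ A)) ?_
    (Set.toFinite _)).trans ((Set.ncard_insert_le _ _).trans
      (Nat.add_le_add_right (Set.ncard_union_le _ _) 1))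
  rintro _ ⟨e, he, rfl⟩
  by_cases h1 : I.node x ε (lo e) = I.node x ε a
  · exact .inl h1
  by_cases h2 : I.node x ε (lo e) ∈ A
  · exact .inr (.inr h2)
  exact .inr (.inl (h.leaf_of_forall hρ (hS he) (hlo e he).1 (hlo e he).2
    (hall e he _ (hlo e he).1 (hlo e he).2 h2) h1))

/-- The number of lowest edges of a branch. -/
theorem ncard_lowest_le : {e | e ∈ I.edgesOf x ε (insert r K) ∧
    ∀ f ∈ I.edgesOf x ε (insert r K), (∃ p ∈ f, Sep I.tree e ρ p) → f = e}.ncard ≤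
      leafCount (I.contracted x ε) K + 1 := by
  have := h.ncard_le_of_forall hρ (S := {e | e ∈ I.edgesOf x ε (insert r K) ∧
    ∀ f ∈ I.edgesOf x ε (insert r K), (∃ p ∈ f, Sep I.tree e ρ p) → f = e}) (fun e he => he.1) ∅ (by
      rintro e he p hp hs - p' q' hpp hf
      refine he.2 _ hf ⟨p', by simp, hs.of_not_right ?_⟩
      exact not_sep_of_node_eq hpp.symm (not_mem_heavy_of_mem_edgesOf he.1))
  simpa using this

/-- At the lower end of a start there is no other edge of R̄, but only as an original node. If that
node is not compound, this makes it a leaf of K (or its topmost node). At compound nodes ascending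
paths may break, so these are counted separately. -/
theorem isBundle_or {γ : ℕ} : I.IsBundle γ (I.edgesOf x ε (insert r K)) ∨
    γ < leafCount (I.contracted x ε) K +
      {v | v ∈ K ∧ ∃ p p', p ≠ p' ∧ I.node x ε p = v ∧ I.node x ε p' = v}.ncard + 1 := by
  by_cases hγ : {e | IsStart I.tree ρ (I.edgesOf x ε (insert r K)) e}.ncard ≤ γ
  · exact .inl (isBundle_of_ncard_le ρ edgesOf_subset hγ)
  · refine .inr (lt_of_lt_of_le (not_le.1 hγ) ?_)
    refine h.ncard_le_of_forall hρ (fun e he => he.1) _ ?_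
    intro e he p hp hs hA p' q' hpp hf
    have : p' = p := by
      by_contra hne
      exact hA ⟨node_mem_of_sep hρ he.1 hp hs, p', p, hne, hpp, rfl⟩
    subst this
    exact he.2 p' hp hs _ hf (by simp)

end IsRootEdge

theorem charge_nonneg (hc : ∀ o ∈ I.origLinks, 0 ≤ I.cost o) (L₀ : Finset I.Link)
    (u : I.Node x ε) : 0 ≤ I.charge x ε L₀ u := Finset.sum_nonneg fun l _ => hc _ l.2.1

theorem chargeOn_mono (hc : ∀ o ∈ I.origLinks, 0 ≤ I.cost o) (L₀ : Finset I.Link)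
    {A B : Set (I.Node x ε)} (h : A ⊆ B) : I.chargeOn x ε L₀ A ≤ I.chargeOn x ε L₀ B :=
  Finset.sum_le_sum_of_subset_of_nonneg
    (fun u hu => by simp only [Finset.mem_filter] at hu ⊢; exact ⟨hu.1, h hu.2⟩)
    fun u _ _ => charge_nonneg hc L₀ u

theorem chargeOn_nonneg (hc : ∀ o ∈ I.origLinks, 0 ≤ I.cost o) (L₀ : Finset I.Link)
    (A : Set (I.Node x ε)) : 0 ≤ I.chargeOn x ε L₀ A :=
  Finset.sum_nonneg fun u _ => charge_nonneg hc L₀ u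

/-- Every compound node is charged for a link. -/
theorem one_le_charge (hc : ∀ o ∈ I.origLinks, 1 ≤ I.cost o) {L₀ : Finset I.Link}
    (hL₀ : I.Covers L₀ (I.heavy x ε)) {p p' : Fin n} (hne : p ≠ p')
    (h : I.node x ε p' = I.node x ε p) : 1 ≤ I.charge x ε L₀ (I.node x ε p) := by
  obtain ⟨w⟩ := ConnectedComponent.eq.1 h.symm
  cases w with
  | nil => exact absurd rfl hne
  | @cons _ q _ hadj w =>
    have hq : I.node x ε q = I.node x ε p := (ConnectedComponent.eq.2 hadj.reachable).symm
    rw [fromEdgeSet_adj] at hadj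
    obtain ⟨l, hl, hpl⟩ := hL₀ _ hadj.1
    refine (hc _ l.2.1).trans (Finset.single_le_sum (f := fun l : I.Link => I.cost l.1.1)
      (fun l _ => zero_le_one.trans (hc _ l.2.1)) (Finset.mem_filter.2 ⟨hl, s(p, q), hadj.1, ?_, hpl⟩))
    intro c hcm
    rcases Sym2.mem_iff.1 hcm with rfl | rfl
    · rfl
    · exact hq

theorem ncard_le_chargeOn (hc : ∀ o ∈ I.origLinks, 1 ≤ I.cost o) {L₀ : Finset I.Link}
    (hL₀ : I.Covers L₀ (I.heavy x ε)) :
    ({v | v ∈ K ∧ ∃ p p', p ≠ p' ∧ I.node x ε p = v ∧ I.node x ε p' = v}.ncard : ℝ) ≤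
      I.chargeOn x ε L₀ K := by
  rw [Set.ncard_eq_toFinset_card', chargeOn, Finset.card_eq_sum_ones, Nat.cast_sum, Nat.cast_one]
  refine (Finset.sum_le_sum (g := fun v => I.charge x ε L₀ v) fun v hv => ?_).trans
    (Finset.sum_le_sum_of_subset_of_nonneg (fun v hv => ?_)
      fun u _ _ => charge_nonneg (fun o ho => zero_le_one.trans (hc o ho)) L₀ u)
  · rw [Set.mem_toFinset] at hv
    obtain ⟨-, p, p', hne, rfl, h⟩ := hv
    exact one_le_charge hc hL₀ hne h
  · rw [Set.mem_toFinset] at hv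
    exact Finset.mem_filter.2 ⟨Finset.mem_univ _, hv.1⟩

/-! ### Transfer of costs -/

/-- Change of variables along φ, valid away from loops. -/
theorem IsImage.sum_eq (h : I.IsImage x ε T z φ)
    (P : Sym2 (Fin n) × Sym2 (I.Node x ε) → Prop) [DecidablePred P] (hP : ∀ l, P l → ¬ l.2.IsDiag) :
    ∑ l with P (l.1.1, l.1.2.map φ), I.cost l.1.1 * x l = ∑ l with P l, I.cost l.1 * z l := by
  rw [← Finset.sum_fiberwise_of_maps_to (s := Finset.univ.filter fun l : I.Link =>
    P (l.1.1, l.1.2.map φ)) (t := Finset.univ.filter P) (g := fun l => (l.1.1, l.1.2.map φ))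
    (fun l hl => Finset.mem_filter.2 ⟨Finset.mem_univ _, (Finset.mem_filter.1 hl).2⟩)]
  refine Finset.sum_congr rfl ?_
  rintro ⟨o, s⟩ hl
  have hPl := (Finset.mem_filter.1 hl).2
  rw [h.eq_sum o s (hP _ hPl), Finset.mul_sum]
  refine Finset.sum_congr ?_ ?_
  · ext l
    simp only [Finset.mem_filter, Finset.mem_univ, true_and]
    constructor
    · exact fun h => h.2.symm
    · exact fun h => ⟨h ▸ hPl, h.symm⟩
  · intro l hl
    rw [(Prod.mk.inj (Finset.mem_filter.1 hl).2).1]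

theorem IsImage.mem_of_ne_zero (h : I.IsImage x ε T z φ) (l : Sym2 (Fin n) × Sym2 (I.Node x ε))
    (hd : ¬ l.2.IsDiag) (hz : z l ≠ 0) : ∀ a ∈ l.2, a ∈ T := by
  obtain ⟨o, s⟩ := l
  rw [h.eq_sum o s hd] at hz
  obtain ⟨l, hl, -⟩ := Finset.exists_ne_zero_of_sum_ne_zero hz
  obtain ⟨rfl, rfl⟩ := Prod.mk.inj (Finset.mem_filter.1 hl).2
  intro a ha
  obtain ⟨p, -, rfl⟩ := Sym2.mem_map.1 ha
  exact h.maps p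

theorem IsImage.cost_nonneg_or (h : I.IsImage x ε T z φ) (hc : ∀ o ∈ I.origLinks, 0 ≤ I.cost o)
    (o : Sym2 (Fin n)) : 0 ≤ I.cost o ∨ ∀ s, z (o, s) = 0 := by
  by_cases ho : o ∈ I.origLinks
  · exact .inl (hc o ho)
  · exact .inr (h.eq_zero o ho)

theorem IsImage.cost_mul_nonneg (h : I.IsImage x ε T z φ) (hc : ∀ o ∈ I.origLinks, 0 ≤ I.cost o)
    (l : Sym2 (Fin n) × Sym2 (I.Node x ε)) : 0 ≤ I.cost l.1 * z l := by
  rcases h.cost_nonneg_or hc l.1 with h' | h'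
  · exact mul_nonneg h' (h.nonneg l)
  · rw [show z l = 0 from h' l.2, mul_zero]

namespace IsRootEdge

variable (h : I.IsRootEdge x ε T r K a b) (hφ : I.IsImage x ε T z φ)
include h hφ

/-- Since φ moves no node across e, the images of the ends are separated by e as well. As e is not
on the root side of ab, one of the images lies beyond ab, that is, in K; if the link does not cross
ab, both do. -/
theorem image_of_covers {e : Sym2 (Fin n)} (he : e ∈ I.edgesOf x ε (insert r K)) {l : I.Link}
    (hl : e ∈ pathEdges I.tree l.1.2) : ¬ (l.1.2.map φ).IsDiag ∧ (∃ v ∈ l.1.2.map φ, v ∈ K) ∧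
      (s(a, b) ∉ pathEdges I.tree l.1.2 → ∀ v ∈ l.1.2.map φ, v ∈ K) := by
  obtain ⟨⟨o, s⟩, ho⟩ := l
  induction s with | _ p q
  simp only [mem_pathEdges I.isTree] at hl ⊢
  obtain ⟨p', hp'⟩ := I.node_surjective x ε (φ p)
  obtain ⟨q', hq'⟩ := I.node_surjective x ε (φ q)
  obtain ⟨ρ, hρ⟩ := I.node_surjective x ε r
  have heT := edgesOf_mono h.subset he
  have hfT := edgesOf_mono h.subset h.mem_edgesOf
  have hsep : Sep I.tree e p' q' := (hl.2.of_not_left (hφ.not_sep e heT p p' hp')).of_not_right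
    (hφ.not_sep e heT q q' hq')
  have hpT : I.node x ε p' ∈ T := hp' ▸ hφ.maps p
  have hqT : I.node x ε q' ∈ T := hq' ▸ hφ.maps q
  simp only [Sym2.map_mk, Sym2.mk_isDiag_iff, Sym2.mem_iff, exists_eq_or_imp, exists_eq_left,
    forall_eq_or_imp, forall_eq, ← hp', ← hq']
  have hex : I.node x ε p' ∈ K ∨ I.node x ε q' ∈ K := by
    by_contra hcon
    push Not at hcon
    rw [h.mem_iff hρ, h.mem_iff hρ] at hcon
    have hp1 : ¬ Sep I.tree s(a, b) ρ p' := fun h => hcon.1 ⟨hpT, h⟩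
    have hq1 : ¬ Sep I.tree s(a, b) ρ q' := fun h => hcon.2 ⟨hqT, h⟩
    obtain ⟨-, c, hce, hc⟩ := (h.mem_edgesOf_iff hρ).1 he
    exact not_sep_of_end (not_sep_trans (not_sep_symm hp1) hq1) hce (hc.of_not_left hp1) hsep
  refine ⟨fun heq => not_sep_of_node_eq heq (not_mem_heavy_of_mem_edgesOf he) hsep, hex, ?_⟩
  intro hf
  have hf : ¬ Sep I.tree s(a, b) p q := fun hs => hf ⟨h.adj, hs⟩
  have hf' : ¬ Sep I.tree s(a, b) p' q' := not_sep_trans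
    (not_sep_symm (hφ.not_sep _ hfT p p' hp')) (not_sep_trans hf (hφ.not_sep _ hfT q q' hq'))
  rcases hex with h1 | h1
  · exact ⟨h1, (h.mem_iff hρ).2 ⟨hqT, ((h.mem_iff hρ).1 h1).2.of_not_right hf'⟩⟩
  · exact ⟨(h.mem_iff hρ).2 ⟨hpT, ((h.mem_iff hρ).1 h1).2.of_not_right (not_sep_symm hf')⟩, h1⟩

theorem coverCost_le_costMeeting (hc : ∀ o ∈ I.origLinks, 0 ≤ I.cost o) (hx : ∀ l, 0 ≤ x l) :
    I.coverCost x (I.edgesOf x ε (insert r K)) ≤ costMeeting I.cost z K := by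
  have he : ∑ l with ¬ l.2.IsDiag ∧ ∃ a ∈ l.2, a ∈ K, I.cost l.1 * z l = costMeeting I.cost z K := by
    unfold costMeeting
    congr!
  rw [← he, ← hφ.sum_eq (fun l => ¬ l.2.IsDiag ∧ ∃ a ∈ l.2, a ∈ K) fun l hl => hl.1]
  refine Finset.sum_le_sum_of_subset_of_nonneg (fun l hl => ?_) fun l _ _ =>
    mul_nonneg (hc _ l.2.1) (hx l)
  obtain ⟨-, e, he, hel⟩ := Finset.mem_filter.1 hl
  have := h.image_of_covers hφ he hel
  exact Finset.mem_filter.2 ⟨Finset.mem_univ _, this.1, this.2.1⟩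

/-- A link covering an edge of R̄ stays within K or covers ab. Links of the second kind cost at most
M each, and ab is not heavy, so they are cheap in total. -/
theorem coverCost_le_add {M : ℕ} (hc : ∀ o ∈ I.origLinks, 0 ≤ I.cost o ∧ I.cost o ≤ M)
    (hx : ∀ l, 0 ≤ x l) : I.coverCost x (I.edgesOf x ε (insert r K)) ≤
      costWithin I.cost z K + M * I.coverage x s(a, b) := by
  have hc0 : ∀ o ∈ I.origLinks, 0 ≤ I.cost o := fun o ho => (hc o ho).1
  have h1 : ∑ l with ¬ l.2.IsDiag ∧ ∀ a ∈ l.2, a ∈ K, I.cost l.1 * z l ≤ costWithin I.cost z K :=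
    Finset.sum_le_sum_of_subset_of_nonneg (fun l hl => by
      simp only [Finset.mem_filter] at hl ⊢; exact ⟨hl.1, hl.2.2⟩)
      fun l _ _ => hφ.cost_mul_nonneg hc0 l
  rw [← hφ.sum_eq (fun l => ¬ l.2.IsDiag ∧ ∀ a ∈ l.2, a ∈ K) fun l hl => hl.1] at h1
  have h2 : ∑ l : I.Link with s(a, b) ∈ pathEdges I.tree l.1.2, I.cost l.1.1 * x l ≤
      M * I.coverage x s(a, b) := by
    rw [coverage, Finset.mul_sum]
    exact Finset.sum_le_sum fun l _ => mul_le_mul_of_nonneg_right (hc _ l.2.1).2 (hx l)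
  refine le_trans ?_ (add_le_add h1 h2)
  rw [coverCost, Finset.sum_filter, Finset.sum_filter, Finset.sum_filter, ← Finset.sum_add_distrib]
  refine Finset.sum_le_sum fun l _ => ?_
  have h0 := mul_nonneg (hc0 _ l.2.1) (hx l)
  by_cases hl : ∃ e ∈ I.edgesOf x ε (insert r K), e ∈ pathEdges I.tree l.1.2
  · obtain ⟨e, he, hel⟩ := id hl
    have := h.image_of_covers hφ he hel
    by_cases hf : s(a, b) ∈ pathEdges I.tree l.1.2
    · rw [if_pos hl, if_pos hf]
      split_ifs
      all_goals linarith
    · rw [if_pos hl, if_pos ⟨this.1, this.2.2 hf⟩]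
      split_ifs
      linarith
  · rw [if_neg hl]
    split_ifs <;> linarith

/-- The charge is that of K without r. This matters in the sum over all branches, where s_r would
otherwise be counted once per branch. -/
theorem isBundle_or_opt_le {M γ : ℕ} (hε : 0 < ε) (hM : 1 ≤ M)
    (hc : ∀ o ∈ I.origLinks, 1 ≤ I.cost o ∧ I.cost o ≤ M) (hγ : 200 * (M : ℝ) / ε ^ 2 ≤ γ)
    (hx : I.IsFeasible γ x) {L₀ : Finset I.Link} (hL₀ : I.Covers L₀ (I.heavy x ε))
    (hr : I.IsRoot M ε x T z r) : I.IsBundle γ (I.edgesOf x ε (insert r K)) ∨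
      I.opt (I.edgesOf x ε (insert r K)) ≤ I.chargeOn x ε L₀ K := by
  obtain ⟨ρ, hρ⟩ := I.node_surjective x ε r
  refine (h.isBundle_or hρ (γ := γ)).imp_right fun hlt => ?_
  have hc1 : ∀ o ∈ I.origLinks, 1 ≤ I.cost o := fun o ho => (hc o ho).1
  have hc0 : ∀ o ∈ I.origLinks, 0 ≤ I.cost o := fun o ho => zero_le_one.trans (hc1 o ho)
  refine le_trans ?_ (ncard_le_chargeOn hc1 hL₀)
  obtain ⟨hcost, hleaf⟩ := hr.2 K h.branch
  have hlt' : (γ : ℝ) < leafCount (I.contracted x ε) K +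
      {v | v ∈ K ∧ ∃ p p', p ≠ p' ∧ I.node x ε p = v ∧ I.node x ε p' = v}.ncard + 1 := by
    exact_mod_cast hlt
  have h1 := opt_le_two_mul_coverCost hc0 hx.nonneg
    (edgesOf_subset (x := x) (ε := ε) (A := insert r K)) fun e he => hx.cut e (edgesOf_subset he)
  have h2 := h.coverCost_le_add hφ (fun o ho => ⟨hc0 o ho, (hc o ho).2⟩) hx.nonneg
  have h3 : I.coverage x s(a, b) < 2 / ε := by
    by_contra hcon
    exact not_mem_heavy_of_mem_edgesOf h.mem_edgesOf ⟨h.adj, not_lt.1 hcon⟩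
  -- The edge ab is covered at least once without being heavy, so ε < 2. Only this makes the
  -- lower-order terms small.
  have h4 : 1 < 2 / ε := (hx.cut _ h.adj).trans_lt h3
  have hε2 : ε < 2 := by rwa [lt_div_iff₀ hε, one_mul] at h4
  have hM' : (1 : ℝ) ≤ M := by exact_mod_cast hM
  -- In units of t, K has at most 48t leaves and the covering links cost at most 48t + 4t, so OPT is
  -- at most 104t. The number of compound nodes exceeds 200t - 48t - 1, and 1 < 4t.
  set t : ℝ := M / ε ^ 2 with ht
  have e1 : 200 * (M : ℝ) / ε ^ 2 = 200 * t := by rw [ht]; ring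
  have e2 : 48 * (M : ℝ) / ε ^ 2 = 48 * t := by rw [ht]; ring
  have e3 : (M : ℝ) = t * ε ^ 2 := by rw [ht]; field_simp
  have e4 : (M : ℝ) * (2 / ε) = 2 * t * ε := by rw [e3]; field_simp
  have ht0 : 0 < t := by positivity
  have e5 : 1 < 4 * t := by
    have : ε ^ 2 < 4 := by nlinarith
    nlinarith
  have e6 : (M : ℝ) * I.coverage x s(a, b) ≤ 4 * t := by
    have := mul_le_mul_of_nonneg_left h3.le (zero_le_one.trans hM')
    nlinarith
  linarith

end IsRootEdge

theorem opt_le_coverCost {γ : ℕ} (hx : I.IsFeasible γ x) {X : Set (Sym2 (Fin n))}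
    (h : I.IsBundle γ X) : I.opt X ≤ I.coverCost x X := hx.bundle X h

end Instance
end
end TreeAug

/-! ### Correctness of the computations with codes of trees. -/

namespace TreeAug

open SimpleGraph

noncomputable section

open scoped Classical

/-! ### The algorithm on encodings: trees -/

variable {n : ℕ}

namespace Val

theorem length_toList_nat (i : ℕ) : (nat i).toList.length = i := by
  induction i with
  | zero => simp [nat, toList]
  | succ i ih => simp [nat, toList, ih]

theorem lenLe_iff {a b : Val} : lenLe a b ↔ a.toList.length ≤ b.toList.length := by
  refine ⟨PolyTime.length_le_of_lenLe, fun h => ?_⟩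
  unfold lenLe
  generalize b.toList = l at h
  induction l generalizing a with
  | nil => cases a <;> simp [toList] at h ⊢
  | cons x l ih =>
    rw [List.foldl_cons]
    refine ih ?_
    cases a <;> simp [toList, snd] at h ⊢
    exact h

theorem natEq_nat {i j : ℕ} : natEq (nat i) (nat j) ↔ i = j := by
  simp only [natEq, lenLe_iff, length_toList_nat]
  lia

theorem edgeEq_encPair {e f : Sym2 (Fin n)} : edgeEq (encPair e) (encPair f) ↔ e = f := by
  simp only [edgeEq, encPair, fst, snd, natEq_nat, Fin.val_inj]
  exact Sym2.inf_eq_inf_and_sup_eq_sup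

theorem isEnd_encPair {p : Fin n} {e : Sym2 (Fin n)} : isEnd (nat p) (encPair e) ↔ p ∈ e := by
  simp only [isEnd, encPair, fst, snd, natEq_nat, Fin.val_inj]
  induction e with | _ a b
  rw [Sym2.inf_mk, Sym2.sup_mk, Sym2.mem_iff]
  rcases le_total a b with h | h
  · rw [inf_eq_left.2 h, sup_eq_right.2 h]
  · rw [inf_eq_right.2 h, sup_eq_left.2 h, or_comm]

theorem filter_list_map {α : Type*} (c : Val → Prop) (f : α → Val) (l : List α) :
    filter c (list (l.map f)) = list ((l.filter fun a => decide (c (f a))).map f) := by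
  rw [filter, toList_list, List.filter_map]
  rfl

/-- The two ends of a pair of nodes. -/
theorem exists_ends (e : Sym2 (Fin n)) : ∃ a b : Fin n, e = s(a, b) ∧ (encPair e).fst = nat a ∧
    (encPair e).snd = nat b := by
  refine ⟨e.inf, e.sup, ?_, rfl, rfl⟩
  rw [← Sym2.inf_eq_inf_and_sup_eq_sup]
  simp [Sym2.inf_le_sup]

theorem isEnd_iff_mem_inter {e f : Sym2 (Fin n)} :
    isEnd (encPair e).fst (encPair f) ∨ isEnd (encPair e).snd (encPair f) ↔ ∃ c ∈ e, c ∈ f := by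
  obtain ⟨a, b, rfl, h1, h2⟩ := exists_ends e
  rw [h1, h2, isEnd_encPair, isEnd_encPair]
  simp

/-- After k rounds, exactly the edges with an end at distance less than k from a have been found. As
many rounds as edges suffice because a path repeats no edge. -/
theorem conn_iff {H : SimpleGraph (Fin n)} {L : List (Sym2 (Fin n))}
    (hL : ∀ e, e ∈ L ↔ e ∈ H.edgeSet) {a b : Fin n} :
    conn (list (L.map encPair)) (nat a) (nat b) ↔ H.Reachable a b := by
  have key : ∀ m : List Val, ∃ S : List (Sym2 (Fin n)),
      m.foldl (fun acc _ => filter (fun e => isEnd (nat a) e ∨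
        ∃ f ∈ acc.toList, isEnd e.fst f ∨ isEnd e.snd f) (list (L.map encPair))) nil =
        list (S.map encPair) ∧
      ∀ e, e ∈ S ↔ e ∈ L ∧ ∃ q ∈ e, ∃ w : H.Walk a q, w.length < m.length := by
    intro m
    induction m using List.reverseRecOn with
    | nil => exact ⟨[], rfl, by simp⟩
    | append_singleton m x ih =>
      obtain ⟨S, h1, h2⟩ := ih
      rw [List.foldl_append, h1]
      refine ⟨_, filter_list_map _ _ _, fun e => ?_⟩
      simp only [List.mem_filter, decide_eq_true_eq, isEnd_encPair, toList_list, List.mem_map,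
        exists_exists_and_eq_and, isEnd_iff_mem_inter, List.length_append, List.length_singleton]
      refine and_congr_right fun he => ⟨?_, ?_⟩
      · rintro (h | ⟨f, hf, c, hce, hcf⟩)
        · exact ⟨a, h, Walk.nil, by simp⟩
        · obtain ⟨hfL, q, hq, w, hw⟩ := (h2 f).1 hf
          by_cases hqc : q = c
          · subst hqc
            exact ⟨q, hce, w, by lia⟩
          · have : f = s(q, c) := (Sym2.mem_and_mem_iff hqc).1 ⟨hq, hcf⟩
            have hadj : H.Adj q c := by rw [← mem_edgeSet, ← this, ← hL]; exact hfL
            exact ⟨c, hce, w.concat hadj, by rw [Walk.length_concat]; lia⟩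
      · rintro ⟨q, hq, w, hw⟩
        cases w using Walk.concatRec with
        | Hnil => exact .inl hq
        | Hconcat w h _ =>
          rename_i u _
          rw [Walk.length_concat] at hw
          have hf : s(u, q) ∈ L := (hL _).2 h
          exact .inr ⟨s(u, q), (h2 _).2 ⟨hf, u, by simp, w, by lia⟩, q, hq, by simp⟩
  obtain ⟨S, h1, h2⟩ := key (list (L.map encPair)).toList
  rw [conn, reach, h1]
  simp only [natEq_nat, Fin.val_inj, toList_list, List.mem_map, exists_exists_and_eq_and,
    isEnd_encPair, h2, List.length_map]
  constructor
  · rintro (rfl | ⟨f, ⟨hf, q, hq, w, -⟩, hb⟩)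
    · exact Reachable.refl _
    · by_cases hqb : q = b
      · subst hqb
        exact ⟨w⟩
      · have : f = s(q, b) := (Sym2.mem_and_mem_iff hqb).1 ⟨hq, hb⟩
        have hadj : H.Adj q b := by rw [← mem_edgeSet, ← this, ← hL]; exact hf
        exact ⟨w.concat hadj⟩
  · rintro ⟨w⟩
    have hpath := w.bypass_isPath
    generalize w.bypass = w at hpath
    cases w using Walk.concatRec with
    | Hnil => exact .inl rfl
    | Hconcat w h _ =>
      rename_i u _
      have hlen : (w.concat h).length ≤ L.length := by
        rw [← Walk.length_edges]
        refine (hpath.isTrail.edges_nodup.subperm fun e he => ?_).length_le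
        exact (hL e).2 ((w.concat h).edges_subset_edgeSet he)
      rw [Walk.length_concat] at hlen
      exact .inr ⟨s(u, b), ⟨(hL _).2 h, u, by simp, w, by lia⟩, by simp⟩

end Val

namespace Instance

variable {I : Instance n}

/-- The edges of the tree, in a fixed order. -/
def edgeList (I : Instance n) : List (Sym2 (Fin n)) :=
  (List.finRange n).sym2.filter fun e => decide (e ∈ I.tree.edgeSet)

theorem encTree_eq : I.encTree = .list (I.edgeList.map encPair) := rfl

theorem mem_sym2_finRange (e : Sym2 (Fin n)) : e ∈ (List.finRange n).sym2 := by
  rw [List.mem_sym2_iff]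
  exact fun a _ => List.mem_finRange a

theorem mem_edgeList {e : Sym2 (Fin n)} : e ∈ I.edgeList ↔ e ∈ I.tree.edgeSet := by
  simp [edgeList, mem_sym2_finRange]

theorem nodup_edgeList : I.edgeList.Nodup :=
  ((List.nodup_finRange n).sym2).filter _

theorem mem_linkList {o : Sym2 (Fin n)} : o ∈ I.linkList ↔ o ∈ I.origLinks := by
  simp [linkList, mem_sym2_finRange]

theorem length_linkList_le : I.linkList.length ≤ (List.finRange n).sym2.length :=
  List.length_filter_le _ _

theorem separates_iff {e : Sym2 (Fin n)} {a b : Fin n} :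
    Val.separates I.encTree (encPair e) (.nat a) (.nat b) ↔ Sep I.tree e a b := by
  rw [Val.separates, encTree_eq, Val.filter_list_map, Sep]
  simp only [Val.edgeEq_encPair]
  rw [Val.conn_iff (H := I.tree.deleteEdges {e})]
  intro f
  simp only [List.mem_filter, mem_edgeList, edgeSet_deleteEdges, Set.mem_sdiff,
    Set.mem_singleton_iff, decide_eq_true_eq]
  exact and_congr_right fun _ => not_congr eq_comm

theorem separates_encPair_iff {e o : Sym2 (Fin n)} (he : e ∈ I.tree.edgeSet) :
    Val.separates I.encTree (encPair e) (encPair o).fst (encPair o).snd ↔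
      e ∈ pathEdges I.tree o := by
  obtain ⟨a, b, rfl, h1, h2⟩ := Val.exists_ends o
  rw [h1, h2, separates_iff, mem_pathEdges I.isTree, and_iff_right he]

theorem beyond_iff {e f : Sym2 (Fin n)} {a : Fin n} :
    Val.beyond I.encTree (.nat a) (encPair f) (encPair e) ↔ ∃ p ∈ e, Sep I.tree f a p := by
  obtain ⟨p, q, rfl, h1, h2⟩ := Val.exists_ends e
  rw [Val.beyond, h1, h2, separates_iff, separates_iff]
  simp only [Sym2.mem_iff, or_and_right, exists_or, exists_eq_left]

variable {x : I.Link → ℝ} {ε : ℝ} {T : Set (I.Node x ε)}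

theorem nodeMem_iff {p : Fin n} {A : I.Node x ε} :
    Val.nodeMem (.nat p) (I.encNode x ε A) ↔ I.node x ε p = A := by
  simp [Val.nodeMem, encNode, Val.toList_list, Val.natEq_nat, Fin.val_inj]

theorem mem_nodeList {A : I.Node x ε} : A ∈ I.nodeList x ε T ↔ A ∈ T := by
  obtain ⟨p, rfl⟩ := I.node_surjective x ε A
  simp [nodeList]

theorem exists_mem_encNodes {c : Val → Prop} :
    (∃ A ∈ (Val.list ((I.nodeList x ε T).map (I.encNode x ε))).toList, c A) ↔
      ∃ A ∈ T, c (I.encNode x ε A) := by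
  simp [Val.toList_list, mem_nodeList]

theorem edgesBetween_eq :
    Val.edgesBetween I.encTree (.list ((I.nodeList x ε T).map (I.encNode x ε))) =
      .list ((I.edgeList.filter fun e => decide (e ∈ I.edgesOf x ε T)).map encPair) := by
  rw [Val.edgesBetween, encTree_eq, Val.filter_list_map]
  refine congrArg (fun l => Val.list (List.map encPair l)) (List.filter_congr fun e he => ?_)
  rw [mem_edgeList] at he
  rw [decide_eq_decide]
  simp only [exists_mem_encNodes]
  obtain ⟨p, q, rfl, h1, h2⟩ := Val.exists_ends e
  simp only [h1, h2, nodeMem_iff]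
  constructor
  · rintro ⟨⟨A, hA, rfl⟩, ⟨B, hB, rfl⟩, h⟩
    exact ⟨p, q, rfl, he, fun h' => h ⟨_, hA, rfl, h'.symm⟩, hA, hB⟩
  · rintro ⟨p', q', hpq, -, hne, hp, hq⟩
    rcases Sym2.eq_iff.1 hpq with ⟨rfl, rfl⟩ | ⟨rfl, rfl⟩
    · exact ⟨⟨_, hp, rfl⟩, ⟨_, hq, rfl⟩, fun ⟨A, _, h, h'⟩ => hne (h.trans h'.symm)⟩
    · exact ⟨⟨_, hq, rfl⟩, ⟨_, hp, rfl⟩, fun ⟨A, _, h, h'⟩ => hne (h'.trans h.symm)⟩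

theorem exists_fst_encNode (A : I.Node x ε) :
    ∃ p : Fin n, I.node x ε p = A ∧ (I.encNode x ε A).fst = .nat p := by
  obtain ⟨q, hq⟩ := I.node_surjective x ε A
  rw [encNode]
  have hmem : q ∈ (List.finRange n).filter fun p => decide (I.node x ε p = A) := by simp [hq]
  rcases hl : (List.finRange n).filter fun p => decide (I.node x ε p = A) with _ | ⟨p, l⟩
  · rw [hl] at hmem
    simp at hmem
  · refine ⟨p, ?_, rfl⟩
    have : p ∈ (List.finRange n).filter fun p => decide (I.node x ε p = A) := by rw [hl]; simp
    simpa using this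

end Instance

end

end TreeAug

/-! ### Sets closed under descending, and correctness of the dynamic program. -/

namespace TreeAug

open SimpleGraph

noncomputable section

open scoped Classical

/-! ### Sets of edges that are closed under descending -/

section DownClosed

variable {V : Type*} {G : SimpleGraph V} {e f g : Sym2 V} {r : V}

/-- Being equal to or beyond f thus is inclusion of far sides, which is transitive. -/
theorem exists_mem_sep_iff (hG : G.IsTree) (hf : f ∈ G.edgeSet) (hg : g ∈ G.edgeSet) :
    (∃ p ∈ g, Sep G f r p) ↔ ∀ q, Sep G g r q → Sep G f r q := by
  obtain ⟨a, b, rfl, ha, hb⟩ := sep_or_of_mem hG hg r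
  refine ⟨fun ⟨p, hp, hs⟩ => ?_, fun h => ⟨a, by simp, h a ha⟩⟩
  by_cases hfg : f = s(a, b)
  · exact fun q hq => hfg ▸ hq
  have hfa : Sep G f r a := hs.of_not_right (not_sep_of_mem hg hfg hp (by simp))
  have hfb : Sep G f r b := hs.of_not_right (not_sep_of_mem hg hfg hp (by simp))
  exact (sep_laminar hG hf ha hfa).resolve_right fun h => hb (h b hfb)

theorem eq_of_weight_le [Finite V] (hG : G.IsTree) (hf : f ∈ G.edgeSet) (hg : g ∈ G.edgeSet)
    (h : ∃ p ∈ g, Sep G f r p) (hw : weight G r f ≤ weight G r g) : f = g := by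
  rw [exists_mem_sep_iff hG hf hg] at h
  obtain ⟨a, b, hab, ha, -⟩ := sep_or_of_mem hG hg r
  obtain ⟨a', b', hab', ha', -⟩ := sep_or_of_mem hG hf r
  refine eq_of_sep hG hf hg (a := a') (a' := a) (r := r) (by simp [hab']) (by simp [hab]) ha'
    (h a ha) ?_ ha
  exact sep_of_weight_le hG hg (h a ha) ha hw ha'

theorem exists_topmost [Finite V] (hG : G.IsTree) {R : List (Sym2 V)} (hR : ∀ e ∈ R, e ∈ G.edgeSet)
    (h : R ≠ []) (r : V) : ∃ e ∈ R, ∀ f ∈ R, f = e ∨ ¬ ∃ p ∈ e, Sep G f r p := by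
  obtain ⟨e, he, hmax⟩ := R.toFinset.exists_max_image (weight G r) (by simpa using h)
  rw [List.mem_toFinset] at he
  refine ⟨e, he, fun f hf => or_iff_not_imp_right.2 fun h => ?_⟩
  exact eq_of_weight_le hG (hR f hf) (hR e he) (not_not.1 h) (hmax f (List.mem_toFinset.2 hf))

/-- With every edge, `R` contains the edges of `X` beyond it. -/
def DownClosed (G : SimpleGraph V) (r : V) (X R : Set (Sym2 V)) : Prop :=
  ∀ f ∈ R, ∀ g ∈ X, (∃ p ∈ g, Sep G f r p) → g ∈ R

/-- On the way from a lowest edge of X up to the root, a set closed under descending is a bottom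
segment, given by its topmost edge or empty. These are at most |X| + 1 choices per lowest edge. They
determine the set, as every edge of X is, or has below it, a lowest one. -/
theorem card_downClosed_le [Finite V] (hG : G.IsTree) (r : V) (X : Finset (Sym2 V))
    (hX : ∀ e ∈ X, e ∈ G.edgeSet) : (X.powerset.filter fun R : Finset (Sym2 V) => DownClosed G r X R).card ≤
      (X.card + 1) ^ {e | e ∈ X ∧ ∀ f ∈ X, (∃ p ∈ f, Sep G e r p) → f = e}.ncard := by
  set A := {e | e ∈ X ∧ ∀ f ∈ X, (∃ p ∈ f, Sep G e r p) → f = e}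
  have hfin : A.Finite := X.finite_toSet.subset fun e he => he.1
  have := hfin.fintype
  let Φ : (A → Option X) → Finset (Sym2 V) := fun φ =>
    X.filter fun g => ∃ e t, φ e = some t ∧ ∃ p ∈ g, Sep G t r p
  have hcard : (Finset.univ.image Φ).card ≤ (X.card + 1) ^ A.ncard := by
    refine Finset.card_image_le.trans ?_
    rw [Finset.card_univ, Fintype.card_fun, Fintype.card_option, Fintype.card_coe,
      Set.ncard_eq_toFinset_card', Set.toFinset_card]
  refine le_trans (Finset.card_le_card fun R hR => ?_) hcard
  obtain ⟨hRX, hR⟩ := Finset.mem_filter.1 hR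
  rw [Finset.mem_powerset] at hRX
  have hφ : ∀ e : A, ∃ o : Option X, (∀ t, o = some t → t.1 ∈ R) ∧ ∀ g ∈ R,
      (∃ p ∈ e.1, Sep G g r p) → ∃ t, o = some t ∧ ∃ p ∈ g, Sep G t r p := by
    rintro ⟨e, he⟩
    by_cases h : ∃ g ∈ R, ∃ p ∈ e, Sep G g r p
    · obtain ⟨t, ht, hmax⟩ := (R.filter fun g => ∃ p ∈ e, Sep G g r p).exists_max_image (weight G r)
        (by obtain ⟨g, hg, h⟩ := h; exact ⟨g, Finset.mem_filter.2 ⟨hg, h⟩⟩)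
      obtain ⟨htR, ht⟩ := Finset.mem_filter.1 ht
      refine ⟨some ⟨t, hRX htR⟩, fun t' ht' => Option.some.inj ht' ▸ htR, fun g hg hge => ?_⟩
      refine ⟨_, rfl, ?_⟩
      have hw := hmax g (Finset.mem_filter.2 ⟨hg, hge⟩)
      have hte := hX t (hRX htR)
      have hgE := hX g (hRX hg)
      rw [exists_mem_sep_iff hG hte (hX e he.1)] at ht
      rw [exists_mem_sep_iff hG hgE (hX e he.1)] at hge
      obtain ⟨a, b, -, ha, -⟩ := sep_or_of_mem hG (hX e he.1) r
      exact (exists_mem_sep_iff hG hte hgE).2 fun q hq =>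
        sep_of_weight_le hG hte (hge a ha) (ht a ha) hw hq
    · exact ⟨none, by simp, fun g hg hge => absurd ⟨g, hg, hge⟩ h⟩
  choose φ hφ₁ hφ₂ using hφ
  refine Finset.mem_image.2 ⟨φ, Finset.mem_univ _, ?_⟩
  ext g
  simp only [Φ, Finset.mem_filter]
  constructor
  · rintro ⟨hg, e, t, ht, hp⟩
    exact hR _ (hφ₁ e t ht) g hg hp
  · intro hg
    have hgE := hX g (hRX hg)
    obtain ⟨e, he, hmin⟩ := (X.filter fun e => ∃ p ∈ e, Sep G g r p).exists_min_image (weight G r)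
      ⟨g, Finset.mem_filter.2 ⟨hRX hg, (exists_mem_sep_iff hG hgE hgE).2 fun _ h => h⟩⟩
    obtain ⟨heX, he⟩ := Finset.mem_filter.1 he
    have heA : e ∈ A := by
      refine ⟨heX, fun f hf hef => (eq_of_weight_le hG (hX e heX) (hX f hf) hef ?_).symm⟩
      refine hmin f (Finset.mem_filter.2 ⟨hf, ?_⟩)
      rw [exists_mem_sep_iff hG hgE (hX e heX)] at he
      rw [exists_mem_sep_iff hG (hX e heX) (hX f hf)] at hef
      exact (exists_mem_sep_iff hG hgE (hX f hf)).2 fun q hq => he q (hef q hq)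
    obtain ⟨t, ht, hp⟩ := hφ₂ ⟨e, heA⟩ g hg he
    exact ⟨hRX hg, _, t, ht, hp⟩

end DownClosed

/-! ### The dynamic program -/

namespace Instance

variable {n : ℕ} {I : Instance n} {xs : List (Sym2 (Fin n))}

/-- An original link. -/
abbrev OrigLink (I : Instance n) : Type := {o : Sym2 (Fin n) // o ∈ I.origLinks}

/-- An original link, as a link of the shadow completion. -/
def ofOrig (I : Instance n) (o : I.OrigLink) : I.Link := ⟨(o.1, o.1), o.2, subset_rfl⟩

def listCost (I : Instance n) (S : List I.OrigLink) : ℝ := (S.map fun o => I.cost o.1).sum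

/-- The edges in `xs` that are not covered by the links in `S`. -/
def rest (I : Instance n) (xs : List (Sym2 (Fin n))) (S : List I.OrigLink) : List (Sym2 (Fin n)) :=
  xs.filter fun e => decide (∀ o ∈ S, e ∉ pathEdges I.tree o.1)

/-- The code of a partial solution. -/
def entry (I : Instance n) (xs : List (Sym2 (Fin n))) (S : List I.OrigLink) : Val :=
  .pair (.list ((I.rest xs S).map encPair))
    (.pair (.real (I.listCost S)) (I.encLinks (S.map I.ofOrig)))

/-- The link `o` covers a topmost edge that is not covered by `S`. -/
def CoversTop (I : Instance n) (ρ : Fin n) (xs : List (Sym2 (Fin n))) (S : List I.OrigLink)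
    (o : I.OrigLink) : Prop :=
  ∃ e ∈ I.rest xs S, e ∈ pathEdges I.tree o.1 ∧
    ∀ f ∈ I.rest xs S, f = e ∨ ¬ ∃ p ∈ e, Sep I.tree f ρ p

theorem mem_rest {S : List I.OrigLink} {e : Sym2 (Fin n)} :
    e ∈ I.rest xs S ↔ e ∈ xs ∧ ∀ o ∈ S, e ∉ pathEdges I.tree o.1 := by
  simp [rest]

theorem rest_cons (o : I.OrigLink) (S : List I.OrigLink) :
    I.rest xs (o :: S) = (I.rest xs S).filter fun e => decide (e ∉ pathEdges I.tree o.1) := by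
  simp only [rest, List.filter_filter]
  refine List.filter_congr fun e _ => ?_
  simp

theorem fst_entry (S : List I.OrigLink) :
    (I.entry xs S).fst = .list ((I.rest xs S).map encPair) := rfl

theorem list_map_encPair_injective {l l' : List (Sym2 (Fin n))}
    (h : Val.list (l.map encPair) = .list (l'.map encPair)) : l = l' := by
  have h1 := congrArg Val.toList h
  rw [Val.toList_list, Val.toList_list] at h1
  refine List.map_injective_iff.2 (fun e f hef => ?_) h1
  rw [← Val.edgeEq_encPair, hef, Val.edgeEq_encPair]

theorem fst_entry_eq_nil {S : List I.OrigLink} : (I.entry xs S).fst = .nil ↔ I.rest xs S = [] := by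
  rw [fst_entry]
  exact ⟨fun h => list_map_encPair_injective (l' := []) h, fun h => by rw [h]; rfl⟩

theorem dominates_entry {S S' : List I.OrigLink} :
    Val.dominates (I.entry xs S) (I.entry xs S') ↔
      I.rest xs S ⊆ I.rest xs S' ∧ I.listCost S ≤ I.listCost S' := by
  have hle : (Val.pair (I.entry xs S).snd.fst (I.entry xs S').snd.fst).le ≠ .nil ↔
      I.listCost S ≤ I.listCost S' := by
    simp only [entry, Val.snd, Val.fst, Val.le]
    split_ifs with h <;> simp [h]
  rw [Val.dominates, hle]
  refine and_congr_left fun _ => ?_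
  simp [fst_entry, Val.toList_list, Val.edgeEq_encPair, List.subset_def]

theorem mem_encCosts {k : Val} : k ∈ I.encCosts.toList ↔
    ∃ o : I.OrigLink, k = .pair (encPair o.1) (.real (I.cost o.1)) := by
  simp only [encCosts, Val.toList_list, List.mem_map, mem_linkList, Subtype.exists, exists_prop]
  exact exists_congr fun o => and_congr_right fun _ => eq_comm

variable (hxs : ∀ e ∈ xs, e ∈ I.tree.edgeSet)
include hxs

theorem extend_entry (S : List I.OrigLink) (o : I.OrigLink) :
    Val.extend I.encTree (I.entry xs S) (.pair (encPair o.1) (.real (I.cost o.1))) =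
      I.entry xs (o :: S) := by
  have h : Val.filter (fun e => ¬ Val.separates I.encTree e (encPair o.1).fst (encPair o.1).snd)
      (I.entry xs S).fst = .list ((I.rest xs (o :: S)).map encPair) := by
    rw [fst_entry, Val.filter_list_map, rest_cons]
    refine congrArg (fun l => Val.list (List.map encPair l)) (List.filter_congr fun e he => ?_)
    rw [decide_eq_decide, separates_encPair_iff (hxs e (mem_rest.1 he).1)]
  refine (congrArg (fun v => Val.pair v _) h).trans ?_
  simp only [entry, Val.snd, Val.fst, Val.add, listCost, List.map_cons, List.sum_cons, encLinks,
    Val.list, ofOrig, add_comm]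

theorem useful_entry {ρ : Fin n} {S : List I.OrigLink} {o : I.OrigLink} :
    Val.useful I.encTree (.nat ρ) (I.entry xs S) (.pair (encPair o.1) (.real (I.cost o.1))) ↔
      I.CoversTop ρ xs S o := by
  simp only [Val.useful, fst_entry, Val.toList_list, List.mem_map, exists_exists_and_eq_and,
    forall_exists_index, and_imp, forall_apply_eq_imp_iff₂, Val.edgeEq_encPair, beyond_iff,
    CoversTop]
  refine exists_congr fun e => and_congr_right fun he => and_congr_left fun _ => ?_
  exact separates_encPair_iff (hxs e (mem_rest.1 he).1)

/-- Suppose o covers g beyond f but leaves f uncovered. Then the path of o does not cross f and so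
lies entirely beyond f. In particular the topmost edge e that o covers is beyond f, which
contradicts its choice. -/
theorem downClosed_cons {ρ : Fin n} {S : List I.OrigLink} {o : I.OrigLink}
    (hS : DownClosed I.tree ρ {e | e ∈ xs} {e | e ∈ I.rest xs S}) (ho : I.CoversTop ρ xs S o) :
    DownClosed I.tree ρ {e | e ∈ xs} {e | e ∈ I.rest xs (o :: S)} := by
  intro f hf g hg ⟨p, hp, hs⟩
  simp only [Set.mem_ofPred_eq, rest_cons, List.mem_filter, decide_eq_true_eq] at hf hg ⊢
  refine ⟨hS f hf.1 g hg ⟨p, hp, hs⟩, fun hgo => ?_⟩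
  obtain ⟨e, he, heo, htop⟩ := ho
  have hfE := hxs f (mem_rest.1 hf.1).1
  obtain ⟨o, hoL⟩ := o
  induction o with | _ a b
  simp only [mem_pathEdges I.isTree] at hf hgo heo
  have hab : ¬ Sep I.tree f a b := fun h => hf.2 ⟨hfE, h⟩
  have key : ∀ h ∈ I.tree.edgeSet, Sep I.tree h a b → ∀ c ∈ h, ¬ Sep I.tree f a c :=
    fun h _ hh c hc hfc => not_sep_of_end hab hc hfc hh
  have hpa := key g hgo.1 hgo.2 p hp
  rcases htop f hf.1 with rfl | h
  · exact hab heo.2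
  · refine h ?_
    obtain ⟨c, hc⟩ : ∃ c, c ∈ e := ⟨_, Sym2.out_fst_mem e⟩
    refine ⟨c, hc, ?_⟩
    exact hs.of_not_right (not_sep_trans (not_sep_symm hpa) (key e heo.1 heo.2 c hc))

omit hxs

/-- The table consists of partial solutions with different sets of remaining edges, and these sets
are closed under descending. -/
def IsTable (I : Instance n) (ρ : Fin n) (xs : List (Sym2 (Fin n))) (tbl : Val) : Prop :=
  (∀ v ∈ tbl.toList, ∃ S, DownClosed I.tree ρ {e | e ∈ xs} {e | e ∈ I.rest xs S} ∧
    v = I.entry xs S) ∧ (tbl.toList.map Val.fst).Nodup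

/-- The table contains a partial solution that dominates `S`. -/
def Dominated (I : Instance n) (xs : List (Sym2 (Fin n))) (tbl : Val) (S : List I.OrigLink) :
    Prop :=
  ∃ S', I.entry xs S' ∈ tbl.toList ∧ I.rest xs S' ⊆ I.rest xs S ∧ I.listCost S' ≤ I.listCost S

theorem insertSol_spec {ρ : Fin n} {tbl : Val} (h : I.IsTable ρ xs tbl) {S : List I.OrigLink}
    (hS : DownClosed I.tree ρ {e | e ∈ xs} {e | e ∈ I.rest xs S}) :
    I.IsTable ρ xs (Val.insertSol (I.entry xs S) tbl) ∧
      I.Dominated xs (Val.insertSol (I.entry xs S) tbl) S ∧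
      ∀ S', I.Dominated xs tbl S' → I.Dominated xs (Val.insertSol (I.entry xs S) tbl) S' := by
  unfold Val.insertSol Val.ite
  split_ifs with hdom
  · refine ⟨h, ?_, fun _ h => h⟩
    obtain ⟨y, hy, hdom⟩ := hdom
    obtain ⟨S', -, rfl⟩ := h.1 y hy
    exact ⟨S', hy, dominates_entry.1 hdom⟩
  · have hmem : ∀ v, v ∈ (Val.pair (I.entry xs S)
        (Val.filter (fun y => ¬ Val.dominates (I.entry xs S) y) tbl)).toList ↔
        v = I.entry xs S ∨ v ∈ tbl.toList ∧ ¬ Val.dominates (I.entry xs S) v := by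
      intro v
      rw [Val.toList, List.mem_cons, Val.mem_filter]
    refine ⟨⟨fun v hv => ?_, ?_⟩, ?_, ?_⟩
    · rcases (hmem v).1 hv with rfl | hv
      · exact ⟨S, hS, rfl⟩
      · exact h.1 v hv.1
    · rw [Val.toList, List.map_cons, List.nodup_cons]
      refine ⟨fun hmem => ?_, ?_⟩
      · obtain ⟨y, hy, hfst⟩ := List.mem_map.1 hmem
        rw [Val.mem_filter] at hy
        obtain ⟨S', -, rfl⟩ := h.1 y hy.1
        have hrest := list_map_encPair_injective hfst
        -- Entries with equal remaining edges are always comparable, so one of the two dominates the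
        -- other and only one is kept.
        rcases le_total (I.listCost S) (I.listCost S') with hle | hle
        · exact hy.2 (dominates_entry.2 ⟨hrest ▸ List.Subset.refl _, hle⟩)
        · exact hdom ⟨_, hy.1, dominates_entry.2 ⟨hrest ▸ List.Subset.refl _, hle⟩⟩
      · rw [Val.filter, Val.toList_list]
        exact h.2.sublist (List.filter_sublist.map _)
    · exact ⟨S, (hmem _).2 (.inl rfl), List.Subset.refl _, le_rfl⟩
    · rintro S' ⟨S₁, h₁, h₂, h₃⟩
      by_cases hd : Val.dominates (I.entry xs S) (I.entry xs S₁)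
      · have hd' := dominates_entry.1 hd
        exact ⟨S, (hmem _).2 (.inl rfl), List.Subset.trans hd'.1 h₂, hd'.2.trans h₃⟩
      · exact ⟨S₁, (hmem _).2 (.inr ⟨h₁, hd⟩), h₂, h₃⟩

theorem insertSols_spec {ρ : Fin n} (l : List Val) {tbl : Val} (h : I.IsTable ρ xs tbl)
    (hl : ∀ v ∈ l, ∃ S, DownClosed I.tree ρ {e | e ∈ xs} {e | e ∈ I.rest xs S} ∧
      v = I.entry xs S) :
    I.IsTable ρ xs (l.foldl (fun acc x => Val.insertSol x acc) tbl) ∧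
      ∀ S, I.Dominated xs tbl S ∨ I.entry xs S ∈ l →
        I.Dominated xs (l.foldl (fun acc x => Val.insertSol x acc) tbl) S := by
  induction l generalizing tbl with
  | nil => exact ⟨h, by simp⟩
  | cons x l ih =>
    obtain ⟨S₀, hS₀, rfl⟩ := hl x (by simp)
    obtain ⟨h1, h2, h3⟩ := insertSol_spec h hS₀
    obtain ⟨h4, h5⟩ := ih h1 fun v hv => hl v (by simp [hv])
    refine ⟨h4, ?_⟩
    rintro S (hS | hS)
    · exact h5 S (.inl (h3 S hS))
    · rcases List.mem_cons.1 hS with hS | hS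
      · refine h5 S (.inl ?_)
        obtain ⟨S', h6, h7, h8⟩ := h2
        refine ⟨S', hS ▸ h6, ?_⟩
        rw [← dominates_entry, hS, dominates_entry]
        exact ⟨h7, h8⟩
      · exact h5 S (.inr hS)

include hxs

/-- The entries inject into the sets closed under descending, by their remaining edges. -/
theorem IsTable.length_le {ρ : Fin n} {tbl : Val} (h : I.IsTable ρ xs tbl) :
    tbl.toList.length ≤ (xs.length + 1) ^ {e | e ∈ {e | e ∈ xs} ∧ ∀ f ∈ {e | e ∈ xs},
      (∃ p ∈ f, Sep I.tree e ρ p) → f = e}.ncard := by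
  have hcard := card_downClosed_le I.isTree ρ xs.toFinset (fun e he => hxs e (by simpa using he))
  simp only [List.mem_toFinset] at hcard
  refine le_trans ?_ (hcard.trans (Nat.pow_le_pow_left (by
    have := xs.toFinset_card_le
    lia) _))
  rw [← List.length_map Val.fst, ← List.toFinset_card_of_nodup h.2]
  refine (Finset.card_le_card fun v hv => ?_).trans (Finset.card_image_le
    (f := fun R : Finset (Sym2 (Fin n)) => Val.list ((xs.filter fun e => decide (e ∈ R)).map encPair)))
  rw [List.mem_toFinset, List.mem_map] at hv
  obtain ⟨y, hy, rfl⟩ := hv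
  obtain ⟨S, hS, rfl⟩ := h.1 y hy
  refine Finset.mem_image.2 ⟨(I.rest xs S).toFinset, Finset.mem_filter.2 ⟨?_, ?_⟩, ?_⟩
  · rw [Finset.mem_powerset]
    intro e he
    rw [List.mem_toFinset] at he ⊢
    exact (mem_rest.1 he).1
  · simpa [DownClosed] using hS
  · rw [fst_entry]
    refine congrArg (fun l => Val.list (List.map encPair l)) (List.filter_congr fun e he => ?_)
    simp [mem_rest, he]

theorem expansions_spec {ρ : Fin n} {tbl : Val} (h : I.IsTable ρ xs tbl) :
    ∀ v ∈ (Val.expansions I.encTree I.encCosts (.nat ρ) tbl).toList,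
      ∃ S, DownClosed I.tree ρ {e | e ∈ xs} {e | e ∈ I.rest xs S} ∧ v = I.entry xs S := by
  intro v hv
  obtain ⟨y, hy, k, hk, huse, rfl⟩ := PolyTime.mem_expansions.1 hv
  obtain ⟨o, rfl⟩ := mem_encCosts.1 hk
  obtain ⟨S, hS, rfl⟩ := h.1 y hy
  exact ⟨o :: S, downClosed_cons hxs hS ((useful_entry hxs).1 huse), extend_entry hxs S o⟩

theorem IsTable.round {ρ : Fin n} {tbl : Val} (B : Val) (h : I.IsTable ρ xs tbl) :
    I.IsTable ρ xs (Val.round B I.encTree I.encCosts (.nat ρ) tbl) := by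
  unfold Val.round Val.ite
  split_ifs
  · exact (insertSols_spec _ h (expansions_spec hxs h)).1
  · simp [IsTable, Val.toList]

omit hxs in
theorem isTable_start (ρ : Fin n) :
    I.IsTable ρ xs (.pair (.pair (.list (xs.map encPair)) (.pair (.real 0) .nil)) .nil) := by
  have h : I.rest xs [] = xs := by simp [rest]
  have h' : Val.pair (.list (xs.map encPair)) (.pair (.real 0) .nil) = I.entry xs [] := by
    simp [entry, h, listCost, encLinks, Val.list]
  rw [h']
  refine ⟨fun v hv => ⟨[], ?_, ?_⟩, ?_⟩
  · rw [h]
    exact fun f _ g hg _ => hg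
  · simpa [Val.toList] using hv
  · simp [Val.toList]

theorem isTable_table (B : Val) (ρ : Fin n) :
    I.IsTable ρ xs (Val.table B I.encTree I.encCosts (.nat ρ) (.list (xs.map encPair))) := by
  unfold Val.table
  generalize (Val.list (xs.map encPair)).toList = l
  induction l using List.reverseRecOn with
  | nil => exact isTable_start ρ
  | append_singleton l x ih =>
    rw [List.foldl_append]
    exact ih.round hxs B

/-- Follow a cover C. The invariant is an entry that costs at most a subset C₀ of C and leaves only
edges that no original link of C₀ covers. If edges remain, a topmost one is covered by some k in C,
which cannot be in C₀. Extending by the original link of k, and passing to an entry dominating the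
result, restores the invariant with k added to C₀. The remainder shrinks in every round, so the
rounds suffice. -/
theorem exists_entry_of_covers {ρ : Fin n} (hnd : xs.Nodup) {B : Val}
    (hB : (xs.length + 1) ^ {e | e ∈ {e | e ∈ xs} ∧ ∀ f ∈ {e | e ∈ xs},
      (∃ p ∈ f, Sep I.tree e ρ p) → f = e}.ncard ≤ B.toList.length)
    {C : Finset I.Link} (hC : I.Covers C {e | e ∈ xs}) (hc : ∀ o ∈ I.origLinks, 0 ≤ I.cost o) :
    ∃ S, I.entry xs S ∈ (Val.table B I.encTree I.encCosts (.nat ρ) (.list (xs.map encPair))).toList ∧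
      I.rest xs S = [] ∧ I.listCost S ≤ I.setCost C := by
  have key : ∀ (l : List Val) (tbl : Val), tbl = l.foldl (fun acc _ =>
      Val.round B I.encTree I.encCosts (.nat ρ) acc)
        (Val.pair (.pair (.list (xs.map encPair)) (.pair (.real 0) .nil)) .nil) →
      I.IsTable ρ xs tbl ∧ ∃ C₀ ⊆ C, ∃ S, I.entry xs S ∈ tbl.toList ∧
        (∀ e ∈ I.rest xs S, ∀ k ∈ C₀, e ∉ pathEdges I.tree k.1.1) ∧
        I.listCost S ≤ I.setCost C₀ ∧ (I.rest xs S = [] ∨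
          (I.rest xs S).length + l.length ≤ xs.length) := by
    intro l
    induction l using List.reverseRecOn with
    | nil =>
      rintro _ rfl
      refine ⟨isTable_start ρ, ∅, by simp, [], ?_, by simp, by simp [listCost, setCost], .inr ?_⟩
      · simp [Val.toList, entry, rest, listCost, encLinks, Val.list]
      · simp [rest]
    | append_singleton l x ih =>
      rintro _ rfl
      obtain ⟨htab, C₀, hC₀, S, hS, hunc, hcost, hlen⟩ := ih _ rfl
      simp only [List.foldl_append, List.foldl_cons, List.foldl_nil, List.length_append,
        List.length_singleton]
      generalize l.foldl (fun acc _ => Val.round B I.encTree I.encCosts (.nat ρ) acc)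
        (Val.pair (.pair (.list (xs.map encPair)) (.pair (.real 0) .nil)) .nil) = tbl at htab hS ⊢
      have hins := insertSols_spec _ htab (expansions_spec hxs htab)
      -- By `hB`, the table never exceeds the cap.
      have hround : Val.round B I.encTree I.encCosts (.nat ρ) tbl =
          (Val.expansions I.encTree I.encCosts (.nat ρ) tbl).toList.foldl
            (fun acc x => Val.insertSol x acc) tbl := by
        unfold Val.round Val.ite
        rw [if_pos]
        exact Val.lenLe_iff.2 ((hins.1.length_le hxs).trans hB)
      rw [hround]
      refine ⟨hins.1, ?_⟩
      by_cases hnil : I.rest xs S = []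
      · obtain ⟨S', h1, h2, h3⟩ := hins.2 S (.inl ⟨S, hS, List.Subset.refl _, le_rfl⟩)
        rw [hnil, List.subset_nil] at h2
        exact ⟨C₀, hC₀, S', h1, by simp [h2], h3.trans hcost, .inl h2⟩
      · obtain ⟨e, he, htop⟩ := exists_topmost I.isTree
          (fun e he => hxs e (mem_rest.1 he).1) hnil ρ
        obtain ⟨k, hk, hek⟩ := hC e (mem_rest.1 he).1
        -- The original link covers whatever its shadow k covers, at the same cost.
        have heo : e ∈ pathEdges I.tree k.1.1 := k.2.2 hek
        have hkC₀ : k ∉ C₀ := fun h => hunc e he k h heo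
        let o : I.OrigLink := ⟨k.1.1, k.2.1⟩
        have hmem : I.entry xs (o :: S) ∈ (Val.expansions I.encTree I.encCosts (.nat ρ) tbl).toList :=
          PolyTime.mem_expansions.2 ⟨_, hS, _, mem_encCosts.2 ⟨o, rfl⟩,
            (useful_entry hxs).2 ⟨e, he, heo, htop⟩, (extend_entry hxs S o).symm⟩
        obtain ⟨S', h1, h2, h3⟩ := hins.2 (o :: S) (.inr hmem)
        refine ⟨insert k C₀, Finset.insert_subset hk hC₀, S', h1, fun f hf k' hk' => ?_, ?_, .inr ?_⟩
        · have hf' := h2 hf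
          rw [rest_cons, List.mem_filter, decide_eq_true_eq] at hf'
          rcases Finset.mem_insert.1 hk' with rfl | hk'
          · exact hf'.2
          · exact hunc f hf'.1 k' hk'
        · refine h3.trans ?_
          rw [setCost, Finset.sum_insert hkC₀]
          rw [listCost, List.map_cons, List.sum_cons]
          exact add_le_add_right hcost _
        · have hlt : (I.rest xs (o :: S)).length < (I.rest xs S).length := by
            rw [rest_cons, List.length_filter_lt_length_iff_exists]
            exact ⟨e, he, by simpa using heo⟩
          have hle : (I.rest xs S').length ≤ (I.rest xs (o :: S)).length :=
            ((hnd.filter _).subperm h2).length_le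
          have := hlen.resolve_left hnil
          lia
  obtain ⟨-, C₀, hC₀, S, hS, -, hcost, hlen⟩ := key (Val.list (xs.map encPair)).toList _ rfl
  refine ⟨S, hS, ?_, hcost.trans ?_⟩
  · rw [Val.toList_list, List.length_map] at hlen
    exact hlen.elim id fun h => List.eq_nil_of_length_eq_zero (by lia)
  · exact Finset.sum_le_sum_of_subset_of_nonneg hC₀ fun k _ _ => hc _ k.2.1

omit hxs in
theorem exists_solution_eq_fst (B E C a X : Val) : ∃ l : List Val,
    Val.solution B E C a X = (Val.list l).fst ∧
      ∀ v, v ∈ l ↔ v ∈ (Val.table B E C a X).toList ∧ v.fst = .nil :=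
  ⟨_, rfl, fun v => by rw [List.mem_filter, decide_eq_true_eq]⟩

/-- No bound on B is involved: too small a table may lose solutions, but what is found is a cover.
So the candidates are correct also for nodes that are not centers. -/
theorem solution_eq (B : Val) (ρ : Fin n) :
    Val.solution B I.encTree I.encCosts (.nat ρ) (.list (xs.map encPair)) = .nil ∨
    ∃ S, I.rest xs S = [] ∧
      Val.solution B I.encTree I.encCosts (.nat ρ) (.list (xs.map encPair)) = I.entry xs S := by
  obtain ⟨l, h1, h2⟩ := exists_solution_eq_fst B I.encTree I.encCosts (.nat ρ)
    (.list (xs.map encPair))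
  rw [h1]
  rcases l with _ | ⟨v, l⟩
  · exact .inl rfl
  · obtain ⟨hv, hv'⟩ := (h2 v).1 (by simp)
    obtain ⟨S, -, rfl⟩ := (isTable_table hxs B ρ).1 v hv
    exact .inr ⟨S, fst_entry_eq_nil.1 hv', rfl⟩

theorem exists_solution_eq_of_covers {ρ : Fin n} (hnd : xs.Nodup) {B : Val}
    (hB : (xs.length + 1) ^ {e | e ∈ {e | e ∈ xs} ∧ ∀ f ∈ {e | e ∈ xs},
      (∃ p ∈ f, Sep I.tree e ρ p) → f = e}.ncard ≤ B.toList.length)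
    {C : Finset I.Link} (hC : I.Covers C {e | e ∈ xs}) (hc : ∀ o ∈ I.origLinks, 0 ≤ I.cost o) :
    ∃ S, I.rest xs S = [] ∧ I.listCost S ≤ I.setCost C ∧
      Val.solution B I.encTree I.encCosts (.nat ρ) (.list (xs.map encPair)) = I.entry xs S := by
  obtain ⟨S, hS, hnil, hcost⟩ := exists_entry_of_covers hxs hnd hB hC hc
  refine ⟨S, hnil, hcost, ?_⟩
  obtain ⟨l, h1, h2⟩ := exists_solution_eq_fst B I.encTree I.encCosts (.nat ρ)
    (.list (xs.map encPair))
  rw [h1]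
  have hmem := (h2 _).2 ⟨hS, fst_entry_eq_nil.2 hnil⟩
  rcases l with _ | ⟨v, l⟩
  · simp at hmem
  · obtain ⟨hv, hv'⟩ := (h2 v).1 (by simp)
    -- Remainders in a table are distinct, so only one entry has the empty remainder; hence the
    -- first one found is the cheap one.
    exact List.inj_on_of_nodup_map (isTable_table hxs B ρ).2 hv hS
      (hv'.trans (fst_entry_eq_nil.2 hnil).symm)

end Instance

end

end TreeAug

/-! ### From solutions for the branches to a cover of T. -/

namespace TreeAug

open SimpleGraph

noncomputable section

open scoped Classical

/-! ### Combining the solutions for the branches -/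

namespace Val

theorem exists_cheapest {l : List Val} (hl : ∀ v ∈ l, ∃ t w, v = pair (real t) w) (hne : l ≠ []) :
    ∃ t w, pair (real t) w ∈ l ∧ cheapest (list l) = pair (real t) w ∧
      ∀ t' w', pair (real t') w' ∈ l → t ≤ t' := by
  unfold cheapest
  rw [toList_list]
  induction l using List.reverseRecOn with
  | nil => exact absurd rfl hne
  | append_singleton l v ih =>
    rw [List.foldl_append]
    simp only [List.foldl_cons, List.foldl_nil]
    obtain ⟨t₀, w₀, rfl⟩ := hl v (by simp)
    rcases eq_or_ne l [] with rfl | hl0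
    · refine ⟨t₀, w₀, by simp, by simp [ite], ?_⟩
      intro t' w' h
      simp only [List.nil_append, List.mem_singleton, pair.injEq, real.injEq] at h
      exact h.1.ge
    · obtain ⟨t, w, hmem, heq, hmin⟩ := ih (fun v hv => hl v (by simp [hv])) hl0
      rw [heq]
      have hite : ite (pair (real t) w = nil ∨ ((pair (real t₀) w₀).fst.pair
          (pair (real t) w).fst).le ≠ nil) (pair (real t₀) w₀) (pair (real t) w) =
          if t₀ ≤ t then pair (real t₀) w₀ else pair (real t) w := by
        unfold ite
        by_cases h : t₀ ≤ t <;> simp [fst, le, h]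
      rw [hite]
      split_ifs with h
      · refine ⟨t₀, w₀, by simp, rfl, fun t' w' h' => ?_⟩
        simp only [List.mem_append, List.mem_singleton, pair.injEq, real.injEq] at h'
        rcases h' with h' | h'
        · exact h.trans (hmin t' w' h')
        · exact h'.1.ge
      · refine ⟨t, w, by simp [hmem], rfl, fun t' w' h' => ?_⟩
        simp only [List.mem_append, List.mem_singleton, pair.injEq, real.injEq] at h'
        rcases h' with h' | h'
        · exact hmin t' w' h'
        · exact h'.1 ▸ (not_le.1 h).le

end Val

namespace Instance

variable {n : ℕ} {I : Instance n}

theorem setCost_toSet_le (hc : ∀ o ∈ I.origLinks, 0 ≤ I.cost o) (S : List I.OrigLink) :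
    I.setCost (I.toSet (S.map I.ofOrig)) ≤ I.listCost S := by
  induction S with
  | nil => simp [setCost, toSet, listCost]
  | cons o S ih =>
    rw [toSet, List.map_cons, List.toFinset_cons, listCost, List.map_cons, List.sum_cons]
    by_cases h : I.ofOrig o ∈ (S.map I.ofOrig).toFinset
    · rw [Finset.insert_eq_of_mem h]
      exact ih.trans (le_add_of_nonneg_left (hc _ o.2))
    · rw [setCost, Finset.sum_insert h]
      exact add_le_add_right ih _

theorem union_entries {α : Type*} (l : List α) (xs : α → List (Sym2 (Fin n)))
    (S : α → List I.OrigLink) :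
    Val.union (.list (l.map fun f => I.entry (xs f) (S f))) =
      .pair (.real (l.map fun f => I.listCost (S f)).sum)
        (I.encLinks ((l.flatMap S).map I.ofOrig)) := by
  unfold Val.union
  rw [Val.toList_list]
  congr 1
  · induction l using List.reverseRecOn with
    | nil => simp
    | append_singleton l f ih =>
      rw [List.map_append, List.foldl_append, ih, List.map_append, List.sum_append]
      simp [entry, Val.fst, Val.snd, Val.add]
  · rw [encLinks]
    congr 1
    induction l with
    | nil => rfl
    | cons f l ih =>
      rw [List.map_cons, List.flatMap_cons, ih, List.flatMap_cons, List.map_append, List.map_append]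
      exact congrArg (· ++ _) (Val.toList_list _)

variable {x : I.Link → ℝ} {ε : ℝ} {T : Set (I.Node x ε)} {r : I.Node x ε} {ρ : Fin n}

/-- The edges between the nodes of `T`. -/
def edgeListOf (I : Instance n) (x : I.Link → ℝ) (ε : ℝ) (T : Set (I.Node x ε)) :
    List (Sym2 (Fin n)) :=
  I.edgeList.filter fun e => decide (e ∈ I.edgesOf x ε T)

/-- The edges of `T` at the node `r`. -/
def rootEdges (I : Instance n) (x : I.Link → ℝ) (ε : ℝ) (T : Set (I.Node x ε)) (r : I.Node x ε) :
    List (Sym2 (Fin n)) :=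
  (I.edgeListOf x ε T).filter fun f => decide (∃ p ∈ f, I.node x ε p = r)

/-- The edges of `T` that are equal to `f` or beyond `f`. -/
def branchEdges (I : Instance n) (x : I.Link → ℝ) (ε : ℝ) (T : Set (I.Node x ε)) (ρ : Fin n)
    (f : Sym2 (Fin n)) : List (Sym2 (Fin n)) :=
  (I.edgeListOf x ε T).filter fun e => decide (∃ p ∈ e, Sep I.tree f ρ p)

theorem mem_edgeListOf {e : Sym2 (Fin n)} : e ∈ I.edgeListOf x ε T ↔ e ∈ I.edgesOf x ε T := by
  rw [edgeListOf, List.mem_filter, decide_eq_true_eq, mem_edgeList]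
  exact and_iff_right_of_imp fun h => edgesOf_subset h

theorem mem_rootEdges {f : Sym2 (Fin n)} : f ∈ I.rootEdges x ε T r ↔
    f ∈ I.edgesOf x ε T ∧ ∃ p ∈ f, I.node x ε p = r := by
  rw [rootEdges, List.mem_filter, decide_eq_true_eq, mem_edgeListOf]

theorem mem_branchEdges {e f : Sym2 (Fin n)} : e ∈ I.branchEdges x ε T ρ f ↔
    e ∈ I.edgesOf x ε T ∧ ∃ p ∈ e, Sep I.tree f ρ p := by
  rw [branchEdges, List.mem_filter, decide_eq_true_eq, mem_edgeListOf]

theorem mem_edgeSet_of_mem_branchEdges {e f : Sym2 (Fin n)} (h : e ∈ I.branchEdges x ε T ρ f) :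
    e ∈ I.tree.edgeSet := edgesOf_subset (mem_branchEdges.1 h).1

theorem nodup_branchEdges (f : Sym2 (Fin n)) : (I.branchEdges x ε T ρ f).Nodup :=
  (nodup_edgeList.filter _).filter _

theorem length_edgeList_add_one : I.edgeList.length + 1 = n := by
  have h := I.isTree.card_edgeFinset
  rw [Fintype.card_fin] at h
  have h' : I.edgeList.toFinset = I.tree.edgeFinset := by
    ext e
    simp [mem_edgeList]
  rwa [← List.toFinset_card_of_nodup nodup_edgeList, h']

theorem length_branchEdges_le (f : Sym2 (Fin n)) : (I.branchEdges x ε T ρ f).length + 1 ≤ n := by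
  have h1 : (I.branchEdges x ε T ρ f).length ≤ (I.edgeListOf x ε T).length :=
    List.length_filter_le _ _
  have h2 : (I.edgeListOf x ε T).length ≤ I.edgeList.length := List.length_filter_le _ _
  have := I.length_edgeList_add_one
  lia

/-- The code of the nodes in `T`. -/
def encNodes (I : Instance n) (x : I.Link → ℝ) (ε : ℝ) (T : Set (I.Node x ε)) : Val :=
  .list ((I.nodeList x ε T).map (I.encNode x ε))

theorem solutions_eq (B : Val) (hρ : (I.encNode x ε r).fst = .nat ρ) :
    Val.solutions B I.encTree I.encCosts (I.encNodes x ε T) (I.encNode x ε r) =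
      .list ((I.rootEdges x ε T r).map fun f =>
        Val.solution B I.encTree I.encCosts (.nat ρ)
          (.list ((I.branchEdges x ε T ρ f).map encPair))) := by
  rw [Val.solutions, encNodes, edgesBetween_eq, Val.filter_list_map, Val.toList_list, List.map_map,
    hρ]
  refine congrArg Val.list (congrArg₂ List.map (funext fun f => ?_) (List.filter_congr fun f _ => ?_))
  · rw [Function.comp_apply, Val.filter_list_map]
    refine congrArg (fun l => Val.solution B I.encTree I.encCosts (.nat ρ)
      (Val.list (List.map encPair l))) (List.filter_congr fun e _ => ?_)
    rw [decide_eq_decide, beyond_iff]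
  · obtain ⟨a, b, rfl, h1, h2⟩ := Val.exists_ends f
    rw [decide_eq_decide, h1, h2, nodeMem_iff, nodeMem_iff]
    simp only [Sym2.mem_iff, or_and_right, exists_or, exists_eq_left]

section RootEdges

variable (hT : ((I.contracted x ε).induce T).Preconnected) (hr : r ∈ T) (hρ : I.node x ε ρ = r)
include hT hr

theorem exists_isRootEdge_of_mem {f : Sym2 (Fin n)} (hf : f ∈ I.rootEdges x ε T r) :
    ∃ K a b, f = s(a, b) ∧ I.IsRootEdge x ε T r K a b := by
  obtain ⟨hfT, b, hb, hbr⟩ := mem_rootEdges.1 hf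
  obtain ⟨a, rfl⟩ := Sym2.mem_iff_exists.1 hb
  have haT := node_mem_of_mem_edgesOf hfT (Sym2.mem_mk_right b a)
  have hne : I.node x ε a ≠ r := by
    obtain ⟨p, q, hpq, -, hne, -⟩ := hfT
    rcases Sym2.eq_iff.1 hpq with ⟨rfl, rfl⟩ | ⟨rfl, rfl⟩
    · exact fun h => hne (hbr.trans h.symm)
    · exact fun h => hne (h.trans hbr.symm)
  obtain ⟨K, hK, haK⟩ := exists_mem_branches (H := I.contracted x ε) haT hne
  have hadj : I.tree.Adj b a := edgesOf_subset hfT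
  exact ⟨K, a, b, Sym2.eq_swap, hT, hr, hK, hadj.symm, haK, hbr⟩

include hρ

theorem exists_mem_branchEdges {e : Sym2 (Fin n)} (he : e ∈ I.edgesOf x ε T) :
    ∃ f ∈ I.rootEdges x ε T r, e ∈ I.branchEdges x ε T ρ f := by
  obtain ⟨p, hp, hpr⟩ : ∃ p ∈ e, I.node x ε p ≠ r := by
    obtain ⟨p, q, rfl, -, hne, -⟩ := id he
    by_cases h : I.node x ε p = r
    · exact ⟨q, by simp, fun h' => hne (h.trans h'.symm)⟩
    · exact ⟨p, by simp, h⟩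
  obtain ⟨K, hK, hpK⟩ := exists_mem_branches (H := I.contracted x ε)
    (node_mem_of_mem_edgesOf he hp) hpr
  obtain ⟨a, b, h⟩ := exists_isRootEdge hT hr hK
  refine ⟨s(a, b), mem_rootEdges.2 ⟨edgesOf_mono h.subset h.mem_edgesOf, b, by simp, h.node_eq⟩,
    mem_branchEdges.2 ⟨he, p, hp, ((h.mem_iff hρ).1 hpK).2⟩⟩

omit hT hr in
theorem IsRootEdge.setOf_branchEdges {K : Set (I.Node x ε)} {a b : Fin n}
    (h : I.IsRootEdge x ε T r K a b) :
    {e | e ∈ I.branchEdges x ε T ρ s(a, b)} = I.edgesOf x ε (insert r K) := by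
  ext e
  exact mem_branchEdges.trans (h.mem_edgesOf_iff hρ).symm

/-- Different edges at the root lead to different branches. -/
theorem sum_rootEdges_le (F : Set (I.Node x ε) → ℝ)
    (hF : ∀ K ∈ branches (I.contracted x ε) T r, 0 ≤ F K) (g : Sym2 (Fin n) → ℝ)
    (hg : ∀ K a b, I.IsRootEdge x ε T r K a b → g s(a, b) ≤ F K) :
    ((I.rootEdges x ε T r).map g).sum ≤ ∑ K ∈ (branches (I.contracted x ε) T r).toFinset, F K := by
  have h : ∀ f, ∃ K, f ∈ I.rootEdges x ε T r → ∃ a b, f = s(a, b) ∧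
      I.IsRootEdge x ε T r K a b := by
    intro f
    by_cases hf : f ∈ I.rootEdges x ε T r
    · obtain ⟨K, hK⟩ := exists_isRootEdge_of_mem hT hr hf
      exact ⟨K, fun _ => hK⟩
    · exact ⟨∅, fun h => absurd h hf⟩
  choose K hK using h
  have hnd : (I.rootEdges x ε T r).Nodup := (nodup_edgeList.filter _).filter _
  rw [← List.sum_toFinset g hnd]
  have hinj : Set.InjOn K ((I.rootEdges x ε T r).toFinset : Set (Sym2 (Fin n))) := by
    intro f hf f' hf' hKf
    rw [Finset.mem_coe, List.mem_toFinset] at hf hf'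
    -- If two root edges lead to the same branch, each is equal to or beyond the other; comparing
    -- weights turns this into equality.
    have key : ∀ f ∈ I.rootEdges x ε T r, ∀ f' ∈ I.rootEdges x ε T r, K f = K f' →
        weight I.tree ρ f ≤ weight I.tree ρ f' → f = f' := by
      intro f hf f' hf' hKf hw
      obtain ⟨a, b, hab, h⟩ := hK f hf
      obtain ⟨a', b', hab', h'⟩ := hK f' hf'
      refine eq_of_weight_le I.isTree (hab ▸ h.adj) (hab' ▸ h'.adj) ?_ hw
      have := h'.mem_edgesOf
      rw [← hKf, h.mem_edgesOf_iff hρ] at this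
      rw [hab, hab']
      exact this.2
    rcases le_total (weight I.tree ρ f) (weight I.tree ρ f') with hw | hw
    · exact key f hf f' hf' hKf hw
    · exact (key f' hf' f hf hKf.symm hw).symm
  refine (Finset.sum_le_sum (g := fun f => F (K f)) fun f hf => ?_).trans ?_
  · obtain ⟨a, b, hab, h⟩ := hK f (List.mem_toFinset.1 hf)
    conv_lhs => rw [hab]
    exact hg _ a b h
  · rw [← Finset.sum_image hinj]
    refine Finset.sum_le_sum_of_subset_of_nonneg ?_ fun K hK _ => hF K (Set.mem_toFinset.1 hK)
    intro L hL
    obtain ⟨f, hf, rfl⟩ := Finset.mem_image.1 hL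
    obtain ⟨a, b, -, h⟩ := hK f (List.mem_toFinset.1 hf)
    exact Set.mem_toFinset.2 h.branch

end RootEdges

/-- The branches are disjoint subsets of T, so no node is charged twice. -/
theorem sum_chargeOn_le (hc : ∀ o ∈ I.origLinks, 0 ≤ I.cost o) (L₀ : Finset I.Link) :
    ∑ K ∈ (branches (I.contracted x ε) T r).toFinset, I.chargeOn x ε L₀ K ≤ I.chargeOn x ε L₀ T := by
  unfold chargeOn
  rw [← Finset.sum_biUnion]
  · refine Finset.sum_le_sum_of_subset_of_nonneg (fun u hu => ?_) fun u _ _ => charge_nonneg hc L₀ u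
    obtain ⟨K, hK, hu⟩ := Finset.mem_biUnion.1 hu
    rw [Finset.mem_filter] at hu ⊢
    exact ⟨hu.1, branch_subset (Set.mem_toFinset.1 hK) hu.2⟩
  · intro K hK K' hK' hne
    refine Finset.disjoint_left.2 fun u hu hu' => hne ?_
    rw [Finset.mem_filter] at hu hu'
    rw [Finset.mem_coe, Set.mem_toFinset] at hK hK'
    exact branch_eq_of_mem hK hK' hu.2 hu'.2

/-- Every candidate is a cover of the edges of `T`. -/
theorem exists_of_mem_candidates (hT : ((I.contracted x ε).induce T).Preconnected) {B v : Val}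
    (hv : v ∈ (Val.candidates B I.encTree I.encCosts (I.encNodes x ε T)).toList) :
    ∃ S, v = .pair (.real (I.listCost S)) (I.encLinks (S.map I.ofOrig)) ∧
      I.Covers (I.toSet (S.map I.ofOrig)) (I.edgesOf x ε T) := by
  rw [Val.candidates, Val.toList_list, List.mem_map] at hv
  obtain ⟨A, hA, rfl⟩ := hv
  rw [Val.mem_filter] at hA
  obtain ⟨hA, hne⟩ := hA
  rw [encNodes, Val.toList_list, List.mem_map] at hA
  obtain ⟨r, hr, rfl⟩ := hA
  rw [mem_nodeList] at hr
  obtain ⟨ρ, hρ, hρ'⟩ := exists_fst_encNode (I := I) (x := x) (ε := ε) r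
  rw [solutions_eq B hρ', Val.toList_list] at hne
  have h : ∀ f, ∃ S, f ∈ I.rootEdges x ε T r → I.rest (I.branchEdges x ε T ρ f) S = [] ∧
      Val.solution B I.encTree I.encCosts (.nat ρ) (.list ((I.branchEdges x ε T ρ f).map encPair)) =
        I.entry (I.branchEdges x ε T ρ f) S := by
    intro f
    by_cases hf : f ∈ I.rootEdges x ε T r
    · obtain ⟨S, hS⟩ := (solution_eq (fun e => mem_edgeSet_of_mem_branchEdges) B ρ).resolve_left
        (hne _ (List.mem_map_of_mem hf))
      exact ⟨S, fun _ => hS⟩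
    · exact ⟨[], fun h => absurd h hf⟩
  choose S hS using h
  refine ⟨(I.rootEdges x ε T r).flatMap S, ?_, fun e he => ?_⟩
  · rw [solutions_eq B hρ', List.map_congr_left fun f hf => (hS f hf).2, union_entries]
    congr 2
    generalize I.rootEdges x ε T r = l
    induction l with
    | nil => simp [listCost]
    | cons f l ih => rw [List.map_cons, List.sum_cons, ih]; simp [listCost]
  · obtain ⟨f, hf, hef⟩ := exists_mem_branchEdges hT hr hρ he
    have hrest : e ∉ I.rest (I.branchEdges x ε T ρ f) (S f) := by simp [(hS f hf).1]
    rw [mem_rest] at hrest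
    push Not at hrest
    obtain ⟨o, ho, heo⟩ := hrest hef
    refine ⟨I.ofOrig o, ?_, heo⟩
    rw [toSet, List.mem_toFinset]
    exact List.mem_map_of_mem (List.mem_flatMap.2 ⟨f, hf, ho⟩)

/-- If the table may be long enough for the branches at `r`, then there is a candidate for `r`. -/
theorem exists_mem_candidates (hT : ((I.contracted x ε).induce T).Preconnected) (hr : r ∈ T)
    (hc : ∀ o ∈ I.origLinks, 0 ≤ I.cost o) (hcov : I.Covers Finset.univ I.tree.edgeSet) {B : Val}
    (hB : ∀ K ∈ branches (I.contracted x ε) T r,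
      n ^ (leafCount (I.contracted x ε) K + 1) ≤ B.toList.length) :
    ∃ t w, .pair (.real t) w ∈ (Val.candidates B I.encTree I.encCosts (I.encNodes x ε T)).toList ∧
      ∀ F : Set (I.Node x ε) → ℝ, (∀ K ∈ branches (I.contracted x ε) T r, 0 ≤ F K) →
        (∀ K ∈ branches (I.contracted x ε) T r, I.opt (I.edgesOf x ε (insert r K)) ≤ F K) →
        t ≤ ∑ K ∈ (branches (I.contracted x ε) T r).toFinset, F K := by
  obtain ⟨ρ, hρ, hρ'⟩ := exists_fst_encNode (I := I) (x := x) (ε := ε) r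
  have hn : 0 < n := ρ.pos
  have h : ∀ f, ∃ S, f ∈ I.rootEdges x ε T r →
      I.listCost S ≤ I.opt {e | e ∈ I.branchEdges x ε T ρ f} ∧
      Val.solution B I.encTree I.encCosts (.nat ρ) (.list ((I.branchEdges x ε T ρ f).map encPair)) =
        I.entry (I.branchEdges x ε T ρ f) S := by
    intro f
    by_cases hf : f ∈ I.rootEdges x ε T r
    · obtain ⟨K, a, b, hab, h⟩ := exists_isRootEdge_of_mem hT hr hf
      have hset : {e | e ∈ I.branchEdges x ε T ρ f} = I.edgesOf x ε (insert r K) :=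
        hab ▸ h.setOf_branchEdges hρ
      obtain ⟨C, hC, hCopt⟩ := exists_setCost_eq_opt (X := {e | e ∈ I.branchEdges x ε T ρ f})
        fun e he => hcov e (mem_edgeSet_of_mem_branchEdges he)
      obtain ⟨S, -, h1, h2⟩ := exists_solution_eq_of_covers (ρ := ρ) (B := B)
        (fun e => mem_edgeSet_of_mem_branchEdges) (nodup_branchEdges f) (by
          rw [hset]
          exact (Nat.pow_le_pow_left (length_branchEdges_le f) _).trans
            ((Nat.pow_le_pow_right hn (h.ncard_lowest_le hρ)).trans (hB K h.branch))) hC hc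
      exact ⟨S, fun _ => ⟨hCopt ▸ h1, h2⟩⟩
    · exact ⟨[], fun h => absurd h hf⟩
  choose S hS using h
  have hsol : Val.solutions B I.encTree I.encCosts (I.encNodes x ε T) (I.encNode x ε r) =
      .list ((I.rootEdges x ε T r).map fun f => I.entry (I.branchEdges x ε T ρ f) (S f)) := by
    rw [solutions_eq B hρ', List.map_congr_left fun f hf => (hS f hf).2]
  refine ⟨((I.rootEdges x ε T r).map fun f => I.listCost (S f)).sum,
    I.encLinks (((I.rootEdges x ε T r).flatMap S).map I.ofOrig), ?_, fun F hF hopt => ?_⟩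
  · rw [Val.candidates, Val.toList_list, List.mem_map]
    refine ⟨I.encNode x ε r, Val.mem_filter.2 ⟨?_, ?_⟩, ?_⟩
    · rw [encNodes, Val.toList_list]
      exact List.mem_map_of_mem (mem_nodeList.2 hr)
    · rw [hsol, Val.toList_list]
      intro v hv
      obtain ⟨f, -, rfl⟩ := List.mem_map.1 hv
      simp [entry]
    · rw [hsol]
      exact union_entries _ (I.branchEdges x ε T ρ) S
  · refine sum_rootEdges_le hT hr hρ F hF _ fun K a b h => ?_
    have hf : s(a, b) ∈ I.rootEdges x ε T r :=
      mem_rootEdges.2 ⟨edgesOf_mono h.subset h.mem_edgesOf, b, by simp, h.node_eq⟩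
    refine (hS _ hf).1.trans ?_
    rw [h.setOf_branchEdges hρ]
    exact hopt K h.branch

/-- The set S is the cheapest candidate, hence its bound holds for all centers and all L₀ at once. A
center's own candidate costs at most the sum over the branches of any upper bounds on OPT. The bound
`costMeeting` plus charge serves in both cases of `isBundle_or_opt_le`. -/
theorem algorithm_spec {M γ : ℕ} (hε : 0 < ε) (hM : 1 ≤ M)
    (hc : ∀ o ∈ I.origLinks, 1 ≤ I.cost o ∧ I.cost o ≤ M) (hγ : 200 * (M : ℝ) / ε ^ 2 ≤ γ)
    (hx : I.IsFeasible γ x) {z : Sym2 (Fin n) × Sym2 (I.Node x ε) → ℝ} (hz : I.IsPart M ε x T z)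
    (hroot : ∃ r, I.IsRoot M ε x T z r) {B : Val} {b : ℕ} (hb : 48 / ε ^ 2 ≤ b)
    (hB : B.toList.length = n ^ (b * M + 1)) :
    ∃ S, Val.algorithm B I.encTree I.encCosts (I.encNodes x ε T) = I.encLinks S ∧
      I.Covers (I.toSet S) (I.edgesOf x ε T) ∧
      ∀ L₀ : Finset I.Link, I.Covers L₀ (I.heavy x ε) → ∀ r, I.IsRoot M ε x T z r →
        I.setCost (I.toSet S) ≤ totalCost I.cost (inPart (I.contracted x ε) T r z) +
          2 * totalCost I.cost (crossPart (I.contracted x ε) T r z) + I.chargeOn x ε L₀ T := by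
  have hc0 : ∀ o ∈ I.origLinks, 0 ≤ I.cost o := fun o ho => zero_le_one.trans (hc o ho).1
  obtain ⟨φ, hφ⟩ := exists_isImage hx.nonneg hz
  have hT := hφ.connected
  -- The cut constraints guarantee that all links together are a cover, so OPT is attained.
  have hcov : I.Covers Finset.univ I.tree.edgeSet := by
    intro e he
    have h := hx.cut e he
    by_contra hne
    push Not at hne
    rw [coverage, Finset.sum_eq_zero (fun l hl => absurd (Finset.mem_filter.1 hl).2
      (hne l (Finset.mem_univ l)))] at h
    linarith
  have hcand : ∀ r, I.IsRoot M ε x T z r → ∃ t w, .pair (.real t) w ∈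
      (Val.candidates B I.encTree I.encCosts (I.encNodes x ε T)).toList ∧
      ∀ F : Set (I.Node x ε) → ℝ, (∀ K ∈ branches (I.contracted x ε) T r, 0 ≤ F K) →
        (∀ K ∈ branches (I.contracted x ε) T r, I.opt (I.edgesOf x ε (insert r K)) ≤ F K) →
        t ≤ ∑ K ∈ (branches (I.contracted x ε) T r).toFinset, F K := by
    intro r hr
    obtain ⟨ρ, -⟩ := I.node_surjective x ε r
    refine exists_mem_candidates hT hr.1 hc0 hcov fun K hK => ?_
    rw [hB]
    refine Nat.pow_le_pow_right ρ.pos (Nat.add_le_add_right ?_ 1)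
    have h1 := (hr.2 K hK).2
    have h2 : (leafCount (I.contracted x ε) K : ℝ) ≤ b * M := by
      refine h1.trans (le_of_eq_of_le (by ring : _ = 48 / ε ^ 2 * (M : ℝ)) ?_)
      exact mul_le_mul_of_nonneg_right hb (Nat.cast_nonneg M)
    exact_mod_cast h2
  have hlist : Val.list (Val.candidates B I.encTree I.encCosts (I.encNodes x ε T)).toList =
      Val.candidates B I.encTree I.encCosts (I.encNodes x ε T) := by
    rw [Val.candidates, Val.toList_list]
  obtain ⟨t, w, hmem, heq, hmin⟩ := Val.exists_cheapest
    (l := (Val.candidates B I.encTree I.encCosts (I.encNodes x ε T)).toList) (fun v hv => by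
      obtain ⟨S, hS, -⟩ := exists_of_mem_candidates hT hv
      exact ⟨_, _, hS⟩) (by
      obtain ⟨r, hr⟩ := hroot
      obtain ⟨t, w, hmem, -⟩ := hcand r hr
      exact List.ne_nil_of_mem hmem)
  obtain ⟨S, hS, hScov⟩ := exists_of_mem_candidates hT hmem
  obtain ⟨rfl, rfl⟩ : t = I.listCost S ∧ w = I.encLinks (S.map I.ofOrig) := by simpa using hS
  refine ⟨S.map I.ofOrig, ?_, hScov, fun L₀ hL₀ r hr => ?_⟩
  · rw [Val.algorithm, ← hlist, heq]
    rfl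
  · obtain ⟨t', w', hmem', hF⟩ := hcand r hr
    have hcm : ∀ K, 0 ≤ costMeeting I.cost z K := fun K =>
      Finset.sum_nonneg fun l _ => hφ.cost_mul_nonneg hc0 l
    refine (setCost_toSet_le hc0 S).trans ((hmin t' w' hmem').trans ((hF
      (fun K => costMeeting I.cost z K + I.chargeOn x ε L₀ K)
      (fun K _ => add_nonneg (hcm K) (chargeOn_nonneg hc0 L₀ K)) fun K hK => ?_).trans ?_))
    · obtain ⟨a, b, h⟩ := exists_isRootEdge hT hr.1 hK
      rcases h.isBundle_or_opt_le hφ hε hM hc hγ hx hL₀ hr with hb | ho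
      · exact ((opt_le_coverCost hx hb).trans (h.coverCost_le_costMeeting hφ hc0 hx.nonneg)).trans
          (le_add_of_nonneg_right (chargeOn_nonneg hc0 L₀ K))
      · exact ho.trans (le_add_of_nonneg_left (hcm K))
    · rw [Finset.sum_add_distrib]
      exact add_le_add (sum_costMeeting_le hφ.nonneg (hφ.cost_nonneg_or hc0))
        (sum_chargeOn_le hc0 L₀)

end Instance

end

end TreeAug

/-! ### The table length, the input size, and the total running time. -/

namespace TreeAug

noncomputable section

open scoped Classical

/-! ### The table length -/

namespace Val

/-- A list whose length is the product of the lengths of `l` and `m`. -/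
def prod (l m : Val) : Val := list (l.toList.flatMap fun _ => m.toList)

/-- A list whose length is the `b`-th power of the length of `l`. -/
def power (l : Val) : ℕ → Val
  | 0 => list [nil]
  | b + 1 => prod l (power l b)

/-- A list of length `n ^ (b * M + 1)`, if `l` and `m` are lists of lengths `n` and `M`. -/
def budget (b : ℕ) (l m : Val) : Val := m.toList.foldl (fun acc _ => prod acc (power l b)) l

theorem length_prod (l m : Val) :
    (prod l m).toList.length = l.toList.length * m.toList.length := by
  simp [prod, toList_list, List.length_flatMap]

theorem length_power (l : Val) (b : ℕ) : (power l b).toList.length = l.toList.length ^ b := by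
  induction b with
  | zero => simp [power, toList_list]
  | succ b ih => rw [power, length_prod, ih, pow_succ']

theorem eq_nil_of_mem_power {l v : Val} (b : ℕ) (h : v ∈ (power l b).toList) : v = nil := by
  induction b with
  | zero => simpa [power, toList_list] using h
  | succ b ih =>
    simp only [power, prod, toList_list, List.mem_flatMap] at h
    obtain ⟨-, -, h⟩ := h
    exact ih h

theorem eq_nil_of_mem_nat {v : Val} {k : ℕ} (h : v ∈ (nat k).toList) : v = nil := by
  induction k with
  | zero => simp [nat, toList] at h
  | succ k ih =>
    simp only [nat, toList, List.mem_cons] at h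
    exact h.elim id ih

theorem length_foldl_prod (l w : Val) (m : List Val) :
    (m.foldl (fun acc _ => prod acc w) l).toList.length =
      l.toList.length * w.toList.length ^ m.length := by
  induction m generalizing l with
  | nil => simp
  | cons x m ih => rw [List.foldl_cons, ih, length_prod, List.length_cons, pow_succ']; ring

theorem length_budget (b n M : ℕ) : (budget b (nat n) (nat M)).toList.length = n ^ (b * M + 1) := by
  rw [budget, length_foldl_prod, length_power, length_toList_nat, length_toList_nat, ← pow_mul,
    pow_succ']

theorem fst_pair (v w : Val) : (pair v w).fst = v := rfl

theorem snd_pair (v w : Val) : (pair v w).snd = w := rfl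

theorem size_nat (k : ℕ) : (nat k).size = 2 * k + 1 := by
  induction k with
  | zero => rfl
  | succ k ih => rw [nat, size, size, ih]; lia

end Val

/-- The inputs for which tables of length `n ^ (b * M + 1)` can be used. -/
def Affordable (b s : ℕ) (v : Val) : Prop :=
  v.size ≤ s ∧ ∃ n M, 1 ≤ n ∧ v.fst = .nat n ∧ v.snd.fst = .nat M ∧ 2 * n ^ (b * M + 1) + 1 ≤ s

namespace PolyTime

theorem prod {f g : Val → Val} (hf : PolyTime SizeLe f) (hg : PolyTime SizeLe g) :
    PolyTime SizeLe fun v => Val.prod (f v) (g v) := flatMap hf hg.up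

theorem power {f : Val → Val} (hf : PolyTime SizeLe f) (b : ℕ) :
    PolyTime SizeLe fun v => Val.power (f v) b := by
  induction b with
  | zero => exact nil.pair nil
  | succ b ih => exact hf.prod ih

/-- The budget is not polynomial in the input, so `Affordable` puts its length into the size
parameter. As 1 ≤ n, partial products are no longer than the final list; all entries are nil, so the
size is twice the length plus one. -/
theorem budget (b : ℕ) : PolyTime (Affordable b) fun v => Val.budget b v.fst v.snd.fst := by
  have hid : PolyTime (Affordable b) fun v => v := id.mono fun _ _ h => h.1
  refine fold (g := fun _ acc v => Val.prod acc (Val.power v.fst b)) (fun _ _ h => h.1) hid.snd.fst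
    hid.fst (id.snd.fst.prod (id.snd.snd.fst.power b)) ⟨fun s => s, .self, ?_⟩
  rintro s hs v ⟨-, n, M, hn, h1, h2, h3⟩ m hm
  rw [h1]
  rw [h2] at hm
  have hlen := hm.length_le
  rw [Val.length_toList_nat] at hlen
  have hnil : ∀ x ∈ (m.foldl (fun acc _ => Val.prod acc (Val.power (.nat n) b)) (.nat n)).toList,
      x = .nil := by
    intro x hx
    rcases List.eq_nil_or_concat m with rfl | ⟨m, y, rfl⟩
    · exact Val.eq_nil_of_mem_nat hx
    · rw [List.concat_eq_append, List.foldl_append] at hx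
      simp only [List.foldl_cons, List.foldl_nil] at hx
      rw [Val.prod, Val.toList_list, List.mem_flatMap] at hx
      obtain ⟨-, -, hx⟩ := hx
      exact Val.eq_nil_of_mem_power b hx
  refine (Val.size_le_sum_toList _).trans (le_trans (Nat.add_le_add_right ?_ 1) h3)
  rw [List.map_congr_left (g := fun _ => 2) fun x hx => by rw [hnil x hx]; rfl]
  rw [List.map_const', List.sum_replicate, Val.length_foldl_prod, Val.length_power,
    Val.length_toList_nat, smul_eq_mul, ← pow_mul, ← pow_succ', mul_comm]
  exact Nat.mul_le_mul_left _ (Nat.pow_le_pow_right hn (by gcongr))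

theorem main (b : ℕ) : PolyTime (Affordable b) fun v => Val.algorithm
    (Val.budget b v.fst v.snd.fst) v.snd.snd.fst v.snd.snd.snd.fst v.snd.snd.snd.snd := by
  have hid : PolyTime (Affordable b) fun v => v := id.mono fun _ _ h => h.1
  have := (algorithm (a := fun w => w.fst) (b := fun w => w.snd.snd.snd.fst)
    (c := fun w => w.snd.snd.snd.snd.fst) (d := fun w => w.snd.snd.snd.snd.snd) id.fst
    id.snd.snd.snd.fst id.snd.snd.snd.snd.fst id.snd.snd.snd.snd.snd).comp ((budget b).pair hid)
  simpa only [Val.fst_pair, Val.snd_pair] using this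

end PolyTime

/-- Removal of the vector `z` from the input. -/
def Prog.project : Prog :=
  .pair .fst (.comp .snd (.pair .fst (.comp .snd (.pair .fst (.comp .snd
    (.pair .fst (.comp .snd .fst)))))))

theorem exists_run_project (v : Val) : ∃ t ≤ 20, Run .project v (.pair v.fst (.pair v.snd.fst
    (.pair v.snd.snd.fst (.pair v.snd.snd.snd.fst v.snd.snd.snd.snd.fst)))) t :=
  ⟨_, by lia, .pair (.fst _) (.comp (.snd _) (.pair (.fst _) (.comp (.snd _) (.pair (.fst _)
    (.comp (.snd _) (.pair (.fst _) (.comp (.snd _) (.fst _))))))))⟩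

/-! ### The size of the input -/

namespace Instance

variable {n : ℕ} {I : Instance n} {x : I.Link → ℝ} {ε : ℝ} {T : Set (I.Node x ε)}

theorem size_encPair_le (s : Sym2 (Fin n)) : (encPair s).size ≤ 4 * n + 3 := by
  obtain ⟨a, b, -, h1, h2⟩ := Val.exists_ends s
  have h : (encPair s).size = (encPair s).fst.size + (encPair s).snd.size + 1 := rfl
  rw [h, h1, h2, Val.size_nat, Val.size_nat]
  have := a.2
  have := b.2
  lia

theorem size_encTree_le : I.encTree.size ≤ n * (4 * n + 4) + 1 := by
  rw [encTree_eq]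
  refine Val.size_list_le ?_ fun v hv => ?_
  · have := I.length_edgeList_add_one
    rw [List.length_map]
    lia
  · obtain ⟨s, -, rfl⟩ := List.mem_map.1 hv
    exact size_encPair_le s

theorem size_encCosts_le : I.encCosts.size ≤ n ^ 2 * (4 * n + 6) + 1 := by
  refine Val.size_list_le ?_ fun v hv => ?_
  · have h := I.length_linkList_le
    rw [List.length_sym2, List.length_finRange, Nat.choose_two_right] at h
    rw [List.length_map]
    refine h.trans ?_
    rw [Nat.add_sub_cancel]
    refine Nat.div_le_of_le_mul ?_
    nlinarith [Nat.le_self_pow (n := 2) (by lia) n]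
  · obtain ⟨s, -, rfl⟩ := List.mem_map.1 hv
    have := size_encPair_le s
    simp only [Val.size]
    lia

theorem encNode_eq (A : I.Node x ε) : I.encNode x ε A =
    .list (((List.finRange n).filter fun p => decide (I.node x ε p = A)).map
      fun p : Fin n => Val.nat p.1) := by
  simp [encNode, ← List.map_eq_flatMap, List.map_map, Function.comp_def]

theorem size_encNodes_le : (I.encNodes x ε T).size ≤ n * (n * (2 * n + 2) + 2) + 1 := by
  refine Val.size_list_le ?_ fun v hv => ?_
  · rw [List.length_map]
    refine (List.length_filter_le _ _).trans ((List.dedup_sublist _).length_le.trans ?_)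
    rw [List.length_map, List.length_finRange]
  · obtain ⟨A, -, rfl⟩ := List.mem_map.1 hv
    rw [encNode_eq]
    refine Val.size_list_le ?_ fun v hv => ?_
    · rw [List.length_map]
      exact (List.length_filter_le _ _).trans (List.length_finRange).le
    · obtain ⟨p, -, rfl⟩ := List.mem_map.1 hv
      rw [Val.size_nat]
      have := p.2
      lia

/-- The input without the vector `z`. -/
def encShort (I : Instance n) (M : ℕ) (x : I.Link → ℝ) (ε : ℝ) (T : Set (I.Node x ε)) : Val :=
  .pair (.nat n) (.pair (.nat M) (.pair I.encTree (.pair I.encCosts (I.encNodes x ε T))))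

/-- Both the input without z and the budget are bounded by a fixed power of n ^ M if 2 ≤ n. For n =
1 such powers are useless, but there any size parameter will do. -/
theorem exists_affordable {M : ℕ} (hM : 1 ≤ M) (b : ℕ) : ∃ s, 2 ≤ s ∧
    Affordable b s (I.encShort M x ε T) ∧ (2 ≤ n → s ≤ (n ^ M) ^ (b + 8)) := by
  have hn : 1 ≤ n := by have := I.length_edgeList_add_one; lia
  rcases Nat.lt_or_ge n 2 with hn2 | hn2
  · exact ⟨(I.encShort M x ε T).size + (2 * n ^ (b * M + 1) + 1) + 2, by lia,
      ⟨by lia, n, M, hn, rfl, rfl, by lia⟩, fun h => by lia⟩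
  · set N := n ^ M with hN
    have hnN : n ≤ N := Nat.le_self_pow (by lia) n
    have hMN : M ≤ N := (Nat.lt_pow_self (by lia)).le
    have hN2 : 2 ≤ N := hn2.trans hnN
    have h2 : 2 ^ 5 ≤ N ^ 5 := Nat.pow_le_pow_left hN2 5
    have h8 : N ^ 8 ≤ N ^ (b + 8) := Nat.pow_le_pow_right (by lia) (by lia)
    refine ⟨N ^ (b + 8), hN2.trans (Nat.le_self_pow (by lia) N), ⟨?_, n, M, hn, rfl, rfl, ?_⟩,
      fun _ => le_rfl⟩
    · have e1 := I.size_encTree_le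
      have e2 := I.size_encCosts_le
      have e3 := I.size_encNodes_le (x := x) (ε := ε) (T := T)
      simp only [encShort, Val.size, Val.size_nat]
      have f1 : n * (4 * n + 4) ≤ N * (4 * N + 4) := by gcongr
      have f2 : n ^ 2 * (4 * n + 6) ≤ N ^ 2 * (4 * N + 6) := by gcongr
      have f3 : n * (n * (2 * n + 2) + 2) ≤ N * (N * (2 * N + 2) + 2) := by gcongr
      have g1 : 2 * N ≤ N ^ 2 := by nlinarith
      have g2 : 2 * N ^ 2 ≤ N ^ 3 := by nlinarith
      have g3 : 32 * N ^ 3 ≤ N ^ 8 := by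
        rw [show N ^ 8 = N ^ 5 * N ^ 3 by ring]
        exact Nat.mul_le_mul_right _ h2
      have g4 : N * (4 * N + 4) = 4 * N ^ 2 + 4 * N := by ring
      have g5 : N ^ 2 * (4 * N + 6) = 4 * N ^ 3 + 6 * N ^ 2 := by ring
      have g6 : N * (N * (2 * N + 2) + 2) = 2 * N ^ 3 + 2 * N ^ 2 + 2 * N := by ring
      lia
    · have g1 : n ^ (b * M + 1) ≤ N ^ (b + 1) := by
        rw [pow_succ, pow_succ, mul_comm b, pow_mul]
        exact Nat.mul_le_mul_left _ hnN
      have g2 : N ^ (b + 8) = N ^ 7 * N ^ (b + 1) := by ring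
      have g3 : 2 ^ 7 ≤ N ^ 7 := Nat.pow_le_pow_left hN2 7
      have g4 := Nat.mul_le_mul_right (N ^ (b + 1)) g3
      have g5 : 1 ≤ N ^ (b + 1) := Nat.one_le_pow _ _ (by lia)
      lia

end Instance

/-- There is a program that runs the algorithm in time `n ^ O(M)`. -/
theorem exists_prog (b : ℕ) : ∃ (P : Prog) (C : ℕ), ∀ (n M : ℕ) (I : Instance n), 1 ≤ M →
    ∀ (ε : ℝ) (x : I.Link → ℝ) (T : Set (I.Node x ε))
      (z : Sym2 (Fin n) × Sym2 (I.Node x ε) → ℝ), ∃ t,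
      Run P (I.encInput M ε x T z) (Val.algorithm (Val.budget b (.nat n) (.nat M)) I.encTree
        I.encCosts (I.encNodes x ε T)) t ∧ (2 ≤ n → t ≤ n ^ (C * M)) := by
  obtain ⟨p, d, hp⟩ := PolyTime.main b
  -- The main program takes at most s ^ d steps with s at most (n ^ M) ^ (b + 8). The summand 6 pays
  -- for the at most 21 steps of projection and composition.
  refine ⟨.comp .project p, (b + 8) * d + 6, fun n M I hM ε x T z => ?_⟩
  obtain ⟨s, hs, hQ, hle⟩ := I.exists_affordable (x := x) (ε := ε) (T := T) hM b
  obtain ⟨-, t, ht, hrun⟩ := hp s hs _ hQ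
  obtain ⟨t', ht', hrun'⟩ := exists_run_project (I.encInput M ε x T z)
  refine ⟨_, .comp hrun' hrun, fun hn => ?_⟩
  have h1 : s ^ d ≤ (n ^ M) ^ ((b + 8) * d) := by
    rw [pow_mul (n ^ M)]
    exact Nat.pow_le_pow_left (hle hn) d
  have hN : 2 ≤ n ^ M := hn.trans (Nat.le_self_pow (by lia) n)
  have h2 : 2 ^ 6 ≤ (n ^ M) ^ 6 := Nat.pow_le_pow_left hN 6
  rw [mul_comm, pow_mul, pow_add]
  have h3 : 1 ≤ (n ^ M) ^ ((b + 8) * d) := Nat.one_le_pow _ _ (by lia)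
  have h4 := Nat.mul_le_mul_left ((n ^ M) ^ ((b + 8) * d)) h2
  lia

end

end TreeAug

theorem mainTheorem5 (ε : ℝ) (hε : 0 < ε) :
    -- every part `insert r K` of a decomposed simple pair satisfies the bundle bound
    (∀ (n M γ : ℕ) (I : Instance n), 1 ≤ M →
      (∀ o ∈ I.origLinks, 1 ≤ I.cost o ∧ I.cost o ≤ M) →
      200 * (M : ℝ) / ε ^ 2 ≤ γ →
      ∀ x : I.Link → ℝ, I.IsOptimal γ x →
      ∀ L₀ : Finset I.Link, I.Covers L₀ (I.heavy x ε) →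
      ∀ (T : Set (I.Node x ε)) (z : Sym2 (Fin n) × Sym2 (I.Node x ε) → ℝ), I.IsPart M ε x T z →
      ∀ r : I.Node x ε, I.IsRoot M ε x T z r →
      ∀ K ∈ branches (I.contracted x ε) T r,
        (I.IsBundle γ (I.edgesOf x ε (insert r K)) ∨
          I.opt (I.edgesOf x ε (insert r K)) ≤ I.chargeOn x ε L₀ (insert r K)) ∧
        I.opt (I.edgesOf x ε (insert r K)) ≤
          totalCost I.cost (restrictTo (insert r K) (rootSplit (I.contracted x ε) T r z)) +
            I.chargeOn x ε L₀ (insert r K)) ∧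
    -- a cover of the edges of `T` can be computed in time `n ^ O(M)`
    (∃ (P : Prog) (C : ℕ),
      ∀ (n M γ : ℕ) (I : Instance n), 1 ≤ M →
      (∀ o ∈ I.origLinks, 1 ≤ I.cost o ∧ I.cost o ≤ M) →
      200 * (M : ℝ) / ε ^ 2 ≤ γ →
      ∀ x : I.Link → ℝ, I.IsOptimal γ x →
      ∀ (T : Set (I.Node x ε)) (z : Sym2 (Fin n) × Sym2 (I.Node x ε) → ℝ), I.IsPart M ε x T z →
      (∃ r : I.Node x ε, I.IsRoot M ε x T z r) →
      ∃ (S : List I.Link) (t : ℕ),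
        Run P (I.encInput M ε x T z) (I.encLinks S) t ∧
        (2 ≤ n → t ≤ n ^ (C * M)) ∧
        I.Covers (I.toSet S) (I.edgesOf x ε T) ∧
        ∀ L₀ : Finset I.Link, I.Covers L₀ (I.heavy x ε) →
        ∀ r : I.Node x ε, I.IsRoot M ε x T z r →
          I.setCost (I.toSet S) ≤
            totalCost I.cost (inPart (I.contracted x ε) T r z) +
              2 * totalCost I.cost (crossPart (I.contracted x ε) T r z) +
              I.chargeOn x ε L₀ T) := by
  refine ⟨?_, ?_⟩
  · intro n M γ I hM hc hγ x hx L₀ hL₀ T z hz r hr K hK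
    have hc0 : ∀ o ∈ I.origLinks, 0 ≤ I.cost o := fun o ho => zero_le_one.trans (hc o ho).1
    obtain ⟨φ, hφ⟩ := Instance.exists_isImage hx.1.nonneg hz
    obtain ⟨a, b, h⟩ := Instance.exists_isRootEdge hφ.connected hr.1 hK
    have hor := (h.isBundle_or_opt_le hφ hε hM hc hγ hx.1 hL₀ hr).imp_right fun ho =>
      ho.trans (Instance.chargeOn_mono hc0 L₀ (Set.subset_insert r K))
    have hcost := costMeeting_le_totalCost hφ.nonneg (hφ.cost_nonneg_or hc0) hφ.mem_of_ne_zero hK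
    refine ⟨hor, ?_⟩
    rcases hor with hb | ho
    · exact (((Instance.opt_le_coverCost hx.1 hb).trans
        (h.coverCost_le_costMeeting hφ hc0 hx.1.nonneg)).trans hcost).trans
        (le_add_of_nonneg_right (Instance.chargeOn_nonneg hc0 L₀ _))
    · refine ho.trans (le_add_of_nonneg_left (le_trans ?_ hcost))
      exact Finset.sum_nonneg fun l _ => hφ.cost_mul_nonneg hc0 l
  -- This b depends on ε only, and b * M is at least the bound β on the number of leaves of a
  -- branch.
  · obtain ⟨P, C, hP⟩ := exists_prog ⌈48 / ε ^ 2⌉₊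
    refine ⟨P, C, fun n M γ I hM hc hγ x hx T z hz hroot => ?_⟩
    obtain ⟨t, hrun, ht⟩ := hP n M I hM ε x T z
    obtain ⟨S, hS, hcov, hcost⟩ := Instance.algorithm_spec hε hM hc hγ hx.1 hz hroot
      (Nat.le_ceil (48 / ε ^ 2)) (Val.length_budget _ n M)
    exact ⟨S, t, hS ▸ hrun, ht, hcov, hcost⟩
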